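/- **Definitions.** A ball tangle is a proper $1$-dimensional submanifold of a $3$-ball with four fixed endpoints NW, NE, SE, SW on the boundary sphere; a spherical tangle is a proper $1$-dimensional submanifold of $S^2\times[0,1]$ (a ball with one hole, seen in the projection plane) with four such endpoints on each of the two boundary spheres, the outside and the inside hole. Both are given by diagrams; diagrams are equivalent if they are connected by finitely many tangle Reidemeister moves, i.e. moves I, II, III and, for spherical tangles, move IV, which moves an arc over or under the inside hole. The identity spherical tangle $I$ consists of four radial segments. For a spherical tangle diagram $S$ and $i,j\in\{1,2\}$ let $S_{ij}$ be the link diagram obtained from $S$ by taking the numerator closure (NW–NE, SW–SE) if $i=1$ or the denominator closure (NW–SW, NE–SE) if $i=2$ on the outside, and by filling the inside hole with two vertical arcs (NW–SW, NE–SE) if $j=1$ or two horizontal arcs (NW–NE, SW–SE) if $j=2$. Let $\langle\cdot\rangle$ be the Kauffman bracket $\langle L\rangle=\sum_\sigma A^{\alpha(\sigma)-\beta(\sigma)}(-A^2-A^{-2})^{d(\sigma)-1}$ at $A=e^{i\pi/4}$, where $\sigma$ runs over the states of $L$, $\alpha(\sigma)$ and $\beta(\sigma)$ are the numbers of $A$-type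 and $B$-type splittings, and $d(\sigma)$ is the number of circles. The invariant $$F(S)=\left\{\begin{pmatrix} z\langle S_{11}\rangle & -\mathrm i z\langle S_{12}\rangle\\ \mathrm i z\langle S_{21}\rangle & z\langle S_{22}\rangle\end{pmatrix} : z\in\mathbb C,\ z^8=1\right\}\cap M_{2\times2}(\mathbb Z)$$ is a set $\{M,-M\}$, and $\det F(S):=\det M$. For ball or spherical tangles, at most one of them spherical, $A+_hB$ (outer horizontal connect sum) puts $A$ to the left of $B$ and joins NE, SE of $A$ with NW, SW of $B$; $A+_vB$ (outer vertical connect sum) puts $A$ on top of $B$ and joins SW, SE of $A$ with NW, NE of $B$. Let $S^-$ be $S$ with inside and outside interchanged by $(\theta,z,t)\mapsto(\theta,-z,1-t)$ on $S^2\times[0,1]$, where $\theta$ is the angle in the projection plane and $z$ the height over it. For a ball tangle $B$ let $B^{h-}$ and $B^{v-}$ be its $180^\circ$ rotations about the vertical and the horizontal axis of the projection plane. The inner connect sums are, for $*=h,v$, $B\,\overline{+}_*\,S=(S^-+_*B^{*-})^-$ and $S\,\overline{+}_*\,B=(B^{*-}+_*S^-)^-$. Let $S^{r_1}$ and $S^{r_2}$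 be $S$ with only the inside, respectively only the outside, hole rotated by $90^\circ$ counterclockwise in the projection plane. Let $J$ be a spherical tangle. A spherical tangle $S$ is $J$-reducible if there are $n\ge1$, ball or spherical tangles $A_1,\dots,A_{n+1}$ and operations $*_1,\dots,*_n$, each of them one of $+_h,+_v,\overline{+}_h,\overline{+}_v$ or the opposite of one of these ($A*^{op}B=B*A$), such that all operations in $(\cdots((A_1*_1A_2)*_2A_3)\cdots)*_nA_{n+1}$ are defined, the result is equivalent to $S$, and exactly one of $A_1,\dots,A_{n+1}$ is a spherical tangle that becomes equivalent to $J$ after some (possibly no) operations $(\cdot)^{r_1}$, $(\cdot)^{r_2}$. **Theorem.** If a spherical tangle $S$ is $I$-reducible, then $\det F(S)=n^2$ for some $n\in\mathbb Z$. More generally, if $S$ is $J$-reducible for a spherical tangle $J$, then $\det F(S)=n^2\det F(J)$ for some $n\in\mathbb Z$. -/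

import Mathlib

namespace Tangle

/-! Tangle diagrams are encoded by labelled planar-diagram codes. -/

/-- A diagram whose free endpoints are indexed by `β`: finitely many crossings `X`, finitely many
edges `E`, and for each crossing its four incident edges, listed counterclockwise on the projection
plane, positions `0` and `2` being the two ends of the under-strand and positions `1` and `3` the
two ends of the over-strand. An edge that is met nowhere is a circle without crossings. -/
structure Diagram (β : Type) where
  X : Type
  E : Type
  [finX : Fintype X]
  [finE : Finite E]
  cross : X → Fin 4 → E
  bd : β → E

attribute [instance] Diagram.finX Diagram.finE

namespace Diagram

variable {β β' γ : Type}

/-- The set of edge-ends of a diagram: four at each crossing, and the free endpoints. -/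
abbrev Slot (D : Diagram β) : Type := (D.X × Fin 4) ⊕ β

/-- The edge to which an edge-end belongs. -/
def edge (D : Diagram β) : D.Slot → D.E
  | Sum.inl (x, k) => D.cross x k
  | Sum.inr b => D.bd b

/-- Renaming (or forgetting) of free endpoints. -/
def relabel (D : Diagram β) (f : β' → β) : Diagram β' where
  X := D.X
  E := D.E
  cross := D.cross
  bd := fun b => D.bd (f b)

/-- Disjoint union of two diagrams. -/
def disj (D : Diagram β) (D' : Diagram β') : Diagram (β ⊕ β') where
  X := D.X ⊕ D'.X
  E := D.E ⊕ D'.E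
  cross := Sum.elim (fun x k => Sum.inl (D.cross x k)) (fun x k => Sum.inr (D'.cross x k))
  bd := Sum.map D.bd D'.bd

/-- Connecting, for every pair `(a, b) ∈ P`, the free endpoints `a` and `b` by an arc without
crossings: the edges ending there become one edge. (The used endpoints are to be forgotten
afterwards by `relabel`.) -/
def join (D : Diagram β) (P : Set (β × β)) : Diagram β where
  X := D.X
  E := Quot fun e e' : D.E => ∃ p ∈ P, e = D.bd p.1 ∧ e' = D.bd p.2
  cross := fun x k => Quot.mk _ (D.cross x k)
  bd := fun b => Quot.mk _ (D.bd b)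

/-- The diagram turned over, i.e. seen from a direction for which the orientation of the
projection surface is reversed and over- and under-strands are exchanged; the endpoints keep
their names. -/
def turnOver (D : Diagram β) : Diagram β where
  X := D.X
  E := D.E
  cross := fun x k => D.cross x k.rev
  bd := D.bd

/-! ### The Kauffman bracket of a link diagram -/

/-- Identifications of edges caused by a state `σ` (`true` is the `A`-type splitting, which
connects the two regions swept by the over-strand when it is rotated counterclockwise). -/
def StateRel (D : Diagram β) (σ : D.X → Bool) (e e' : D.E) : Prop :=
  ∃ x, (σ x = true ∧ ((e = D.cross x 0 ∧ e' = D.cross x 1) ∨ (e = D.cross x 2 ∧ e' = D.cross x 3)))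
    ∨ (σ x = false ∧ ((e = D.cross x 1 ∧ e' = D.cross x 2) ∨ (e = D.cross x 3 ∧ e' = D.cross x 0)))

/-- The number of circles of the link diagram `L` split according to the state `σ`. -/
noncomputable def circles (L : Diagram Empty) (σ : L.X → Bool) : ℕ :=
  Nat.card (Quot (L.StateRel σ))

open Classical in
/-- The Kauffman bracket of a link diagram at `A`. -/
noncomputable def bracket (A : ℂ) (L : Diagram Empty) : ℂ :=
  ∑ σ : L.X → Bool,
    A ^ (Finset.univ.filter fun x => σ x = true).card *
      (A⁻¹) ^ (Finset.univ.filter fun x => σ x = false).card *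
      (-A ^ 2 - (A⁻¹) ^ 2) ^ (L.circles σ - 1)

/-! ### Reidemeister moves I, II, III

A local move replaces a small diagram `T` by `T'` inside a larger one; the rest of the larger
diagram is `C`. -/

/-- Insert the local diagram `T` in the complementary diagram `C`. -/
def insert (C : Diagram (β ⊕ γ)) (T : Diagram γ) : Diagram β :=
  ((C.disj T).join (Set.range fun g => (Sum.inl (Sum.inr g), Sum.inr g))).relabel
    (fun b => Sum.inl (Sum.inl b))

/-- An arc without crossing. -/
def arc : Diagram (Fin 2) where
  X := Empty
  E := Unit
  cross := fun x _ => x.elim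
  bd := fun _ => ()

/-- An arc with one curl; the curl runs from position `k` to position `k + 1` of the crossing. -/
def curl (k : Fin 4) : Diagram (Fin 2) where
  X := Unit
  E := Fin 3
  cross := fun _ l => ![2, 2, 0, 1] (l - k)
  bd := ![0, 1]

/-- Two arcs without crossing, from endpoint `0` to `1` and from endpoint `2` to `3`. -/
def twoArcs : Diagram (Fin 4) where
  X := Empty
  E := Fin 2
  cross := fun x _ => x.elim
  bd := ![0, 0, 1, 1]

/-- Two arcs, the first one (edges `0, 1, 2`) passing over the second one (edges `3, 4, 5`) and
back, so that they bound a bigon. -/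
def bigon : Diagram (Fin 4) where
  X := Fin 2
  E := Fin 6
  cross := ![![3, 1, 4, 0], ![4, 1, 5, 2]]
  bd := ![0, 2, 3, 5]

/-- Three pairwise crossing arcs: a top one (edges `0, 1, 2`), a middle one (edges `3, 4, 5`) and
a bottom one (edges `6, 7, 8`), the top one passing on one side of the crossing of the other two.
The crossings are top-middle, top-bottom, middle-bottom. -/
def triangle : Diagram (Fin 6) where
  X := Fin 3
  E := Fin 9
  cross := ![![3, 1, 4, 0], ![6, 2, 7, 1], ![7, 5, 8, 4]]
  bd := ![0, 2, 3, 5, 6, 8]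

/-- The same three arcs, the top one passing on the other side of the crossing of the other
two. -/
def triangle' : Diagram (Fin 6) where
  X := Fin 3
  E := Fin 9
  cross := ![![4, 2, 5, 1], ![7, 1, 8, 0], ![6, 4, 7, 3]]
  bd := ![0, 2, 3, 5, 6, 8]

/-- Reflection of the projection plane in a line (over-strands stay over-strands). -/
def reflect (D : Diagram β) : Diagram β where
  X := D.X
  E := D.E
  cross := fun x k => D.cross x (-k)
  bd := D.bd

/-- `D'` is `D` with crossings and edges renamed. At a crossing the position `0` may be either
end of the under-strand. -/
def Iso (D D' : Diagram β) : Prop :=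
  ∃ (f : D.X ≃ D'.X) (g : D.E ≃ D'.E),
    (∀ x, (∀ k, D'.cross (f x) k = g (D.cross x k)) ∨
      (∀ k, D'.cross (f x) k = g (D.cross x (k + 2)))) ∧
    ∀ b, D'.bd b = g (D.bd b)

/-- Renaming and the Reidemeister moves of types I, II and III. -/
inductive Move : Diagram β → Diagram β → Prop
  | iso (D D' : Diagram β) : Iso D D' → Move D D'
  | typeI (C : Diagram (β ⊕ Fin 2)) (k : Fin 4) : Move (C.insert arc) (C.insert (curl k))
  | typeII (C : Diagram (β ⊕ Fin 4)) : Move (C.insert twoArcs) (C.insert bigon)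
  | typeIII (C : Diagram (β ⊕ Fin 6)) : Move (C.insert triangle) (C.insert triangle')
  | typeIII' (C : Diagram (β ⊕ Fin 6)) :
      Move (C.insert triangle.reflect) (C.insert triangle'.reflect)

end Diagram

open Diagram

/-! ### Punctured ball tangle diagrams -/

/-- Diagram of a punctured ball tangle with set of holes `κ` and four endpoints on each boundary
sphere. On the outer boundary (`Sum.inl`) and on the boundary of each hole `h`
(`Sum.inr (h, ·)`) the endpoints `0, 1, 2, 3` are those at NW, NE, SE, SW. -/
abbrev PTangle (κ : Type) : Type 1 := Diagram (Fin 4 ⊕ κ × Fin 4)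

/-- Ball tangle diagrams: no hole. -/
abbrev BT : Type 1 := PTangle Empty

/-- Spherical tangle diagrams: one hole. -/
abbrev ST : Type 1 := PTangle Unit

namespace PTangle

variable {κ κ' : Type}

/-- The next edge-end in the counterclockwise direction around a crossing, a hole, or the outside
of the diagram. The outside is regarded as a disk on the sphere, whence the other direction
there. -/
def next (D : PTangle κ) : D.Slot → D.Slot
  | Sum.inl (x, k) => Sum.inl (x, k + 1)
  | Sum.inr (Sum.inl k) => Sum.inr (Sum.inl (k + 1))
  | Sum.inr (Sum.inr (h, k)) => Sum.inr (Sum.inr (h, k - 1))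

/-- `t` is the end other than `s` of the edge to which `s` belongs. -/
def OtherEnd (D : PTangle κ) (s t : D.Slot) : Prop := t ≠ s ∧ D.edge t = D.edge s

/-- Vertices (crossings, holes, the outside), as orbits of `next`. -/
def Vertices (D : PTangle κ) : Type := Quot fun s t : D.Slot => t = next D s

/-- Faces, as orbits of "go to the other end of the edge, then turn to the next edge". -/
def Faces (D : PTangle κ) : Type :=
  Quot fun s t : D.Slot => ∃ u, OtherEnd D s u ∧ t = next D u

/-- Connected components (disregarding circles without crossings). -/
def Components (D : PTangle κ) : Type :=
  Quot fun s t : D.Slot => t = next D s ∨ D.edge t = D.edge s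

/-- The diagram can be drawn in the disk with the holes removed: every edge has exactly two ends
or (for a circle without crossings) none, and the Euler characteristic is that of a disjoint union
of spheres, one for each component. -/
def IsPlanar (D : PTangle κ) : Prop :=
  (∀ s : D.Slot, ∃! t, OtherEnd D s t) ∧
    Nat.card (Vertices D) + Nat.card (Faces D) =
      Nat.card (Set.range D.edge) + 2 * Nat.card (Components D)

/-- Renaming of holes. -/
def mapHoles (D : PTangle κ) (i : κ' → κ) : PTangle κ' :=
  Diagram.relabel D (Sum.map id (Prod.map i id))

/-- Rotation of the whole diagram by 90° counterclockwise. -/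
def rot (D : PTangle κ) : PTangle κ :=
  Diagram.relabel D (Sum.map (· + 1) (Prod.map id (· + 1)))

/-- Horizontal connect sum: `D` to the left of `D'`. -/
def hsum (D : PTangle κ) (D' : PTangle κ') : PTangle (κ ⊕ κ') :=
  ((Diagram.disj D D').join
    {(Sum.inl (Sum.inl 1), Sum.inr (Sum.inl 0)), (Sum.inl (Sum.inl 2), Sum.inr (Sum.inl 3))}).relabel
    (Sum.elim
      ![Sum.inl (Sum.inl 0), Sum.inr (Sum.inl 1), Sum.inr (Sum.inl 2), Sum.inl (Sum.inl 3)]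
      fun p => match p with
        | (Sum.inl h, k) => Sum.inl (Sum.inr (h, k))
        | (Sum.inr h, k) => Sum.inr (Sum.inr (h, k)))

/-- Vertical connect sum: `D` on top of `D'`. -/
def vsum (D : PTangle κ) (D' : PTangle κ') : PTangle (κ ⊕ κ') :=
  rot (rot (rot (hsum (rot D) (rot D'))))

end PTangle

open PTangle

/-! ### Ball tangles -/

namespace BT

def hsum (B B' : BT) : BT := mapHoles (PTangle.hsum B B') Empty.elim

def vsum (B B' : BT) : BT := mapHoles (PTangle.vsum B B') Empty.elim

/-- `B^{h-}`: rotation by 180° about the vertical axis of the projection plane. -/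
def hFlip (B : BT) : BT := (Diagram.turnOver B).relabel (Sum.map ![1, 0, 3, 2] id)

/-- `B^{v-}`: rotation by 180° about the horizontal axis of the projection plane. -/
def vFlip (B : BT) : BT := (Diagram.turnOver B).relabel (Sum.map ![3, 2, 1, 0] id)

end BT

/-! ### Spherical tangles -/

namespace ST

/-- The identity spherical tangle. -/
def I : ST where
  X := Empty
  E := Fin 4
  cross := fun x _ => x.elim
  bd := Sum.elim id Prod.snd

/-- `S^{r₁}`: rotation of the inside hole only, by 90° counterclockwise. -/
def r₁ (S : ST) : ST := Diagram.relabel S (Sum.map id (Prod.map id (· + 1)))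

/-- `S^{r₂}`: rotation of the outside hole only, by 90° counterclockwise. -/
def r₂ (S : ST) : ST := Diagram.relabel S (Sum.map (· + 1) id)

/-- `S^-`: interchange of the inside hole and the outside hole. In `S² × [0,1]`, with `S²` over the
equator of the projection plane, this is `(θ, z, t) ↦ (θ, -z, 1 - t)`. -/
def inv (S : ST) : ST :=
  (Diagram.turnOver S).relabel (Sum.elim (fun k => Sum.inr ((), k)) fun p => Sum.inl p.2)

/-- `B +_h S`, the first outer horizontal connect sum. -/
def outerH₁ (B : BT) (S : ST) : ST := mapHoles (PTangle.hsum B S) Sum.inr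

/-- `S +_h B`, the second outer horizontal connect sum. -/
def outerH₂ (S : ST) (B : BT) : ST := mapHoles (PTangle.hsum S B) Sum.inl

/-- `B +_v S`, the first outer vertical connect sum. -/
def outerV₁ (B : BT) (S : ST) : ST := mapHoles (PTangle.vsum B S) Sum.inr

/-- `S +_v B`, the second outer vertical connect sum. -/
def outerV₂ (S : ST) (B : BT) : ST := mapHoles (PTangle.vsum S B) Sum.inl

/-- The first inner horizontal connect sum of `B` and `S`: `(S^- +_h B^{h-})^-`. -/
def innerH₁ (B : BT) (S : ST) : ST := inv (outerH₂ (inv S) (BT.hFlip B))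

/-- The second inner horizontal connect sum of `B` and `S`: `(B^{h-} +_h S^-)^-`. -/
def innerH₂ (S : ST) (B : BT) : ST := inv (outerH₁ (BT.hFlip B) (inv S))

/-- The first inner vertical connect sum of `B` and `S`: `(S^- +_v B^{v-})^-`. -/
def innerV₁ (B : BT) (S : ST) : ST := inv (outerV₂ (inv S) (BT.vFlip B))

/-- The second inner vertical connect sum of `B` and `S`: `(B^{v-} +_v S^-)^-`. -/
def innerV₂ (S : ST) (B : BT) : ST := inv (outerV₁ (BT.vFlip B) (inv S))

/-! The Reidemeister move of type IV: an arc is moved over or under the hole. -/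

/-- The hole with its four strands, and an arc beside it that does not cross them. Endpoints:
`Sum.inl i` and `Sum.inr (Sum.inl i)` are the ends of the `i`-th strand at the hole and away from
it, `Sum.inr (Sum.inr ·)` are the ends of the arc. -/
def holeAndArc : Diagram (Fin 4 ⊕ (Fin 4 ⊕ Fin 2)) where
  X := Empty
  E := Fin 4 ⊕ Unit
  cross := fun x _ => x.elim
  bd := Sum.elim Sum.inl (Sum.elim Sum.inl fun _ => Sum.inr ())

/-- The hole with its four strands, and an arc that runs clockwise around the hole and crosses the
strands `j`, `j + 1`, `j + 2`, `j + 3` in this order, over them if `ov = true` and under them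
otherwise. Edges: the inner and the outer part of each strand, and the five parts of the arc. -/
def holeInArc (ov : Bool) (j : Fin 4) : Diagram (Fin 4 ⊕ (Fin 4 ⊕ Fin 2)) where
  X := Fin 4
  E := Fin 4 ⊕ (Fin 4 ⊕ Fin 5)
  cross := fun k l =>
    ![Sum.inl (j + k), Sum.inr (Sum.inr k.succ), Sum.inr (Sum.inl (j + k)),
      Sum.inr (Sum.inr k.castSucc)] (if ov then l else l + 1)
  bd := Sum.elim Sum.inl
    (Sum.elim (fun i => Sum.inr (Sum.inl i)) fun a => Sum.inr (Sum.inr (![0, 4] a)))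

/-- Insert a neighbourhood `T` of the hole in the complementary diagram `C`. -/
def insertHole {γ : Type} (C : Diagram (Fin 4 ⊕ γ)) (T : Diagram (Fin 4 ⊕ γ)) : ST :=
  ((C.disj T).join (Set.range fun g => (Sum.inl (Sum.inr g), Sum.inr (Sum.inr g)))).relabel
    (Sum.elim (fun k => Sum.inl (Sum.inl k)) fun p => Sum.inr (Sum.inl p.2))

/-- Tangle Reidemeister moves of spherical tangle diagrams, including type IV. -/
inductive Move : ST → ST → Prop
  | classical (S S' : ST) : Diagram.Move S S' → Move S S'
  | typeIV (C : Diagram (Fin 4 ⊕ (Fin 4 ⊕ Fin 2))) (ov : Bool) (j : Fin 4) :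
      Move (insertHole C holeAndArc) (insertHole C (holeInArc ov j))

/-- Two diagrams are equivalent (of the same isotopy type) if they are connected by a finite
sequence of tangle Reidemeister moves between planar diagrams. -/
def Equivalent : ST → ST → Prop :=
  Relation.EqvGen fun S S' => IsPlanar S ∧ IsPlanar S' ∧ Move S S'

/-! ### The invariant `F` -/

/-- Pairs of endpoints connected by the two horizontal arcs, and by the two vertical arcs. -/
def hPairs : Set (Fin 4 × Fin 4) := {(0, 1), (3, 2)}

def vPairs : Set (Fin 4 × Fin 4) := {(0, 3), (1, 2)}

/-- The link `S_{ij}` (with `0`, `1` in place of `1`, `2`): the numerator closure (`i = 0`, NW with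
NE, SW with SE) or denominator closure (`i = 1`, NW with SW, NE with SE) of `S` whose hole is
filled by the first fundamental tangle (`j = 0`, two vertical arcs) or the second one (`j = 1`, two
horizontal arcs). -/
def link (S : ST) (i j : Fin 2) : Diagram Empty :=
  (Diagram.join S
    ((fun p => (Sum.inl p.1, Sum.inl p.2)) '' (![hPairs, vPairs] i) ∪
      (fun p => (Sum.inr ((), p.1), Sum.inr ((), p.2))) '' (![vPairs, hPairs] j))).relabel
    Empty.elim

/-- The Kauffman bracket of `S_{ij}` at `A = e^{iπ/4}`. -/
noncomputable def br (S : ST) (i j : Fin 2) : ℂ :=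
  bracket (Complex.exp (Complex.I * Real.pi / 4)) (link S i j)

/-- The invariant `F(S)`, an element of `PM_{2×2}(ℤ)`, i.e. a set `{M, -M}` of integer matrices:
the integer matrices among the multiples by 8-th roots of unity of the matrix of brackets. -/
def F (S : ST) : Set (Matrix (Fin 2) (Fin 2) ℤ) :=
  {M | ∃ z : ℂ, z ^ 8 = 1 ∧
    M.map (fun a : ℤ => (a : ℂ)) =
      !![z * br S 0 0, -Complex.I * z * br S 0 1;
         Complex.I * z * br S 1 0, z * br S 1 1]}

end ST

/-! ### Reducibility -/

/-- A ball tangle diagram or a spherical tangle diagram. -/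
inductive Piece : Type 1
  | ball (B : BT)
  | sph (S : ST)

namespace Piece

def IsPlanar : Piece → Prop
  | ball B => PTangle.IsPlanar B
  | sph S => PTangle.IsPlanar S

/-- `+_h`. Connect sums of two spherical tangles are not (ball or spherical) tangles. -/
def outerH : Piece → Piece → Option Piece
  | ball B, ball B' => some (ball (BT.hsum B B'))
  | ball B, sph S => some (sph (ST.outerH₁ B S))
  | sph S, ball B => some (sph (ST.outerH₂ S B))
  | sph _, sph _ => none

/-- `+_v`. -/
def outerV : Piece → Piece → Option Piece
  | ball B, ball B' => some (ball (BT.vsum B B'))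
  | ball B, sph S => some (sph (ST.outerV₁ B S))
  | sph S, ball B => some (sph (ST.outerV₂ S B))
  | sph _, sph _ => none

/-- The inner horizontal connect sum, defined for a ball tangle and a spherical tangle. -/
def innerH : Piece → Piece → Option Piece
  | ball B, sph S => some (sph (ST.innerH₁ B S))
  | sph S, ball B => some (sph (ST.innerH₂ S B))
  | _, _ => none

/-- The inner vertical connect sum, defined for a ball tangle and a spherical tangle. -/
def innerV : Piece → Piece → Option Piece
  | ball B, sph S => some (sph (ST.innerV₁ B S))
  | sph S, ball B => some (sph (ST.innerV₂ S B))
  | _, _ => none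

end Piece

/-- Names of the eight connect sum operations. -/
inductive Op
  | outerH | outerHOp | outerV | outerVOp | innerH | innerHOp | innerV | innerVOp

/-- The (partial) operation with a given name. -/
def Op.apply : Op → Piece → Piece → Option Piece
  | outerH, P, Q => P.outerH Q
  | outerHOp, P, Q => Q.outerH P
  | outerV, P, Q => P.outerV Q
  | outerVOp, P, Q => Q.outerV P
  | innerH, P, Q => P.innerH Q
  | innerHOp, P, Q => Q.innerH P
  | innerV, P, Q => P.innerV Q
  | innerVOp, P, Q => Q.innerV P

/-- `(⋯(A₀ *₀ A₁) *₁ ⋯) *ₙ₋₁ Aₙ`, if all the operations are defined. -/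
def evalSums : (n : ℕ) → (Fin (n + 1) → Piece) → (Fin n → Op) → Option Piece
  | 0, A, _ => some (A 0)
  | n + 1, A, op =>
    (evalSums n (fun i => A i.castSucc) (fun i => op i.castSucc)).bind fun P =>
      (op (Fin.last n)).apply P (A (Fin.last (n + 1)))

/-- `P` is a spherical tangle that is equivalent to `J` after some operations `r₁`, `r₂`. -/
def IsRotationOf (J : ST) : Piece → Prop
  | Piece.ball _ => False
  | Piece.sph K => ∃ a b : ℕ, ST.Equivalent (ST.r₂^[b] (ST.r₁^[a] K)) J

/-- `S` is `J`-reducible. -/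
def IsReducible (J S : ST) : Prop :=
  ∃ (n : ℕ) (A : Fin (n + 1) → Piece) (op : Fin n → Op) (S' : ST),
    1 ≤ n ∧ (∀ i, (A i).IsPlanar) ∧ evalSums n A op = some (Piece.sph S') ∧
      ST.Equivalent S S' ∧ ∃! i, IsRotationOf J (A i)

end Tangle

/-! At `A = e^{iπ/4}` the value `-A² - A⁻²` of an extra circle is zero. Hence the bracket of a link
diagram is, up to a power of `A`, the sum over the states with a single circle of `-i` to the number
of `B`-splittings (`bracket_A₈`). Everything is then a question of whether a relation on edges
generates a single class (`Total`), and a tangle glued into a larger diagram matters only through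
the partitions that its states induce on its endpoints (`total_glue_iff`).

A planar ball tangle `B` therefore behaves in every state sum like `a` times two horizontal arcs
plus `b` times two vertical arcs (`Expands`). In a horizontal sum of `B` with a spherical tangle,
the row of the numerator closure becomes `a · row₀ + b · row₁`, and the row of the denominator
closure becomes `a · row₁`, because there the vertical part of `B` splits off a circle
(`entry_outerH₁`, `entry_outerH₂`). With the phases built into `F` this is left multiplication by an
integer matrix with rows `(m, n)` and `(0, m)`, of determinant `m²`. All other sums arise from the
horizontal ones by rotations and by the exchange of inside and outside, which preserve the
determinant. So each sum multiplies the determinant by a square (`SquareMultiple`), starting from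
the only spherical piece.

Planarity is needed for integrality: for `a = w m`, `b = w i n` with `w⁸ = 1`, and for `F` to be
nonempty. A planar diagram has a checkerboard colouring (`exists_coloring`), hence an orientation of
its edges for which opposite ends at each vertex are both outgoing or both incoming
(`IsPlanar.exists_sourceSink`). Following the circles of a state permutes the outgoing ends. Each
`B`-splitting contributes a transposition, and a single circle means a single cycle of even length;
so all one-circle states have the same parity of `B`-splittings (`exists_sign`). Closing the outside
or filling a hole counts as a splitting there. For fixed closures the weights are thus all real or
all imaginary.

Finally, `F` is invariant because a Reidemeister move multiplies all four state sums by the same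
power of `-i`. This is a finite comparison of formal sums of partitions of the endpoints of a local
diagram (`localSum_eq_of_code`). -/

namespace Tangle

open Relation

/-! ### Relations that generate the total equivalence relation -/

/-- The equivalence relation generated by `R` has at most one class. -/
def Total {α : Type} (R : α → α → Prop) : Prop := ∀ a b, EqvGen R a b

section Relations

variable {α α' : Type} {R : α → α → Prop} {R' : α' → α' → Prop}

theorem eqvGen_map (f : α → α') (h : ∀ x y, R x y → EqvGen R' (f x) (f y)) {x y : α}
    (hxy : EqvGen R x y) : EqvGen R' (f x) (f y) := by
  induction hxy with
  | rel x y h' => exact h x y h'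
  | refl x => exact EqvGen.refl _
  | symm x y _ ih => exact EqvGen.symm _ _ ih
  | trans x y z _ _ ih ih' => exact EqvGen.trans _ _ _ ih ih'

theorem Total.mono {R' : α → α → Prop} (h : ∀ x y, R x y → EqvGen R' x y) (hR : Total R) :
    Total R' := fun a b => eqvGen_map id h (hR a b)

theorem total_congr {R' : α → α → Prop} (h : ∀ x y, R x y → EqvGen R' x y)
    (h' : ∀ x y, R' x y → EqvGen R x y) : Total R ↔ Total R' :=
  ⟨Total.mono h, Total.mono h'⟩

/-- A contraction `f` neither creates nor destroys connectedness if relations downstairs lift and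
the points that `f` merges are already equivalent upstairs. Joining edges and shrinking arcs are
maps of this kind. -/
theorem total_surj (f : α → α') (hf : Function.Surjective f)
    (h₁ : ∀ x y, R x y → EqvGen R' (f x) (f y))
    (h₂ : ∀ a b, R' a b → ∃ x y, f x = a ∧ f y = b ∧ EqvGen R x y)
    (h₃ : ∀ x y, f x = f y → EqvGen R x y) : Total R ↔ Total R' := by
  constructor
  · intro h a b
    obtain ⟨x, rfl⟩ := hf a
    obtain ⟨y, rfl⟩ := hf b
    exact eqvGen_map f h₁ (h x y)
  · intro h x y
    have key : ∀ a b, EqvGen R' a b → ∀ x y, f x = a → f y = b → EqvGen R x y := by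
      intro a b hab
      induction hab with
      | rel a b hab =>
        intro x y hx hy
        obtain ⟨x', y', rfl, rfl, hxy⟩ := h₂ a b hab
        exact (h₃ _ _ hx).trans _ _ _ (hxy.trans _ _ _ (h₃ _ _ hy.symm))
      | refl a => intro x y hx hy; exact h₃ _ _ (hx.trans hy.symm)
      | symm a b _ ih => intro x y hx hy; exact (ih y x hy hx).symm
      | trans a b c _ _ ih ih' =>
        intro x y hx hy
        obtain ⟨z, rfl⟩ := hf b
        exact (ih x z hx rfl).trans _ _ _ (ih' z y rfl hy)
    exact key _ _ (h (f x) (f y)) x y rfl rfl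

theorem total_equiv (f : α ≃ α') (h₁ : ∀ x y, R x y → EqvGen R' (f x) (f y))
    (h₂ : ∀ a b, R' a b → EqvGen R (f.symm a) (f.symm b)) : Total R ↔ Total R' :=
  total_surj f f.surjective h₁
    (fun a b h => ⟨f.symm a, f.symm b, f.apply_symm_apply a, f.apply_symm_apply b, h₂ a b h⟩)
    (fun x y h => by rw [f.injective h]; exact EqvGen.refl _)

theorem subsingleton_quot_iff : Subsingleton (Quot R) ↔ Total R := by
  constructor
  · intro h a b
    exact Quot.eqvGen_exact (Subsingleton.elim (Quot.mk R a) (Quot.mk R b))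
  · intro h
    refine ⟨fun a b => ?_⟩
    induction a using Quot.ind
    induction b using Quot.ind
    exact Quot.eqvGen_sound (h _ _)

end Relations

/-- The union of relations on `α` and `α'`, with `u g` and `v g` identified. -/
inductive Glue {α α' γ : Type} (R : α → α → Prop) (S : α' → α' → Prop) (u : γ → α) (v : γ → α') :
    α ⊕ α' → α ⊕ α' → Prop
  | left {x y : α} : R x y → Glue R S u v (Sum.inl x) (Sum.inl y)
  | right {x y : α'} : S x y → Glue R S u v (Sum.inr x) (Sum.inr y)
  | mid (g : γ) : Glue R S u v (Sum.inl (u g)) (Sum.inr (v g))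

/-- Every class of `S` contains some `v g`. -/
def Reached {α' γ : Type} (S : α' → α' → Prop) (v : γ → α') : Prop :=
  ∀ y, ∃ g, EqvGen S y (v g)

/-- `R` together with identifications of the points `u g` prescribed by `p`. -/
def With {α γ : Type} (R : α → α → Prop) (p : γ → γ → Prop) (u : γ → α) (x y : α) : Prop :=
  R x y ∨ ∃ g g', p g g' ∧ x = u g ∧ y = u g'

/-- The partition of `γ` induced by `S`. -/
def pull {α' γ : Type} (S : α' → α' → Prop) (v : γ → α') (g g' : γ) : Prop := EqvGen S (v g) (v g')

section Relations

variable {α α' γ : Type} {R : α → α → Prop} {S : α' → α' → Prop} {u : γ → α} {v : γ → α'}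

theorem With.left {p : γ → γ → Prop} {x y : α} (h : R x y) : EqvGen (With R p u) x y :=
  .rel _ _ (Or.inl h)

theorem With.right {p : γ → γ → Prop} {g g' : γ} (h : p g g') :
    EqvGen (With R p u) (u g) (u g') :=
  .rel _ _ (Or.inr ⟨g, g', h, rfl, rfl⟩)

theorem Glue.eqvGen_left {x y : α} (h : EqvGen R x y) :
    EqvGen (Glue R S u v) (Sum.inl x) (Sum.inl y) :=
  eqvGen_map Sum.inl (fun _ _ h => .rel _ _ (.left h)) h

theorem Glue.eqvGen_right {x y : α'} (h : EqvGen S x y) :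
    EqvGen (Glue R S u v) (Sum.inr x) (Sum.inr y) :=
  eqvGen_map Sum.inr (fun _ _ h => .rel _ _ (.right h)) h

theorem Glue.eqvGen_mid (g : γ) : EqvGen (Glue R S u v) (Sum.inl (u g)) (Sum.inr (v g)) :=
  .rel _ _ (.mid g)

/-- Seen from `α`, the other side serves only to connect points `u g`, so it may be replaced by the
partition it induces on `γ`, provided that it has no class of its own away from the glueing points.
If `α` were empty, such a class could be the only one; hence the assumption. -/
theorem total_glue_iff [Nonempty α] :
    Total (Glue R S u v) ↔ Reached S v ∧ Total (With R (pull S v) u) := by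
  constructor
  · intro h
    have hr : Reached S v := by
      intro y
      by_contra hy
      push Not at hy
      -- A class of `S` that contains no `v g` remains a class by itself after glueing, so it cannot
      -- reach `α`.
      have key : ∀ a b, EqvGen (Glue R S u v) a b →
          ((∃ z, a = Sum.inr z ∧ EqvGen S y z) ↔ (∃ z, b = Sum.inr z ∧ EqvGen S y z)) := by
        intro a b hab
        induction hab with
        | rel a b hab =>
          cases hab with
          | left h => simp
          | right h =>
            constructor
            · rintro ⟨z, hz, hz'⟩
              obtain rfl := Sum.inr_injective hz
              exact ⟨_, rfl, hz'.trans _ _ _ (.rel _ _ h)⟩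
            · rintro ⟨z, hz, hz'⟩
              obtain rfl := Sum.inr_injective hz
              exact ⟨_, rfl, hz'.trans _ _ _ (.symm _ _ (.rel _ _ h))⟩
          | mid g =>
            constructor
            · rintro ⟨z, hz, _⟩
              cases hz
            · rintro ⟨z, hz, hz'⟩
              obtain rfl := Sum.inr_injective hz
              exact absurd hz' (hy g)
        | refl a => rfl
        | symm a b _ ih => exact ih.symm
        | trans a b c _ _ ih ih' => exact ih.trans ih'
      obtain ⟨x⟩ := ‹Nonempty α›
      obtain ⟨z, hz, _⟩ := (key _ _ (h (Sum.inr y) (Sum.inl x))).1 ⟨y, rfl, .refl _⟩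
      cases hz
    refine ⟨hr, fun x x' => ?_⟩
    -- Sending each `y` to a point `u (k y)` with `v (k y)` in the class of `y` retracts the glued
    -- set onto `α`.
    choose k hk using hr
    have key := eqvGen_map (R' := With R (pull S v) u) (Sum.elim id fun y => u (k y)) ?_
      (h (Sum.inl x) (Sum.inl x'))
    · exact key
    · intro a b hab
      cases hab with
      | left h => exact With.left h
      | right h =>
        exact With.right (((hk _).symm _ _).trans _ _ _ ((EqvGen.rel _ _ h).trans _ _ _ (hk _)))
      | mid g => exact With.right (hk (v g))
  · rintro ⟨hr, h⟩
    have hl : ∀ x x' : α, EqvGen (Glue R S u v) (Sum.inl x) (Sum.inl x') := by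
      intro x x'
      refine eqvGen_map Sum.inl ?_ (h x x')
      rintro a b (hab | ⟨g, g', hg, rfl, rfl⟩)
      · exact .rel _ _ (.left hab)
      · exact (Glue.eqvGen_mid g).trans _ _ _
          ((Glue.eqvGen_right hg).trans _ _ _ ((Glue.eqvGen_mid g').symm))
    have hx : ∀ a : α ⊕ α', ∃ x : α, EqvGen (Glue R S u v) a (Sum.inl x) := by
      rintro (x | y)
      · exact ⟨x, .refl _⟩
      · obtain ⟨g, hg⟩ := hr y
        exact ⟨u g, (Glue.eqvGen_right hg).trans _ _ _ ((Glue.eqvGen_mid g).symm)⟩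
    intro a b
    obtain ⟨x, hx₁⟩ := hx a
    obtain ⟨x', hx₂⟩ := hx b
    exact hx₁.trans _ _ _ ((hl x x').trans _ _ _ (hx₂.symm))

end Relations

/-! ### State sums -/

/-- The weight of a state at `A = e^{iπ/4}`, up to a power of `A` not depending on the state. -/
noncomputable def wt {X : Type} [Fintype X] (σ : X → Bool) : ℂ :=
  ∏ x, if σ x = true then 1 else -Complex.I

theorem wt_sum {X Y : Type} [Fintype X] [Fintype Y] (σ : X → Bool) (τ : Y → Bool) :
    wt (Sum.elim σ τ) = wt σ * wt τ := by
  simp only [wt, Fintype.prod_sum_type]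
  rfl

theorem wt_equiv {X Y : Type} [Fintype X] [Fintype Y] (f : X ≃ Y) (σ : Y → Bool) :
    wt (fun x => σ (f x)) = wt σ := by
  simp only [wt]
  exact f.prod_comp fun y => if σ y = true then (1 : ℂ) else -Complex.I

open Classical in
/-- The sum of the weights of the states with property `P`. -/
noncomputable def stateSum {X : Type} [Fintype X] (P : (X → Bool) → Prop) : ℂ :=
  ∑ σ : X → Bool, if P σ then wt σ else 0

section stateSum

variable {X Y : Type} [Fintype X] [Fintype Y]

/-- The value does not depend on the decidability instances; needed to pass from classical sums to
computable ones. -/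
theorem stateSum_eq [DecidableEq X] (P : (X → Bool) → Prop) [DecidablePred P] :
    stateSum P = ∑ σ : X → Bool, if P σ then wt σ else 0 := by
  unfold stateSum
  refine Finset.sum_congr (by congr!) fun σ _ => by congr

theorem stateSum_congr {P P' : (X → Bool) → Prop} (h : ∀ σ, P σ ↔ P' σ) :
    stateSum P = stateSum P' := by
  rw [show P = P' from funext fun σ => propext (h σ)]

theorem stateSum_equiv (f : X ≃ Y) (P : (Y → Bool) → Prop) :
    stateSum P = stateSum fun σ : X → Bool => P fun y => σ (f.symm y) := by
  classical
  unfold stateSum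
  refine (Fintype.sum_equiv (f.arrowCongr (Equiv.refl Bool)) _ _ fun σ => ?_).symm
  have : wt σ = wt (fun y => σ (f.symm y)) := (wt_equiv f.symm σ).symm
  rw [this]
  rfl

open Classical in
theorem stateSum_sum (P : (X ⊕ Y → Bool) → Prop) :
    stateSum P = ∑ σ : X → Bool, wt σ * stateSum fun τ : Y → Bool => P (Sum.elim σ τ) := by
  rw [stateSum_eq]
  simp only [stateSum_eq]
  refine (Fintype.sum_equiv (Equiv.sumArrowEquivProdArrow X Y Bool) _
    (fun p => if P (Sum.elim p.1 p.2) then wt p.1 * wt p.2 else 0) ?_).trans ?_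
  rotate_left
  · rw [Fintype.sum_prod_type]
    refine Fintype.sum_congr _ _ fun σ => ?_
    rw [Finset.mul_sum]
    exact Fintype.sum_congr _ _ fun τ => by simp
  · intro σ
    have : Sum.elim (Equiv.sumArrowEquivProdArrow X Y Bool σ).1
        (Equiv.sumArrowEquivProdArrow X Y Bool σ).2 = σ := Sum.elim_comp_inl_inr σ
    simp only [← wt_sum, this]

end stateSum

namespace Diagram

variable {β β' γ : Type}

/-- The identifications of edges caused by the state `σ` and by joining of free endpoints that are
related by `Q`. -/
def Rel (D : Diagram β) (σ : D.X → Bool) (Q : β → β → Prop) : D.E → D.E → Prop :=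
  With (D.StateRel σ) Q D.bd

/-- The state `σ` of `D` closed according to `Q` consists of at most one circle. -/
def Conn (D : Diagram β) (σ : D.X → Bool) (Q : β → β → Prop) : Prop := Total (D.Rel σ Q)

/-- The weighted number of states of `D` closed according to `Q` with one circle. -/
noncomputable def wsum (D : Diagram β) (Q : β → β → Prop) : ℂ := stateSum fun σ => D.Conn σ Q

theorem conn_congr {D : Diagram β} {σ : D.X → Bool} {Q Q' : β → β → Prop}
    (h : ∀ p q, Q p q → EqvGen Q' p q) (h' : ∀ p q, Q' p q → EqvGen Q p q) :
    D.Conn σ Q ↔ D.Conn σ Q' := by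
  refine total_congr ?_ ?_
  · rintro x y (hxy | ⟨p, q, hpq, rfl, rfl⟩)
    · exact With.left hxy
    · exact eqvGen_map D.bd (fun _ _ => With.right) (h p q hpq)
  · rintro x y (hxy | ⟨p, q, hpq, rfl, rfl⟩)
    · exact With.left hxy
    · exact eqvGen_map D.bd (fun _ _ => With.right) (h' p q hpq)

theorem conn_relabel (D : Diagram β) (f : β' → β) (σ : D.X → Bool) (Q : β' → β' → Prop) :
    (D.relabel f).Conn σ Q ↔ D.Conn σ (Relation.Map Q f f) := by
  refine total_congr ?_ ?_
  · rintro x y (hxy | ⟨p, q, hpq, rfl, rfl⟩)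
    · exact With.left hxy
    · exact With.right (u := D.bd) ⟨p, q, hpq, rfl, rfl⟩
  · rintro x y (hxy | ⟨_, _, ⟨p, q, hpq, rfl, rfl⟩, rfl, rfl⟩)
    · exact With.left hxy
    · exact With.right (u := (D.relabel f).bd) hpq

theorem wsum_relabel (D : Diagram β) (f : β' → β) (Q : β' → β' → Prop) :
    (D.relabel f).wsum Q = D.wsum (Relation.Map Q f f) :=
  stateSum_congr fun σ => conn_relabel D f σ Q

theorem stateRel_join {D : Diagram β} {P : Set (β × β)} {σ : D.X → Bool} {e e' : D.E}
    (h : D.StateRel σ e e') : (D.join P).StateRel σ (Quot.mk _ e) (Quot.mk _ e') := by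
  obtain ⟨x, ⟨hx, ⟨rfl, rfl⟩ | ⟨rfl, rfl⟩⟩ | ⟨hx, ⟨rfl, rfl⟩ | ⟨rfl, rfl⟩⟩⟩ := h
  · exact ⟨x, Or.inl ⟨hx, Or.inl ⟨rfl, rfl⟩⟩⟩
  · exact ⟨x, Or.inl ⟨hx, Or.inr ⟨rfl, rfl⟩⟩⟩
  · exact ⟨x, Or.inr ⟨hx, Or.inl ⟨rfl, rfl⟩⟩⟩
  · exact ⟨x, Or.inr ⟨hx, Or.inr ⟨rfl, rfl⟩⟩⟩

theorem exists_of_stateRel_join {D : Diagram β} {P : Set (β × β)} {σ : D.X → Bool}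
    {a a' : (D.join P).E} (h : (D.join P).StateRel σ a a') :
    ∃ e e', Quot.mk _ e = a ∧ Quot.mk _ e' = a' ∧ D.StateRel σ e e' := by
  obtain ⟨x, ⟨hx, ⟨rfl, rfl⟩ | ⟨rfl, rfl⟩⟩ | ⟨hx, ⟨rfl, rfl⟩ | ⟨rfl, rfl⟩⟩⟩ := h
  · exact ⟨_, _, rfl, rfl, x, Or.inl ⟨hx, Or.inl ⟨rfl, rfl⟩⟩⟩
  · exact ⟨_, _, rfl, rfl, x, Or.inl ⟨hx, Or.inr ⟨rfl, rfl⟩⟩⟩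
  · exact ⟨_, _, rfl, rfl, x, Or.inr ⟨hx, Or.inl ⟨rfl, rfl⟩⟩⟩
  · exact ⟨_, _, rfl, rfl, x, Or.inr ⟨hx, Or.inr ⟨rfl, rfl⟩⟩⟩

/-- The quotient of edges made by `join` is a contraction along exactly the pairs that are added to
the closure on the right. It lets all glueing be expressed by closures of unglued diagrams. -/
theorem conn_join (D : Diagram β) (P : Set (β × β)) (σ : D.X → Bool) (Q : β → β → Prop) :
    (D.join P).Conn σ Q ↔ D.Conn σ (fun p q => (p, q) ∈ P ∨ Q p q) := by
  refine (total_surj (α := D.E) (Quot.mk _) Quot.exists_rep ?_ ?_ ?_).symm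
  · rintro x y (hxy | ⟨p, q, hpq | hpq, rfl, rfl⟩)
    · exact With.left (stateRel_join hxy)
    · rw [show (Quot.mk _ (D.bd p) : (D.join P).E) = Quot.mk _ (D.bd q) from
        Quot.sound ⟨_, hpq, rfl, rfl⟩]
      exact .refl _
    · exact With.right (u := (D.join P).bd) hpq
  · rintro a b (hab | ⟨p, q, hpq, rfl, rfl⟩)
    · obtain ⟨e, e', h, h', hee⟩ := exists_of_stateRel_join hab
      exact ⟨e, e', h, h', With.left hee⟩
    · exact ⟨D.bd p, D.bd q, rfl, rfl, With.right (Or.inr hpq)⟩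
  · intro x y hxy
    refine eqvGen_map id ?_ (Quot.eqvGen_exact hxy)
    rintro e e' ⟨p, hp, rfl, rfl⟩
    exact With.right (u := D.bd) (Or.inl hp)

theorem stateRel_disj_inl {D : Diagram β} {D' : Diagram β'} {σ : D.X → Bool} {τ : D'.X → Bool}
    {e e' : D.E} (h : D.StateRel σ e e') :
    (D.disj D').StateRel (Sum.elim σ τ) (Sum.inl e) (Sum.inl e') := by
  obtain ⟨x, ⟨hx, ⟨rfl, rfl⟩ | ⟨rfl, rfl⟩⟩ | ⟨hx, ⟨rfl, rfl⟩ | ⟨rfl, rfl⟩⟩⟩ := h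
  · exact ⟨Sum.inl x, Or.inl ⟨hx, Or.inl ⟨rfl, rfl⟩⟩⟩
  · exact ⟨Sum.inl x, Or.inl ⟨hx, Or.inr ⟨rfl, rfl⟩⟩⟩
  · exact ⟨Sum.inl x, Or.inr ⟨hx, Or.inl ⟨rfl, rfl⟩⟩⟩
  · exact ⟨Sum.inl x, Or.inr ⟨hx, Or.inr ⟨rfl, rfl⟩⟩⟩

theorem stateRel_disj_inr {D : Diagram β} {D' : Diagram β'} {σ : D.X → Bool} {τ : D'.X → Bool}
    {e e' : D'.E} (h : D'.StateRel τ e e') :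
    (D.disj D').StateRel (Sum.elim σ τ) (Sum.inr e) (Sum.inr e') := by
  obtain ⟨x, ⟨hx, ⟨rfl, rfl⟩ | ⟨rfl, rfl⟩⟩ | ⟨hx, ⟨rfl, rfl⟩ | ⟨rfl, rfl⟩⟩⟩ := h
  · exact ⟨Sum.inr x, Or.inl ⟨hx, Or.inl ⟨rfl, rfl⟩⟩⟩
  · exact ⟨Sum.inr x, Or.inl ⟨hx, Or.inr ⟨rfl, rfl⟩⟩⟩
  · exact ⟨Sum.inr x, Or.inr ⟨hx, Or.inl ⟨rfl, rfl⟩⟩⟩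
  · exact ⟨Sum.inr x, Or.inr ⟨hx, Or.inr ⟨rfl, rfl⟩⟩⟩

theorem stateRel_disj_cases {D : Diagram β} {D' : Diagram β'} {σ : D.X → Bool} {τ : D'.X → Bool}
    {a b : (D.disj D').E} (h : (D.disj D').StateRel (Sum.elim σ τ) a b) :
    (∃ e e', a = Sum.inl e ∧ b = Sum.inl e' ∧ D.StateRel σ e e') ∨
      ∃ e e', a = Sum.inr e ∧ b = Sum.inr e' ∧ D'.StateRel τ e e' := by
  obtain ⟨x | x, ⟨hx, ⟨rfl, rfl⟩ | ⟨rfl, rfl⟩⟩ | ⟨hx, ⟨rfl, rfl⟩ | ⟨rfl, rfl⟩⟩⟩ := h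
  · exact Or.inl ⟨_, _, rfl, rfl, x, Or.inl ⟨hx, Or.inl ⟨rfl, rfl⟩⟩⟩
  · exact Or.inl ⟨_, _, rfl, rfl, x, Or.inl ⟨hx, Or.inr ⟨rfl, rfl⟩⟩⟩
  · exact Or.inl ⟨_, _, rfl, rfl, x, Or.inr ⟨hx, Or.inl ⟨rfl, rfl⟩⟩⟩
  · exact Or.inl ⟨_, _, rfl, rfl, x, Or.inr ⟨hx, Or.inr ⟨rfl, rfl⟩⟩⟩
  · exact Or.inr ⟨_, _, rfl, rfl, x, Or.inl ⟨hx, Or.inl ⟨rfl, rfl⟩⟩⟩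
  · exact Or.inr ⟨_, _, rfl, rfl, x, Or.inl ⟨hx, Or.inr ⟨rfl, rfl⟩⟩⟩
  · exact Or.inr ⟨_, _, rfl, rfl, x, Or.inr ⟨hx, Or.inl ⟨rfl, rfl⟩⟩⟩
  · exact Or.inr ⟨_, _, rfl, rfl, x, Or.inr ⟨hx, Or.inr ⟨rfl, rfl⟩⟩⟩

/-- Turning over sends position `k` to `3 - k`, which permutes the two pairs of each splitting among
themselves: reversing the orientation of the surface and exchanging over with under each swap `A`
and `B`, and together they swap nothing. -/
theorem stateRel_turnOver (D : Diagram β) (σ : D.X → Bool) (e e' : D.E) :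
    (D.turnOver).StateRel σ e e' ↔ D.StateRel σ e' e := by
  have h : ∀ x, D.turnOver.cross x 0 = D.cross x 3 ∧ D.turnOver.cross x 1 = D.cross x 2 ∧
      D.turnOver.cross x 2 = D.cross x 1 ∧ D.turnOver.cross x 3 = D.cross x 0 :=
    fun x => ⟨rfl, rfl, rfl, rfl⟩
  refine exists_congr fun x => ?_
  obtain ⟨h0, h1, h2, h3⟩ := h x
  rw [h0, h1, h2, h3]
  tauto

theorem wsum_turnOver (D : Diagram β) (Q : β → β → Prop) : D.turnOver.wsum Q = D.wsum Q := by
  refine stateSum_congr fun σ => total_congr ?_ ?_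
  · rintro x y (hxy | hxy)
    · exact (With.left ((stateRel_turnOver D σ x y).1 hxy)).symm
    · exact .rel _ _ (Or.inr hxy)
  · rintro x y (hxy | hxy)
    · exact (With.left ((stateRel_turnOver D σ y x).2 hxy)).symm
    · exact .rel _ _ (Or.inr hxy)

end Diagram

open Diagram

/-! ### The bracket at `e^{iπ/4}` -/

/-- `e^{iπ/4}` -/
noncomputable def A₈ : ℂ := Complex.exp (Complex.I * Real.pi / 4)

theorem A₈_sq : A₈ ^ 2 = Complex.I := by
  rw [A₈, ← Complex.exp_nat_mul]
  have : ((2 : ℕ) : ℂ) * (Complex.I * Real.pi / 4) = Real.pi / 2 * Complex.I := by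
    push_cast; ring
  rw [this, Complex.exp_pi_div_two_mul_I]

theorem A₈_ne_zero : A₈ ≠ 0 := Complex.exp_ne_zero _

theorem A₈_pow : A₈ ^ 8 = 1 := by
  rw [show 8 = 2 * 4 from rfl, pow_mul, A₈_sq, Complex.I_pow_four]

theorem bracket_A₈ (L : Diagram Empty) (Q : Empty → Empty → Prop) :
    bracket A₈ L = A₈ ^ Fintype.card L.X * L.wsum Q := by
  classical
  have hinv : (A₈⁻¹) ^ 2 = -Complex.I := by rw [inv_pow, A₈_sq, Complex.inv_I]
  have hd : -A₈ ^ 2 - (A₈⁻¹) ^ 2 = 0 := by rw [hinv, A₈_sq]; ring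
  -- The subtraction is truncated, so both one circle and no circle give `0 ^ 0 = 1`; this agrees
  -- with `Total`, which allows at most one class.
  have hc : ∀ σ, (0 : ℂ) ^ (L.circles σ - 1) = if L.Conn σ Q then 1 else 0 := by
    intro σ
    have : L.Conn σ Q ↔ L.circles σ - 1 = 0 := by
      have h1 : L.Conn σ Q ↔ Total (L.StateRel σ) :=
        total_congr (by rintro x y (h | ⟨p, _⟩); exacts [.rel _ _ h, p.elim]) fun _ _ => With.left
      have : Finite (Quot (L.StateRel σ)) := inferInstance
      rw [h1, ← subsingleton_quot_iff, circles, Nat.sub_eq_zero_iff_le,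
        Finite.card_le_one_iff_subsingleton]
    simp [this, zero_pow_eq]
  unfold bracket wsum stateSum
  rw [Finset.mul_sum, hd]
  refine Finset.sum_congr (by congr) fun σ _ => ?_
  rw [hc]
  split_ifs
  · rw [mul_one, wt, Finset.prod_ite, Finset.prod_const_one, one_mul, Finset.prod_const, ← hinv,
      ← Finset.card_univ, ← Finset.card_filter_add_card_filter_not (s := Finset.univ) (fun x => σ x = true), pow_add]
    have : (Finset.univ.filter fun x => σ x = false) = Finset.univ.filter fun x => ¬ σ x = true := by
      ext; simp
    rw [this]
    set k := (Finset.univ.filter fun x => ¬ σ x = true).card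
    -- Writing `A⁻¹ = A · A⁻²` at each `B`-splitting collects one factor `A` per crossing and leaves
    -- `A⁻² = -i` per `B`-splitting.
    have : A₈⁻¹ ^ k = A₈ ^ k * (A₈⁻¹ ^ 2) ^ k := by
      rw [← mul_pow, pow_two, mul_inv_cancel_left₀ A₈_ne_zero]
    rw [this, mul_assoc]
  · simp

namespace ST

/-- The pairs of endpoints connected by the outer closure `i` and the inner filling `j`. -/
def closing (i j : Fin 2) (p q : Fin 4 ⊕ Unit × Fin 4) : Prop :=
  (p, q) ∈ ((fun p => (Sum.inl p.1, Sum.inl p.2)) '' (![hPairs, vPairs] i) ∪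
      (fun p => (Sum.inr ((), p.1), Sum.inr ((), p.2))) '' (![vPairs, hPairs] j) :
      Set ((Fin 4 ⊕ Unit × Fin 4) × (Fin 4 ⊕ Unit × Fin 4)))

theorem br_eq (S : ST) (i j : Fin 2) :
    br S i j = A₈ ^ Fintype.card S.X * S.wsum (closing i j) := by
  unfold br
  rw [← A₈, bracket_A₈ _ fun _ _ => False]
  congr 1
  refine stateSum_congr fun σ => ?_
  unfold link
  refine (conn_relabel _ _ _ _).trans ((conn_join _ _ _ _).trans (conn_congr ?_ ?_))
  · rintro p q (h | ⟨_, _, h, _⟩)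
    · exact .rel _ _ h
    · exact h.elim
  · intro p q h
    exact .rel _ _ (Or.inl h)

end ST

end Tangle

namespace Tangle

open Relation

/-! ### Partitions generated by finitely many pairs -/

section Merge

variable {E : Type}

/-- The labelling `f` with the label of `p.1` replaced by that of `p.2`. -/
def merge (f : E → ℕ) (p : E × E) (x : E) : ℕ := if f x = f p.1 then f p.2 else f x

theorem merge_eq_iff (f : E → ℕ) (p : E × E) (x y : E) :
    merge f p x = merge f p y ↔ EqvGen (fun x y => f x = f y ∨ (x, y) = p) x y := by
  obtain ⟨a, b⟩ := p
  have hr : ∀ x, EqvGen (fun x y => f x = f y ∨ (x, y) = (a, b)) x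
      (if f x = f a then b else x) := by
    intro x
    split_ifs with h
    · exact .trans x a b (.rel _ _ (Or.inl h)) (.rel _ _ (Or.inr rfl))
    · exact .refl _
  have hm : ∀ x, merge f (a, b) x = f (if f x = f a then b else x) := by
    intro x
    simp only [merge]
    split_ifs <;> rfl
  constructor
  · intro h
    rw [hm, hm] at h
    exact .trans _ _ _ (hr x) (.trans _ _ _ (.rel _ _ (Or.inl h)) (.symm _ _ (hr y)))
  · intro h
    induction h with
    | rel x y h =>
      rcases h with h | h
      · simp only [merge, h]
      · obtain ⟨rfl, rfl⟩ := Prod.ext_iff.1 h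
        simp [merge]
    | refl => rfl
    | symm _ _ _ ih => exact ih.symm
    | trans _ _ _ _ _ ih ih' => exact ih.trans ih'

/-- Correctness of a naive union-find: starting from injective labels, processing the list makes
labels equal exactly on the classes generated by its pairs. It turns statements about circles into
computations. -/
theorem foldl_merge_eq_iff (l : List (E × E)) (f : E → ℕ) (x y : E) :
    l.foldl merge f x = l.foldl merge f y ↔ EqvGen (fun x y => f x = f y ∨ (x, y) ∈ l) x y := by
  induction l generalizing f with
  | nil =>
    constructor
    · exact fun h => .rel _ _ (Or.inl h)
    · intro h
      induction h with
      | rel x y h => simpa using h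
      | refl => rfl
      | symm _ _ _ ih => exact ih.symm
      | trans _ _ _ _ _ ih ih' => exact ih.trans ih'
  | cons p l ih =>
    rw [List.foldl_cons, ih]
    constructor
    · refine eqvGen_map id ?_
      rintro x y (h | h)
      · refine eqvGen_map id ?_ ((merge_eq_iff f p x y).1 h)
        rintro x y (h | h)
        · exact .rel _ _ (Or.inl h)
        · exact .rel _ _ (Or.inr (h ▸ List.mem_cons_self))
      · exact .rel _ _ (Or.inr (List.mem_cons_of_mem _ h))
    · refine eqvGen_map id ?_
      rintro x y (h | h)
      · exact .rel _ _ (Or.inl ((merge_eq_iff f p x y).2 (.rel _ _ (Or.inl h))))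
      · rcases List.mem_cons.1 h with h | h
        · exact .rel _ _ (Or.inl ((merge_eq_iff f p x y).2 (.rel _ _ (Or.inr h))))
        · exact .rel _ _ (Or.inr h)

end Merge

/-! ### Formal sums with coefficients that are powers of `-i` -/

section Formal

variable {κ : Type} [DecidableEq κ]

/-- The real part of `(-i)^k`. -/
def rePow (k : ℕ) : ℤ := if k % 4 = 0 then 1 else if k % 4 = 2 then -1 else 0

/-- The imaginary part of `(-i)^k`. -/
def imPow (k : ℕ) : ℤ := if k % 4 = 1 then -1 else if k % 4 = 3 then 1 else 0

theorem neg_I_pow (k : ℕ) :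
    (-Complex.I) ^ k = (rePow k : ℂ) + (imPow k : ℂ) * Complex.I := by
  have h4 : (-Complex.I) ^ 4 = 1 := by rw [neg_pow, Complex.I_pow_four]; norm_num
  rw [← Nat.div_add_mod k 4, pow_add, pow_mul, h4, one_pow, one_mul]
  have : k % 4 < 4 := Nat.mod_lt _ (by norm_num)
  have h2 : (-Complex.I) ^ 2 = -1 := by rw [neg_sq, Complex.I_sq]
  have h3 : (-Complex.I) ^ 3 = Complex.I := by rw [pow_succ, h2]; ring
  simp only [rePow, imPow, Nat.mul_add_mod, Nat.mod_mod]
  interval_cases k % 4 <;> simp [h3]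

/-- The coefficient of `c` in a formal sum, as a pair of integers. -/
def coeff (c : κ) (L : List (ℕ × κ)) : ℤ × ℤ :=
  L.foldr (fun t s => if t.2 = c then (rePow t.1 + s.1, imPow t.1 + s.2) else s) (0, 0)

/-- The value of a formal sum. -/
noncomputable def evalFormal (φ : κ → ℂ) (L : List (ℕ × κ)) : ℂ :=
  (L.map fun t => (-Complex.I) ^ t.1 * φ t.2).sum

/-- Like terms are collected with Gaussian integers as coefficients, for which equality is
decidable. -/
theorem evalFormal_eq (φ : κ → ℂ) (L : List (ℕ × κ)) (S : Finset κ) (hS : ∀ t ∈ L, t.2 ∈ S) :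
    evalFormal φ L = ∑ c ∈ S, (((coeff c L).1 : ℂ) + ((coeff c L).2 : ℂ) * Complex.I) * φ c := by
  induction L with
  | nil => simp [evalFormal, coeff]
  | cons t L ih =>
    have hc : ∀ c, (((coeff c (t :: L)).1 : ℂ) + ((coeff c (t :: L)).2 : ℂ) * Complex.I) * φ c =
        (if t.2 = c then (-Complex.I) ^ t.1 * φ c else 0) +
          (((coeff c L).1 : ℂ) + ((coeff c L).2 : ℂ) * Complex.I) * φ c := by
      intro c
      simp only [coeff, List.foldr_cons, neg_I_pow]
      split_ifs
      · push_cast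
        ring
      · ring
    simp only [hc]
    rw [Finset.sum_add_distrib, ← ih fun t ht => hS t (List.mem_cons_of_mem _ ht),
      Finset.sum_ite_eq, if_pos (hS t List.mem_cons_self)]
    simp [evalFormal]

/-- Equality of two formal sums disregarding the terms at `none`. -/
def sameFormal (L L' : List (ℕ × Option κ)) : Bool :=
  (L ++ L').all fun t => t.2.isNone || decide (coeff t.2 L = coeff t.2 L')

/-- The key `none` stands for states with a class that misses the boundary; these contribute
nothing, so their coefficients need not agree. -/
theorem evalFormal_congr {L L' : List (ℕ × Option κ)} (h : sameFormal L L' = true)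
    (φ : Option κ → ℂ) (hφ : φ none = 0) : evalFormal φ L = evalFormal φ L' := by
  have hS : ∀ t ∈ L ++ L', t.2 ∈ ((L ++ L').map Prod.snd).toFinset := fun t ht =>
    List.mem_toFinset.2 (List.mem_map_of_mem ht)
  rw [evalFormal_eq φ L _ fun t ht => hS t (List.mem_append_left _ ht),
    evalFormal_eq φ L' _ fun t ht => hS t (List.mem_append_right _ ht)]
  refine Finset.sum_congr rfl fun c hc => ?_
  obtain ⟨t, ht, rfl⟩ := List.mem_map.1 (List.mem_toFinset.1 hc)
  have := List.all_eq_true.1 h t ht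
  rcases t with ⟨k, _ | c⟩
  · simp [hφ]
  · rw [show coeff (some c) L = coeff (some c) L' by simpa using this]

end Formal

/-! ### Lists of states -/

/-- All states of `n` crossings. -/
def states : (n : ℕ) → List (Fin n → Bool)
  | 0 => [Fin.elim0]
  | n + 1 => (states n).flatMap fun s => [Fin.cons true s, Fin.cons false s]

theorem sum_states (n : ℕ) (g : (Fin n → Bool) → ℂ) : ∑ s, g s = ((states n).map g).sum := by
  induction n with
  | zero =>
    simp only [states, List.map_cons, List.map_nil, List.sum_singleton]
    exact Fintype.sum_unique g |>.trans (congrArg g (Subsingleton.elim _ _))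
  | succ n ih =>
    rw [← (Fin.consEquiv fun _ => Bool).sum_comp g, Fintype.sum_prod_type_right, ih]
    simp only [states, List.map_flatMap, Fintype.sum_bool, List.map_cons, List.map_nil]
    rw [List.flatMap_def, List.sum_flatten, List.map_map]
    congr 2
    funext s
    simp [Fin.consEquiv]

/-- The number of `B`-type splittings. -/
def countB : (n : ℕ) → (Fin n → Bool) → ℕ
  | 0, _ => 0
  | n + 1, s => (if s 0 = true then 0 else 1) + countB n (Fin.tail s)

theorem wt_eq_pow (n : ℕ) (s : Fin n → Bool) : wt s = (-Complex.I) ^ countB n s := by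
  induction n with
  | zero => simp [wt, countB]
  | succ n ih =>
    have : wt s = (if s 0 = true then 1 else -Complex.I) * wt (Fin.tail s) := by
      simp only [wt, Fin.prod_univ_succ]
      rfl
    rw [this, ih, countB, pow_add]
    split_ifs <;> simp

/-! ### Local state sums -/

namespace Diagram

variable {β γ δ δ' : Type}

/-- The part contributed by the local diagram `T`, closed according to `Q`, to a state sum of a
larger diagram; the larger diagram is attached at the endpoints `v` and enters only through `Φ`. -/
noncomputable def localSum (T : Diagram δ) (Q : δ → δ → Prop) (v : γ → δ)
    (Φ : (γ → γ → Prop) → Prop) : ℂ :=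
  stateSum fun τ => Reached (T.Rel τ Q) (T.bd ∘ v) ∧ Φ (pull (T.Rel τ Q) (T.bd ∘ v))

/-- The pairs of edges joined by the state `s`. -/
def statePairs {E : Type} {n : ℕ} (cr : Fin n → Fin 4 → E) (s : Fin n → Bool) : List (E × E) :=
  (List.finRange n).flatMap fun i =>
    if s i = true then [(cr i 0, cr i 1), (cr i 2, cr i 3)]
    else [(cr i 1, cr i 2), (cr i 3, cr i 0)]

/-- The partition of the boundary edges `bs` effected by identification of the pairs `l` of edges,
or `none` if not all edges `es` are connected to the boundary. -/
def boundaryCode {E : Type} (enc : E → ℕ) (es bs : List E) (l : List (E × E)) :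
    Option (List ℕ) :=
  let f := l.foldl merge enc
  let c := bs.map f
  if es.all fun e => c.elem (f e) then some (c.map fun k => c.idxOf k) else none

/-- A finite description of a diagram. -/
structure Code (T : Diagram δ) (Q : δ → δ → Prop) (v : γ → δ) where
  n : ℕ
  e : Fin n ≃ T.X
  enc : T.E → ℕ
  enc_inj : Function.Injective enc
  es : List T.E
  mem_es : ∀ e, e ∈ es
  qs : List (δ × δ)
  mem_qs : ∀ p q, Q p q ↔ (p, q) ∈ qs

/-- The local state sum as a formal sum of partitions. -/
def Code.terms {T : Diagram δ} {Q : δ → δ → Prop} {v : γ → δ} (c : Code T Q v) (gs : List γ) :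
    List (ℕ × Option (List ℕ)) :=
  (states c.n).map fun s => (countB c.n s, boundaryCode c.enc c.es (gs.map (T.bd ∘ v))
    (c.qs.map (Prod.map T.bd T.bd) ++ statePairs (T.cross ∘ c.e) s))

theorem Code.eqvGen_iff {T : Diagram δ} {Q : δ → δ → Prop} {v : γ → δ} (c : Code T Q v)
    (s : Fin c.n → Bool) (x y : T.E) :
    EqvGen (T.Rel (fun x => s (c.e.symm x)) Q) x y ↔
      (c.qs.map (Prod.map T.bd T.bd) ++ statePairs (T.cross ∘ c.e) s).foldl merge c.enc x =
      (c.qs.map (Prod.map T.bd T.bd) ++ statePairs (T.cross ∘ c.e) s).foldl merge c.enc y := by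
  rw [foldl_merge_eq_iff]
  constructor
  · refine eqvGen_map id ?_
    rintro x y (⟨z, hz⟩ | ⟨p, q, hpq, rfl, rfl⟩)
    · obtain ⟨i, rfl⟩ := c.e.surjective z
      simp only [Equiv.symm_apply_apply] at hz
      refine .rel _ _ (Or.inr (List.mem_append_right _ (List.mem_flatMap.2
        ⟨i, List.mem_finRange _, ?_⟩)))
      rcases hz with ⟨hx, ⟨rfl, rfl⟩ | ⟨rfl, rfl⟩⟩ | ⟨hx, ⟨rfl, rfl⟩ | ⟨rfl, rfl⟩⟩ <;>
        simp [hx]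
    · exact .rel _ _ (Or.inr (List.mem_append_left _
        (List.mem_map.2 ⟨(p, q), (c.mem_qs p q).1 hpq, rfl⟩)))
  · refine eqvGen_map id ?_
    rintro x y (h | h)
    · rw [c.enc_inj h]
      exact .refl _
    · rcases List.mem_append.1 h with h | h
      · obtain ⟨⟨p, q⟩, hpq, h⟩ := List.mem_map.1 h
        obtain ⟨rfl, rfl⟩ := Prod.ext_iff.1 h
        exact With.right ((c.mem_qs p q).2 hpq)
      · obtain ⟨i, -, h⟩ := List.mem_flatMap.1 h
        refine With.left ⟨c.e i, ?_⟩
        simp only [Equiv.symm_apply_apply]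
        cases hs : s i <;> simpa [hs] using h

/-- The function on partitions of `γ`, coded by lists, that corresponds to `Φ`. -/
noncomputable def codeFun [DecidableEq γ] (gs : List γ) (Φ : (γ → γ → Prop) → Prop) :
    Option (List ℕ) → ℂ
  | none => 0
  | some c => open Classical in
    if Φ (fun g g' => c.getD (gs.idxOf g) 0 = c.getD (gs.idxOf g') 0) then 1 else 0

/-- A state of the local diagram contributes its weight times a function of the induced boundary
partition alone. The unknown surroundings `Φ` are thereby separated from the finite data of `T`. -/
theorem Code.localSum_eq {T : Diagram δ} {Q : δ → δ → Prop} {v : γ → δ} (c : Code T Q v)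
    [DecidableEq γ] (gs : List γ) (hgs : ∀ g, g ∈ gs) (Φ : (γ → γ → Prop) → Prop) :
    T.localSum Q v Φ = evalFormal (codeFun gs Φ) (c.terms gs) := by
  classical
  rw [localSum, stateSum_equiv c.e, stateSum_eq, sum_states, evalFormal, terms, List.map_map]
  congr 1
  refine List.map_congr_left fun s _ => ?_
  simp only [Function.comp_apply]
  rw [← wt_eq_pow]
  have key := c.eqvGen_iff s
  set l := c.qs.map (Prod.map T.bd T.bd) ++ statePairs (T.cross ∘ c.e) s with hl
  set f := l.foldl merge c.enc with hf
  have hreach : Reached (T.Rel (fun x => s (c.e.symm x)) Q) (T.bd ∘ v) ↔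
      (c.es.all fun e => ((gs.map (T.bd ∘ v)).map f).elem (f e)) = true := by
    simp only [List.all_eq_true, List.elem_eq_mem, decide_eq_true_eq, List.mem_map,
      exists_exists_and_eq_and]
    constructor
    · intro h e _
      obtain ⟨g, hg⟩ := h e
      exact ⟨g, hgs g, ((key _ _).1 hg).symm⟩
    · intro h e
      obtain ⟨g, -, hg⟩ := h e (c.mem_es e)
      exact ⟨g, (key _ _).2 hg.symm⟩
  by_cases hr : Reached (T.Rel (fun x => s (c.e.symm x)) Q) (T.bd ∘ v)
  -- Replacing each label by the index of its first occurrence gives a normal form of the partition,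
  -- so that codes of different diagrams can be compared.
  · have hpull : (pull (T.Rel (fun x => s (c.e.symm x)) Q) (T.bd ∘ v)) = fun g g' =>
        (((gs.map (T.bd ∘ v)).map f).map
          fun k => ((gs.map (T.bd ∘ v)).map f).idxOf k).getD (gs.idxOf g) 0 =
        (((gs.map (T.bd ∘ v)).map f).map
          fun k => ((gs.map (T.bd ∘ v)).map f).idxOf k).getD (gs.idxOf g') 0 := by
      funext g g'
      have hget : ∀ (F : γ → ℕ) (g : γ), (gs.map F).getD (gs.idxOf g) 0 = F g := fun F g => by
        have := List.idxOf_lt_length_iff.2 (hgs g)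
        rw [List.getD_eq_getElem _ _ (by simpa using this), List.getElem_map, List.getElem_idxOf]
      simp only [List.map_map, hget, Function.comp_apply]
      rw [pull, key]
      refine propext ⟨fun h => congrArg (fun k => List.idxOf k (gs.map (f ∘ T.bd ∘ v))) h,
        fun h => ?_⟩
      refine (List.idxOf_inj ?_).1 h
      simp only [List.mem_map]
      exact ⟨g, hgs g, rfl⟩
    simp only [boundaryCode]
    rw [if_pos (hreach.1 hr), codeFun, ← hpull]
    simp [hr]
  · simp only [boundaryCode]
    rw [if_neg (hreach.not.1 hr), codeFun]
    simp [hr]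

/-- Multiplication of a formal sum by `(-i)^k`. -/
def shift {κ : Type} (k : ℕ) (L : List (ℕ × κ)) : List (ℕ × κ) := L.map fun t => (k + t.1, t.2)

theorem evalFormal_shift {κ : Type} (k : ℕ) (φ : κ → ℂ) (L : List (ℕ × κ)) :
    evalFormal φ (shift k L) = (-Complex.I) ^ k * evalFormal φ L := by
  rw [evalFormal, evalFormal, shift, List.map_map, ← List.sum_map_mul_left]
  congr 1
  refine List.map_congr_left fun t _ => ?_
  simp only [Function.comp_apply]
  rw [pow_add, mul_assoc]

/-- One decidable equality of formal sums settles the comparison for all surroundings `Φ` at once.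
-/
theorem localSum_eq_of_code [DecidableEq γ] {T : Diagram δ} {T' : Diagram δ'} {Q : δ → δ → Prop}
    {Q' : δ' → δ' → Prop} {v : γ → δ} {v' : γ → δ'} (c : Code T Q v) (c' : Code T' Q' v')
    (gs : List γ) (hgs : ∀ g, g ∈ gs) (k : ℕ)
    (h : sameFormal (c'.terms gs) (shift k (c.terms gs)) = true) (Φ : (γ → γ → Prop) → Prop) :
    T'.localSum Q' v' Φ = (-Complex.I) ^ k * T.localSum Q v Φ := by
  rw [c.localSum_eq gs hgs, c'.localSum_eq gs hgs, ← evalFormal_shift]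
  exact evalFormal_congr h _ rfl

end Diagram
end Tangle

namespace Tangle

open Relation

namespace Diagram

/-! ### Local state sums of the Reidemeister moves -/

def arcCode : Code arc (fun _ _ => False) id where
  n := 0
  e := Equiv.equivOfIsEmpty (Fin 0) Empty
  enc := fun _ => 0
  enc_inj := fun _ _ _ => rfl
  es := [()]
  mem_es := fun _ => List.mem_singleton.2 rfl
  qs := []
  mem_qs := by simp

def curlCode (k : Fin 4) : Code (curl k) (fun _ _ => False) id where
  n := 1
  e := (Equiv.refl (Fin 1)).trans (Equiv.ofUnique (Fin 1) Unit)
  enc := Fin.val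
  enc_inj := Fin.val_injective
  es := List.finRange 3
  mem_es := List.mem_finRange
  qs := []
  mem_qs := by simp

def twoArcsCode : Code twoArcs (fun _ _ => False) id where
  n := 0
  e := Equiv.equivOfIsEmpty (Fin 0) Empty
  enc := Fin.val
  enc_inj := Fin.val_injective
  es := List.finRange 2
  mem_es := List.mem_finRange
  qs := []
  mem_qs := by simp

def bigonCode : Code bigon (fun _ _ => False) id where
  n := 2
  e := Equiv.refl (Fin 2)
  enc := Fin.val
  enc_inj := Fin.val_injective
  es := List.finRange 6
  mem_es := List.mem_finRange
  qs := []
  mem_qs := by simp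

def triangleCode : Code triangle (fun _ _ => False) id where
  n := 3
  e := Equiv.refl (Fin 3)
  enc := Fin.val
  enc_inj := Fin.val_injective
  es := List.finRange 9
  mem_es := List.mem_finRange
  qs := []
  mem_qs := by simp

def triangleCode' : Code triangle' (fun _ _ => False) id where
  n := 3
  e := Equiv.refl (Fin 3)
  enc := Fin.val
  enc_inj := Fin.val_injective
  es := List.finRange 9
  mem_es := List.mem_finRange
  qs := []
  mem_qs := by simp

def reflectCode {δ γ : Type} {T : Diagram δ} {Q : δ → δ → Prop} {v : γ → δ} (c : Code T Q v) :
    Code T.reflect Q v where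
  n := c.n
  e := c.e
  enc := c.enc
  enc_inj := c.enc_inj
  es := c.es
  mem_es := c.mem_es
  qs := c.qs
  mem_qs := c.mem_qs

/-- One splitting cuts the curl off as a separate circle and contributes nothing; the other leaves a
plain arc. The surviving one is the `B`-splitting exactly when `k` is even, which explains the
exponent `(k + 1) % 2` used in the proof. -/
theorem localSum_curl (k : Fin 4) : ∃ u : ℕ, ∀ Φ,
    (curl k).localSum (fun _ _ => False) id Φ =
      (-Complex.I) ^ u * arc.localSum (fun _ _ => False) id Φ := by
  have h : ∀ k : Fin 4, sameFormal ((curlCode k).terms (List.finRange 2))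
      (shift ((k.val + 1) % 2) (arcCode.terms (List.finRange 2))) = true := by decide +kernel
  exact ⟨_, localSum_eq_of_code arcCode (curlCode k) _ List.mem_finRange _ (h k)⟩

/-- Of the four states, one contains a closed circle, the two with equal splittings induce the same
partition with weights `1` and `(-i)² = -1` and cancel, and the last is the pair of arcs with weight
`-i`. -/
theorem localSum_bigon (Φ : (Fin 4 → Fin 4 → Prop) → Prop) :
    bigon.localSum (fun _ _ => False) id Φ =
      (-Complex.I) ^ 1 * twoArcs.localSum (fun _ _ => False) id Φ :=
  localSum_eq_of_code twoArcsCode bigonCode (List.finRange 4) List.mem_finRange 1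
    (by decide +kernel) Φ

theorem localSum_triangle (Φ : (Fin 6 → Fin 6 → Prop) → Prop) :
    triangle'.localSum (fun _ _ => False) id Φ =
      (-Complex.I) ^ 0 * triangle.localSum (fun _ _ => False) id Φ :=
  localSum_eq_of_code triangleCode triangleCode' (List.finRange 6) List.mem_finRange 0
    (by decide +kernel) Φ

theorem localSum_triangle_reflect (Φ : (Fin 6 → Fin 6 → Prop) → Prop) :
    triangle'.reflect.localSum (fun _ _ => False) id Φ =
      (-Complex.I) ^ 0 * triangle.reflect.localSum (fun _ _ => False) id Φ :=
  localSum_eq_of_code (reflectCode triangleCode) (reflectCode triangleCode') (List.finRange 6)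
    List.mem_finRange 0 (by decide +kernel) Φ

end Diagram

/-! ### The local state sum of the move of type IV -/

namespace ST

open Diagram

/-- The filling of the hole: two vertical arcs (`j = 0`) or two horizontal arcs (`j = 1`). -/
def fillPairs (j : Fin 2) : List (Fin 4 × Fin 4) :=
  if j = 0 then [(0, 3), (1, 2)] else [(0, 1), (3, 2)]

/-- The filling of the hole of a neighbourhood of the hole. -/
def fill (j : Fin 2) (p q : Fin 4 ⊕ (Fin 4 ⊕ Fin 2)) : Prop :=
  (p, q) ∈ (fillPairs j).map (Prod.map Sum.inl Sum.inl)

def holeAndArcCode (i : Fin 2) :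
    Code holeAndArc (fill i) (Sum.inr : Fin 4 ⊕ Fin 2 → Fin 4 ⊕ (Fin 4 ⊕ Fin 2)) where
  n := 0
  e := Equiv.equivOfIsEmpty (Fin 0) Empty
  enc := Sum.elim Fin.val fun _ => 4
  enc_inj := by
    change Function.Injective (Sum.elim Fin.val fun _ => 4 : Fin 4 ⊕ Unit → ℕ)
    decide +kernel
  es := (List.finRange 4).map Sum.inl ++ [Sum.inr ()]
  mem_es := by
    have : ∀ e : Fin 4 ⊕ Unit, e ∈ (List.finRange 4).map Sum.inl ++ [Sum.inr ()] := by simp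
    exact this
  qs := (fillPairs i).map (Prod.map Sum.inl Sum.inl)
  mem_qs := fun _ _ => Iff.rfl

def holeInArcCode (ov : Bool) (j : Fin 4) (i : Fin 2) :
    Code (holeInArc ov j) (fill i) (Sum.inr : Fin 4 ⊕ Fin 2 → Fin 4 ⊕ (Fin 4 ⊕ Fin 2)) where
  n := 4
  e := Equiv.refl (Fin 4)
  enc := Sum.elim Fin.val (Sum.elim (fun k => 4 + k.val) fun k => 8 + k.val)
  enc_inj := by
    change Function.Injective (Sum.elim Fin.val (Sum.elim (fun k => 4 + k.val) fun k => 8 + k.val) :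
      Fin 4 ⊕ (Fin 4 ⊕ Fin 5) → ℕ)
    decide +kernel
  es := (List.finRange 4).map Sum.inl ++ ((List.finRange 4).map (fun k => Sum.inr (Sum.inl k)) ++
    (List.finRange 5).map fun k => Sum.inr (Sum.inr k))
  mem_es := by
    have : ∀ e : Fin 4 ⊕ (Fin 4 ⊕ Fin 5), e ∈ (List.finRange 4).map Sum.inl ++
      ((List.finRange 4).map (fun k => Sum.inr (Sum.inl k)) ++
        (List.finRange 5).map fun k => Sum.inr (Sum.inr k)) := by simp
    exact this
  qs := (fillPairs i).map (Prod.map Sum.inl Sum.inl)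
  mem_qs := fun _ _ => Iff.rfl

/-- Once the hole is filled by two arcs, moving an arc across it amounts to two moves of type II,
side by side or nested, whence the factor `(-i)²`. It is essential that the factor is the same for
both fillings. -/
theorem localSum_holeInArc (ov : Bool) (j : Fin 4) (i : Fin 2)
    (Φ : (Fin 4 ⊕ Fin 2 → Fin 4 ⊕ Fin 2 → Prop) → Prop) :
    (holeInArc ov j).localSum (fill i) Sum.inr Φ =
      (-Complex.I) ^ 2 * holeAndArc.localSum (fill i) Sum.inr Φ := by
  have : ∀ (ov : Bool) (j : Fin 4) (i : Fin 2),
      sameFormal ((holeInArcCode ov j i).terms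
        ((List.finRange 4).map Sum.inl ++ (List.finRange 2).map Sum.inr))
      (shift 2 ((holeAndArcCode i).terms
        ((List.finRange 4).map Sum.inl ++ (List.finRange 2).map Sum.inr))) = true := by
    decide +kernel
  exact localSum_eq_of_code (holeAndArcCode i) (holeInArcCode ov j i) _ (by simp) 2 (this ov j i) Φ

end ST

end Tangle

/-! ### Invariance of state sums and of `F` under Reidemeister moves -/

namespace Tangle

open Relation

namespace Diagram

variable {β β' γ : Type}

theorem conn_disj_glue (C : Diagram β) (T : Diagram β') (σ : C.X → Bool) (τ : T.X → Bool)
    (Q : β → β → Prop) (Q' : β' → β' → Prop) (u : γ → β) (v : γ → β') :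
    (C.disj T).Conn (Sum.elim σ τ) (Glue Q Q' u v) ↔
      Total (Glue (C.Rel σ Q) (T.Rel τ Q') (C.bd ∘ u) (T.bd ∘ v)) := by
  refine total_congr ?_ ?_
  · rintro x y (h | ⟨_, _, h | h | g, rfl, rfl⟩)
    · obtain ⟨e, e', rfl, rfl, h'⟩ | ⟨e, e', rfl, rfl, h'⟩ := stateRel_disj_cases h
      · exact Glue.eqvGen_left (With.left h')
      · exact Glue.eqvGen_right (With.left h')
    · exact Glue.eqvGen_left (With.right h)
    · exact Glue.eqvGen_right (With.right h)
    · exact Glue.eqvGen_mid (R := C.Rel σ Q) (S := T.Rel τ Q') (u := C.bd ∘ u) (v := T.bd ∘ v) g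
  · rintro _ _ ((h | ⟨p, q, h, rfl, rfl⟩) | (h | ⟨p, q, h, rfl, rfl⟩) | g)
    · exact With.left (stateRel_disj_inl h)
    · exact With.right (u := (C.disj T).bd) (g := Sum.inl p) (g' := Sum.inl q) (.left h)
    · exact With.left (stateRel_disj_inr h)
    · exact With.right (u := (C.disj T).bd) (g := Sum.inr p) (g' := Sum.inr q) (.right h)
    · exact With.right (u := (C.disj T).bd) (g := Sum.inl (u g)) (g' := Sum.inr (v g)) (.mid g)

open Classical in
theorem wsum_disj_glue (C : Diagram β) (T : Diagram β') [Nonempty β]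
    (Q : β → β → Prop) (Q' : β' → β' → Prop) (u : γ → β) (v : γ → β') :
    (C.disj T).wsum (Glue Q Q' u v) = ∑ σ, wt σ * T.localSum Q' v
      fun p => Total (With (C.Rel σ Q) p (C.bd ∘ u)) := by
  have : Nonempty C.E := Nonempty.map C.bd ‹_›
  rw [wsum]
  refine (stateSum_sum _).trans (Fintype.sum_congr _ _ fun σ => ?_)
  congr 1
  exact stateSum_congr fun τ => (conn_disj_glue C T σ τ Q Q' u v).trans total_glue_iff

theorem wsum_disj_glue_congr (C : Diagram β) {δ δ' : Type} [Nonempty β]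
    {T : Diagram δ} {T' : Diagram δ'} (Q : β → β → Prop) {Q₁ : δ → δ → Prop} {Q₂ : δ' → δ' → Prop}
    (u : γ → β) {v : γ → δ} {v' : γ → δ'} {c : ℂ}
    (h : ∀ Φ, T'.localSum Q₂ v' Φ = c * T.localSum Q₁ v Φ) :
    (C.disj T').wsum (Glue Q Q₂ u v') = c * (C.disj T).wsum (Glue Q Q₁ u v) := by
  classical
  rw [wsum_disj_glue, wsum_disj_glue, Finset.mul_sum]
  refine Fintype.sum_congr _ _ fun σ => ?_
  rw [h]
  ring

theorem wsum_insert (C : Diagram (β ⊕ γ)) (T : Diagram γ) (Q : β → β → Prop) :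
    (C.insert T).wsum Q = (C.disj T).wsum
      (Glue (Relation.Map Q Sum.inl Sum.inl) (fun _ _ => False) Sum.inr id) := by
  refine stateSum_congr fun σ => ?_
  refine (conn_relabel _ _ _ _).trans ((conn_join _ _ _ _).trans (conn_congr ?_ ?_))
  · rintro _ _ (⟨g, hg⟩ | ⟨p, q, h, rfl, rfl⟩)
    · obtain ⟨rfl, rfl⟩ := Prod.ext_iff.1 hg
      exact .rel _ _ (.mid (u := Sum.inr) (v := id) g)
    · exact .rel _ _ (.left ⟨p, q, h, rfl, rfl⟩)
  · rintro _ _ (⟨p, q, h, rfl, rfl⟩ | h | g)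
    · exact .rel _ _ (Or.inr ⟨p, q, h, rfl, rfl⟩)
    · exact h.elim
    · exact .rel _ _ (Or.inl ⟨g, rfl⟩)

theorem wsum_insert_congr [Nonempty β] (C : Diagram (β ⊕ γ)) {T T' : Diagram γ} {c : ℂ}
    (h : ∀ Φ, T'.localSum (fun _ _ => False) id Φ = c * T.localSum (fun _ _ => False) id Φ)
    (Q : β → β → Prop) : (C.insert T').wsum Q = c * (C.insert T).wsum Q := by
  rw [wsum_insert, wsum_insert]
  exact wsum_disj_glue_congr C _ _ h

/-- Shifting the positions at a crossing by `2` exchanges the two pairs within each splitting, so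
starting from the other end of the under-strand does not alter the type of a splitting. -/
theorem stateRel_iso {D D' : Diagram β} (f : D.X ≃ D'.X) (g : D.E ≃ D'.E)
    (h : ∀ x, (∀ k, D'.cross (f x) k = g (D.cross x k)) ∨
      (∀ k, D'.cross (f x) k = g (D.cross x (k + 2)))) (σ : D.X → Bool) (e e' : D.E) :
    D'.StateRel (fun y => σ (f.symm y)) (g e) (g e') ↔ D.StateRel σ e e' := by
  unfold StateRel
  rw [f.symm.exists_congr_left]
  refine exists_congr fun x => ?_
  simp only [Equiv.symm_symm, Equiv.symm_apply_apply]
  rcases h x with h | h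
  · simp only [h, g.injective.eq_iff]
  · simp only [h, g.injective.eq_iff]
    rw [show (0 + 2 : Fin 4) = 2 from rfl, show (1 + 2 : Fin 4) = 3 from rfl,
      show (2 + 2 : Fin 4) = 0 from rfl, show (3 + 2 : Fin 4) = 1 from rfl]
    tauto

theorem wsum_iso {D D' : Diagram β} (h : Iso D D') (Q : β → β → Prop) :
    D'.wsum Q = D.wsum Q := by
  obtain ⟨f, g, hx, hb⟩ := h
  rw [wsum, stateSum_equiv f]
  refine stateSum_congr fun σ => (total_equiv g ?_ ?_).symm
  · rintro x y (h | ⟨p, q, h, rfl, rfl⟩)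
    · exact With.left ((stateRel_iso f g hx σ x y).2 h)
    · rw [← hb, ← hb]
      exact With.right h
  · rintro x y (h | ⟨p, q, h, rfl, rfl⟩)
    · refine With.left ((stateRel_iso f g hx σ _ _).1 ?_)
      simpa using h
    · rw [hb, hb, g.symm_apply_apply, g.symm_apply_apply]
      exact With.right h

/-- The exponent is chosen before the closure `Q`: the four entries of a spherical tangle are all
scaled by the same factor. -/
theorem Move.wsum_eq [Nonempty β] {D D' : Diagram β} (h : Move D D') :
    ∃ n : ℕ, ∀ Q, D'.wsum Q = (-Complex.I) ^ n * D.wsum Q := by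
  cases h with
  | iso D D' h => exact ⟨0, fun Q => by rw [wsum_iso h, pow_zero, one_mul]⟩
  | typeI C k =>
    obtain ⟨n, hn⟩ := localSum_curl k
    exact ⟨n, wsum_insert_congr C hn⟩
  | typeII C => exact ⟨1, wsum_insert_congr C localSum_bigon⟩
  | typeIII C => exact ⟨0, wsum_insert_congr C localSum_triangle⟩
  | typeIII' C => exact ⟨0, wsum_insert_congr C localSum_triangle_reflect⟩

end Diagram

namespace ST

open Diagram

/-- The pairs of endpoints connected by the outer closure `i`. -/
def outerPairs (i : Fin 2) : List (Fin 4 × Fin 4) :=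
  if i = 0 then [(0, 1), (3, 2)] else [(0, 3), (1, 2)]

theorem closing_iff (i j : Fin 2) (p q : Fin 4 ⊕ Unit × Fin 4) : closing i j p q ↔
    (p, q) ∈ (outerPairs i).map (Prod.map Sum.inl Sum.inl) ++
      (fillPairs j).map (Prod.map (fun k => Sum.inr ((), k)) fun k => Sum.inr ((), k)) := by
  fin_cases i <;> fin_cases j <;>
    simp [closing, outerPairs, fillPairs, hPairs, vPairs, eq_comm, or_assoc]

theorem wsum_insertHole {γ : Type} (C T : Diagram (Fin 4 ⊕ γ)) (i j : Fin 2) :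
    (insertHole C T).wsum (closing i j) = (C.disj T).wsum
      (Glue (fun p q => (p, q) ∈ (outerPairs i).map (Prod.map Sum.inl Sum.inl))
        (fun p q => (p, q) ∈ (fillPairs j).map (Prod.map Sum.inl Sum.inl)) Sum.inr Sum.inr) := by
  refine stateSum_congr fun σ => ?_
  refine (conn_relabel _ _ _ _).trans ((conn_join _ _ _ _).trans (conn_congr ?_ ?_))
  · rintro _ _ (⟨g, hg⟩ | ⟨p, q, h, rfl, rfl⟩)
    · obtain ⟨rfl, rfl⟩ := Prod.ext_iff.1 hg
      exact .rel _ _ (.mid (u := Sum.inr) (v := Sum.inr) g)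
    · rw [closing_iff, List.mem_append, List.mem_map, List.mem_map] at h
      obtain ⟨⟨a, b⟩, h, hp⟩ | ⟨⟨a, b⟩, h, hp⟩ := h <;> obtain ⟨rfl, rfl⟩ := Prod.ext_iff.1 hp
      · exact .rel _ _ (.left (List.mem_map.2 ⟨(a, b), h, rfl⟩))
      · exact .rel _ _ (.right (List.mem_map.2 ⟨(a, b), h, rfl⟩))
  · rintro _ _ (hq | hq | g)
    · obtain ⟨⟨a, b⟩, h, hp⟩ := List.mem_map.1 hq
      obtain ⟨rfl, rfl⟩ := Prod.ext_iff.1 hp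
      exact .rel _ _ (Or.inr ⟨Sum.inl a, Sum.inl b, (closing_iff _ _ _ _).2
        (List.mem_append_left _ (List.mem_map.2 ⟨(a, b), h, rfl⟩)), rfl, rfl⟩)
    · obtain ⟨⟨a, b⟩, h, hp⟩ := List.mem_map.1 hq
      obtain ⟨rfl, rfl⟩ := Prod.ext_iff.1 hp
      exact .rel _ _ (Or.inr ⟨Sum.inr ((), a), Sum.inr ((), b), (closing_iff _ _ _ _).2
        (List.mem_append_right _ (List.mem_map.2 ⟨(a, b), h, rfl⟩)), rfl, rfl⟩)
    · exact .rel _ _ (Or.inl ⟨g, rfl⟩)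

/-- The state sum of the link `S_{ij}`. -/
noncomputable def entry (S : ST) (i j : Fin 2) : ℂ := S.wsum (closing i j)

theorem Move.entry_eq {S S' : ST} (h : Move S S') :
    ∃ n : ℕ, ∀ i j, S'.entry i j = (-Complex.I) ^ n * S.entry i j := by
  cases h with
  | classical S S' h =>
    obtain ⟨n, hn⟩ := h.wsum_eq
    exact ⟨n, fun i j => hn _⟩
  | typeIV C ov j =>
    refine ⟨2, fun i j' => ?_⟩
    rw [entry, entry, wsum_insertHole, wsum_insertHole]
    exact wsum_disj_glue_congr C _ _ (localSum_holeInArc ov j j')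

/-- The matrix of state sums, multiplied by `z`. -/
noncomputable def entries (S : ST) (z : ℂ) : Matrix (Fin 2) (Fin 2) ℂ :=
  !![z * S.entry 0 0, -Complex.I * z * S.entry 0 1;
     Complex.I * z * S.entry 1 0, z * S.entry 1 1]

/-- The power of `A₈` that separates brackets from state sums is itself an 8-th root of unity and is
absorbed in `z`. -/
theorem mem_F_iff (S : ST) (M : Matrix (Fin 2) (Fin 2) ℤ) :
    M ∈ F S ↔ ∃ z : ℂ, z ^ 8 = 1 ∧ M.map (fun a : ℤ => (a : ℂ)) = S.entries z := by
  have h8 : (A₈ ^ Fintype.card S.X) ^ 8 = 1 := by rw [← pow_mul, mul_comm, pow_mul, A₈_pow, one_pow]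
  have h0 : A₈ ^ Fintype.card S.X ≠ 0 := pow_ne_zero _ A₈_ne_zero
  have hb : ∀ i j, br S i j = A₈ ^ Fintype.card S.X * S.entry i j := br_eq S
  simp only [F, Set.mem_ofPred_eq, hb]
  constructor
  · rintro ⟨z, hz, h⟩
    refine ⟨z * A₈ ^ Fintype.card S.X, by rw [mul_pow, hz, h8, one_mul], h.trans ?_⟩
    simp only [entries, mul_assoc]
  · rintro ⟨z, hz, h⟩
    refine ⟨z * (A₈ ^ Fintype.card S.X)⁻¹, by rw [mul_pow, hz, inv_pow, h8, inv_one, one_mul],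
      h.trans ?_⟩
    simp only [entries, mul_assoc, inv_mul_cancel_left₀ h0]

theorem F_eq_of_entry_eq {S S' : ST} {c : ℂ} (hc : c ^ 8 = 1)
    (h : ∀ i j, S'.entry i j = c * S.entry i j) : F S = F S' := by
  have hc0 : c ≠ 0 := by rintro rfl; norm_num at hc
  ext M
  rw [mem_F_iff, mem_F_iff]
  constructor
  · rintro ⟨z, hz, hM⟩
    refine ⟨z * c⁻¹, by rw [mul_pow, hz, inv_pow, hc, inv_one, one_mul], hM.trans ?_⟩
    simp only [entries, h, mul_assoc, inv_mul_cancel_left₀ hc0]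
  · rintro ⟨z, hz, hM⟩
    refine ⟨z * c, by rw [mul_pow, hz, hc, one_mul], hM.trans ?_⟩
    simp only [entries, h, mul_assoc]

theorem neg_I_pow_pow_eight (n : ℕ) : ((-Complex.I) ^ n) ^ 8 = 1 := by
  rw [← pow_mul, mul_comm, pow_mul, show 8 = 4 * 2 from rfl, pow_mul, neg_pow, Complex.I_pow_four]
  norm_num

theorem Equivalent.F_eq {S S' : ST} (h : Equivalent S S') : F S = F S' := by
  induction h with
  | rel S S' h =>
    obtain ⟨n, hn⟩ := h.2.2.entry_eq
    exact F_eq_of_entry_eq (neg_I_pow_pow_eight n) hn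
  | refl => rfl
  | symm _ _ _ ih => exact ih.symm
  | trans _ _ _ _ _ ih ih' => exact ih.trans ih'

end ST

end Tangle

namespace Tangle

open Relation

/-! ### Expansion of tangles with four endpoints in the two fundamental tangles -/

/-- The indicator of a proposition. -/
noncomputable def ind (p : Prop) : ℂ := open Classical in if p then 1 else 0

theorem ind_congr {p q : Prop} (h : p ↔ q) : ind p = ind q := by rw [propext h]

theorem ind_false {p : Prop} (h : ¬ p) : ind p = 0 := if_neg h

theorem ind_true {p : Prop} (h : p) : ind p = 1 := if_pos h

open Classical in
theorem stateSum_eq_ind {X : Type} [Fintype X] (P : (X → Bool) → Prop) :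
    stateSum P = ∑ σ, wt σ * ind (P σ) := by
  unfold stateSum ind
  exact Fintype.sum_congr _ _ fun σ => by simp

open Classical in
theorem stateSum_sum_right {X Y : Type} [Fintype X] [Fintype Y] (P : (X ⊕ Y → Bool) → Prop) :
    stateSum P = ∑ τ : Y → Bool, wt τ * stateSum fun σ : X → Bool => P (Sum.elim σ τ) := by
  rw [stateSum_sum]
  simp only [stateSum_eq_ind, Finset.mul_sum]
  rw [Finset.sum_comm]
  exact Fintype.sum_congr _ _ fun σ => Fintype.sum_congr _ _ fun τ => by ring

open Classical in
theorem sum_wt_mul_ind {X : Type} [Fintype X] (P P' : (X → Bool) → Prop) (a b : ℂ) :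
    ∑ σ, wt σ * (a * ind (P σ) + b * ind (P' σ)) = a * stateSum P + b * stateSum P' := by
  rw [stateSum_eq_ind, stateSum_eq_ind, Finset.mul_sum, Finset.mul_sum, ← Finset.sum_add_distrib]
  exact Fintype.sum_congr _ _ fun σ => by ring

/-- `R` together with the identifications listed in `l`. -/
def Adj {α : Type} (R : α → α → Prop) (l : List (α × α)) (x y : α) : Prop := R x y ∨ (x, y) ∈ l

section Adj

variable {α : Type} {R : α → α → Prop} {l l' : List (α × α)}

theorem Adj.left {x y : α} (h : R x y) : EqvGen (Adj R l) x y := .rel _ _ (Or.inl h)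

theorem Adj.right {x y : α} (h : (x, y) ∈ l) : EqvGen (Adj R l) x y := .rel _ _ (Or.inr h)

theorem Adj.fst {x y : α} {l : List (α × α)} : EqvGen (Adj R ((x, y) :: l)) x y :=
  Adj.right List.mem_cons_self

theorem Adj.snd {p : α × α} {x y : α} {l : List (α × α)} :
    EqvGen (Adj R (p :: (x, y) :: l)) x y :=
  Adj.right (List.mem_cons_of_mem _ List.mem_cons_self)

theorem total_adj_congr (h : ∀ t ∈ l, t ∈ l' ∨ t.swap ∈ l') (h' : ∀ t ∈ l', t ∈ l ∨ t.swap ∈ l) :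
    Total (Adj R l) ↔ Total (Adj R l') := by
  refine total_congr ?_ ?_
  · rintro x y (hxy | hxy)
    · exact Adj.left hxy
    · exact (h _ hxy).elim Adj.right fun h => (Adj.right h).symm
  · rintro x y (hxy | hxy)
    · exact Adj.left hxy
    · exact (h' _ hxy).elim Adj.right fun h => (Adj.right h).symm

end Adj

theorem total_glue_swap {α α' γ : Type} {R : α → α → Prop} {S : α' → α' → Prop} {u : γ → α}
    {v : γ → α'} : Total (Glue R S u v) ↔ Total (Glue S R v u) := by
  refine total_equiv (Equiv.sumComm α α') ?_ ?_
  · rintro _ _ (h | h | g)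
    · exact .rel _ _ (.right h)
    · exact .rel _ _ (.left h)
    · exact (EqvGen.rel _ _ (.mid g)).symm
  · rintro _ _ (h | h | g)
    · exact .rel _ _ (.right h)
    · exact .rel _ _ (.left h)
    · exact (EqvGen.rel _ _ (.mid g)).symm

namespace Diagram

variable {β β' : Type}

/-- In all state sums, the diagram `B` with endpoints `v` (at NW, NE, SE, SW) may be replaced by
`a` times two horizontal arcs plus `b` times two vertical arcs. -/
def Expands (B : Diagram β) (v : Fin 4 → β) (a b : ℂ) : Prop :=
  ∀ (α : Type) (R : α → α → Prop) (u : Fin 4 → α),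
    (stateSum fun σ : B.X → Bool => Total (Glue R (B.StateRel σ) u (B.bd ∘ v))) =
      a * ind (Total (Adj R [(u 0, u 1), (u 3, u 2)])) +
      b * ind (Total (Adj R [(u 0, u 3), (u 1, u 2)]))

theorem Expands.relabel {B : Diagram β} {f : β' → β} {v : Fin 4 → β'} {a b : ℂ}
    (h : B.Expands (f ∘ v) a b) : (B.relabel f).Expands v a b := h

theorem total_glue_comp_equiv {α α' γ γ' : Type} {R : α → α → Prop} {S : α' → α' → Prop}
    {u : γ → α} {v : γ → α'} (e : γ' ≃ γ) :
    Total (Glue R S (u ∘ e) (v ∘ e)) ↔ Total (Glue R S u v) := by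
  refine total_congr ?_ ?_
  · rintro _ _ (h | h | g)
    · exact .rel _ _ (.left h)
    · exact .rel _ _ (.right h)
    · exact .rel _ _ (.mid (u := u) (v := v) (e g))
  · rintro _ _ (h | h | g)
    · exact .rel _ _ (.left h)
    · exact .rel _ _ (.right h)
    · obtain ⟨g, rfl⟩ := e.surjective g
      exact .rel _ _ (.mid (u := u ∘ e) (v := v ∘ e) g)

/-- Renaming the endpoints of `B` is undone by renaming the points to which they are attached. Only
the effect on the two arc patterns remains to be computed: a quarter turn exchanges them and the
flips keep them. -/
theorem Expands.comp_equiv {B : Diagram β} {v : Fin 4 → β} {a b a' b' : ℂ} (h : B.Expands v a b)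
    (e : Fin 4 ≃ Fin 4)
    (h' : ∀ (α : Type) (R : α → α → Prop) (u : Fin 4 → α),
      a * ind (Total (Adj R [(u (e.symm 0), u (e.symm 1)), (u (e.symm 3), u (e.symm 2))])) +
      b * ind (Total (Adj R [(u (e.symm 0), u (e.symm 3)), (u (e.symm 1), u (e.symm 2))])) =
      a' * ind (Total (Adj R [(u 0, u 1), (u 3, u 2)])) +
      b' * ind (Total (Adj R [(u 0, u 3), (u 1, u 2)]))) :
    B.Expands (v ∘ e) a' b' := by
  intro α R u
  rw [← h', ← h α R fun k => u (e.symm k)]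
  refine stateSum_congr fun σ => ?_
  have := total_glue_comp_equiv (R := R) (S := B.StateRel σ) (u := fun k => u (e.symm k))
    (v := B.bd ∘ v) e
  rw [← this]
  simp [Function.comp_def]

theorem Expands.rotate {B : Diagram β} {v : Fin 4 → β} {a b : ℂ} (h : B.Expands v a b) :
    B.Expands (v ∘ (· + 1)) b a := by
  refine h.comp_equiv ⟨(· + 1), ![3, 0, 1, 2], by decide, by decide⟩ fun α R u => ?_
  rw [add_comm]
  congr 2 <;> refine ind_congr (total_adj_congr ?_ ?_) <;> simp

theorem Expands.hFlip {B : Diagram β} {v : Fin 4 → β} {a b : ℂ} (h : B.Expands v a b) :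
    B.Expands (v ∘ ![1, 0, 3, 2]) a b := by
  refine h.comp_equiv ⟨![1, 0, 3, 2], ![1, 0, 3, 2], by decide, by decide⟩ fun α R u => ?_
  congr 2 <;> refine ind_congr (total_adj_congr ?_ ?_) <;> simp

theorem Expands.vFlip {B : Diagram β} {v : Fin 4 → β} {a b : ℂ} (h : B.Expands v a b) :
    B.Expands (v ∘ ![3, 2, 1, 0]) a b := by
  refine h.comp_equiv ⟨![3, 2, 1, 0], ![3, 2, 1, 0], by decide, by decide⟩ fun α R u => ?_
  congr 2 <;> refine ind_congr (total_adj_congr ?_ ?_) <;> simp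

theorem Expands.turnOver {B : Diagram β} {v : Fin 4 → β} {a b : ℂ} (h : B.Expands v a b) :
    B.turnOver.Expands v a b := by
  intro α R u
  rw [← h α R u]
  refine stateSum_congr fun σ => total_congr ?_ ?_
  · rintro _ _ (h | h | g)
    · exact .rel _ _ (.left h)
    · exact (EqvGen.rel _ _ (.right ((stateRel_turnOver B σ _ _).1 h))).symm
    · exact .rel _ _ (.mid (u := u) (v := B.bd ∘ v) g)
  · rintro _ _ (h | h | g)
    · exact .rel _ _ (.left h)
    · exact (EqvGen.rel _ _ (.right ((stateRel_turnOver B σ _ _).2 h))).symm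
    · exact .rel _ _ (.mid (u := u) (v := B.turnOver.bd ∘ v) g)

/-- The state sum of `B` with its right endpoints connected to each other. -/
theorem Expands.close {B : Diagram β} {v : Fin 4 → β} {a b : ℂ} (h : B.Expands v a b)
    {α : Type} (R : α → α → Prop) (x y : α) :
    (stateSum fun σ : B.X → Bool => Total (Glue R (Adj (B.StateRel σ) [(B.bd (v 1), B.bd (v 2))])
      ![x, y] ![B.bd (v 0), B.bd (v 3)])) = a * ind (Total (Adj R [(x, y)])) := by
  -- The connection of the right endpoints is modelled by one extra point to which both are
  -- attached, so that the expansion of `B` applies to `α ⊕ Unit`.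
  let R' : α ⊕ Unit → α ⊕ Unit → Prop := Relation.Map R Sum.inl Sum.inl
  let u : Fin 4 → α ⊕ Unit := ![Sum.inl x, Sum.inr (), Sum.inr (), Sum.inl y]
  have key := h (α ⊕ Unit) R' u
  have h₁ : Total (Adj R' [(u 0, u 1), (u 3, u 2)]) ↔ Total (Adj R [(x, y)]) := by
    refine total_surj (Sum.elim id fun _ => x) (fun z => ⟨Sum.inl z, rfl⟩) ?_ ?_ ?_
    · rintro _ _ (⟨z, w, hzw, rfl, rfl⟩ | hp)
      · exact Adj.left hzw
      · simp only [List.mem_cons, List.not_mem_nil, or_false] at hp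
        rcases hp with hp | hp <;> obtain ⟨rfl, rfl⟩ := Prod.ext_iff.1 hp
        · exact .refl _
        · exact (Adj.fst).symm
    · rintro z w (hzw | hp)
      · exact ⟨Sum.inl z, Sum.inl w, rfl, rfl, Adj.left ⟨z, w, hzw, rfl, rfl⟩⟩
      · obtain ⟨rfl, rfl⟩ := Prod.ext_iff.1 (List.mem_singleton.1 hp)
        exact ⟨u 0, u 3, rfl, rfl, .trans _ (u 1) _ Adj.fst (Adj.snd (R := R')).symm⟩
    · rintro (z | ⟨⟩) (w | ⟨⟩) hzw
      · obtain rfl : z = w := hzw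
        exact .refl _
      · obtain rfl : z = x := hzw
        exact Adj.fst (R := R')
      · obtain rfl : x = w := hzw
        exact (Adj.fst (R := R')).symm
      · exact .refl _
  -- With vertical arcs the extra point is connected only to itself: it is a separate circle, and
  -- the coefficient `b` drops out.
  have h₂ : ¬ Total (Adj R' [(u 0, u 3), (u 1, u 2)]) := by
    intro ht
    have key : ∀ p q, EqvGen (Adj R' [(u 0, u 3), (u 1, u 2)]) p q → (p.isLeft ↔ q.isLeft) := by
      intro p q hpq
      induction hpq with
      | rel p q h =>
        rcases h with ⟨z, w, hzw, rfl, rfl⟩ | hp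
        · rfl
        · simp only [List.mem_cons, List.not_mem_nil, or_false] at hp
          rcases hp with hp | hp <;> obtain ⟨rfl, rfl⟩ := Prod.ext_iff.1 hp <;> rfl
      | refl => rfl
      | symm _ _ _ ih => exact ih.symm
      | trans _ _ _ _ _ ih ih' => exact ih.trans ih'
    simpa using key _ _ (ht (Sum.inl x) (Sum.inr ()))
  rw [ind_congr h₁, ind_false h₂, mul_zero, add_zero] at key
  rw [← key]
  -- The extra point is contracted onto the edge of `B` at `v 1`.
  refine stateSum_congr fun σ => (total_surj
    (Sum.elim (Sum.elim Sum.inl fun _ => Sum.inr (B.bd (v 1))) Sum.inr) ?_ ?_ ?_ ?_).symm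
  · rintro (z | e)
    · exact ⟨Sum.inl (Sum.inl z), rfl⟩
    · exact ⟨Sum.inr e, rfl⟩
  · rintro _ _ (⟨z, w, hzw, rfl, rfl⟩ | h | g)
    · exact .rel _ _ (.left hzw)
    · exact .rel _ _ (.right (Or.inl h))
    · fin_cases g
      · exact .rel _ _ (.mid (u := ![x, y]) (v := ![B.bd (v 0), B.bd (v 3)]) 0)
      · exact .refl _
      · exact .rel _ _ (.right (Or.inr (List.mem_singleton.2 rfl)))
      · exact .rel _ _ (.mid (u := ![x, y]) (v := ![B.bd (v 0), B.bd (v 3)]) 1)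
  · rintro _ _ (h | h | g)
    · exact ⟨Sum.inl (Sum.inl _), Sum.inl (Sum.inl _), rfl, rfl,
        .rel _ _ (.left ⟨_, _, h, rfl, rfl⟩)⟩
    · refine ⟨Sum.inr _, Sum.inr _, rfl, rfl, ?_⟩
      rcases h with h | h
      · exact .rel _ _ (.right h)
      · obtain ⟨rfl, rfl⟩ := Prod.ext_iff.1 (List.mem_singleton.1 h)
        exact .trans _ (Sum.inl (u 1)) _
          (EqvGen.rel _ _ (.mid (u := u) (v := B.bd ∘ v) 1)).symm
          (.rel _ _ (.mid (u := u) (v := B.bd ∘ v) 2))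
    · fin_cases g
      · exact ⟨Sum.inl (u 0), Sum.inr _, rfl, rfl, .rel _ _ (.mid (u := u) (v := B.bd ∘ v) 0)⟩
      · exact ⟨Sum.inl (u 3), Sum.inr _, rfl, rfl, .rel _ _ (.mid (u := u) (v := B.bd ∘ v) 3)⟩
  · have hm : EqvGen (Glue R' (B.StateRel σ) u (B.bd ∘ v)) (Sum.inl (Sum.inr ()))
        (Sum.inr (B.bd (v 1))) := .rel _ _ (.mid (u := u) (v := B.bd ∘ v) 1)
    rintro ((z | ⟨⟩) | e) ((w | ⟨⟩) | e') hzw <;>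
      simp only [Sum.elim_inl, Sum.elim_inr, Sum.inl.injEq, Sum.inr.injEq, reduceCtorEq] at hzw
    · subst hzw
      exact .refl _
    · exact .refl _
    · subst hzw
      exact hm
    · subst hzw
      exact hm.symm
    · subst hzw
      exact .refl _

end Diagram

end Tangle

/-! ### Expansions of connect sums -/

namespace Tangle

open Relation Diagram

namespace PTangle

variable {κ κ' : Type}

/-- The expansion of a tangle at its outer endpoints. -/
abbrev OuterExpands (B : PTangle κ) (a b : ℂ) : Prop := Diagram.Expands B Sum.inl a b

theorem OuterExpands.rot {B : PTangle κ} {a b : ℂ} (h : OuterExpands B a b) :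
    OuterExpands (rot B) b a :=
  Expands.relabel (Expands.rotate h)

theorem stateRel_hsum_cases {B : PTangle κ} {B' : PTangle κ'} {σ : B.X → Bool} {τ : B'.X → Bool}
    {a b : (hsum B B').E} (h : (hsum B B').StateRel (Sum.elim σ τ) a b) :
    (∃ e e', a = Quot.mk _ (Sum.inl e) ∧ b = Quot.mk _ (Sum.inl e') ∧ B.StateRel σ e e') ∨
      ∃ e e', a = Quot.mk _ (Sum.inr e) ∧ b = Quot.mk _ (Sum.inr e') ∧ B'.StateRel τ e e' := by
  obtain ⟨e, e', rfl, rfl, h'⟩ := exists_of_stateRel_join (D := B.disj B') h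
  obtain ⟨e, e', rfl, rfl, h''⟩ | ⟨e, e', rfl, rfl, h''⟩ := stateRel_disj_cases h'
  · exact Or.inl ⟨e, e', rfl, rfl, h''⟩
  · exact Or.inr ⟨e, e', rfl, rfl, h''⟩

/-- The glueing is done in two stages: `B` is attached to the surroundings by its left endpoints,
and the result serves as the surroundings of all four endpoints of `B'`. The expansion of `B'` then
applies directly. -/
theorem total_hsum_iff (B : PTangle κ) (B' : PTangle κ') (σ : B.X → Bool) (τ : B'.X → Bool)
    {α : Type} (R : α → α → Prop) (u : Fin 4 → α) :
    Total (Glue R ((hsum B B').StateRel (Sum.elim σ τ)) u ((hsum B B').bd ∘ Sum.inl)) ↔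
      Total (Glue
        (Glue R (B.StateRel σ) ![u 0, u 3] ![B.bd (Sum.inl 0), B.bd (Sum.inl 3)]) (B'.StateRel τ)
        ![Sum.inr (B.bd (Sum.inl 1)), Sum.inl (u 1), Sum.inl (u 2), Sum.inr (B.bd (Sum.inl 2))]
        (B'.bd ∘ Sum.inl)) := by
  let mk : B.E ⊕ B'.E → (hsum B B').E := Quot.mk _
  set R₁ := Glue R (B.StateRel σ) ![u 0, u 3] ![B.bd (Sum.inl 0), B.bd (Sum.inl 3)]
  set u₁ : Fin 4 → α ⊕ B.E :=
    ![Sum.inr (B.bd (Sum.inl 1)), Sum.inl (u 1), Sum.inl (u 2), Sum.inr (B.bd (Sum.inl 2))]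
  have hj : ∀ k l, (k = 1 ∧ l = 0) ∨ (k = 2 ∧ l = 3) →
      mk (Sum.inl (B.bd (Sum.inl k))) = mk (Sum.inr (B'.bd (Sum.inl l))) := by
    rintro k l (⟨rfl, rfl⟩ | ⟨rfl, rfl⟩)
    · exact Quot.sound ⟨_, Or.inl rfl, rfl, rfl⟩
    · exact Quot.sound ⟨_, Or.inr rfl, rfl, rfl⟩
  refine (total_surj (Sum.elim (Sum.elim Sum.inl fun e => Sum.inr (mk (Sum.inl e)))
    fun e => Sum.inr (mk (Sum.inr e))) ?_ ?_ ?_ ?_).symm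
  · rintro (x | e)
    · exact ⟨Sum.inl (Sum.inl x), rfl⟩
    · induction e using Quot.ind with
      | mk e =>
        rcases e with e | e
        · exact ⟨Sum.inl (Sum.inr e), rfl⟩
        · exact ⟨Sum.inr e, rfl⟩
  · rintro _ _ ((h | h | g) | h | g)
    · exact .rel _ _ (.left h)
    · exact .rel _ _ (.right (stateRel_join (stateRel_disj_inl h)))
    · fin_cases g
      · exact .rel _ _ (.mid (u := u) (v := (hsum B B').bd ∘ Sum.inl) 0)
      · exact .rel _ _ (.mid (u := u) (v := (hsum B B').bd ∘ Sum.inl) 3)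
    · exact .rel _ _ (.right (stateRel_join (stateRel_disj_inr h)))
    · fin_cases g
      · change EqvGen _ (Sum.inr (mk (Sum.inl (B.bd (Sum.inl 1)))))
          (Sum.inr (mk (Sum.inr (B'.bd (Sum.inl 0)))))
        rw [hj 1 0 (Or.inl ⟨rfl, rfl⟩)]
        exact .refl _
      · exact .rel _ _ (.mid (u := u) (v := (hsum B B').bd ∘ Sum.inl) 1)
      · exact .rel _ _ (.mid (u := u) (v := (hsum B B').bd ∘ Sum.inl) 2)
      · change EqvGen _ (Sum.inr (mk (Sum.inl (B.bd (Sum.inl 2)))))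
          (Sum.inr (mk (Sum.inr (B'.bd (Sum.inl 3)))))
        rw [hj 2 3 (Or.inr ⟨rfl, rfl⟩)]
        exact .refl _
  · rintro _ _ (h | h | g)
    · exact ⟨Sum.inl (Sum.inl _), Sum.inl (Sum.inl _), rfl, rfl, .rel _ _ (.left (.left h))⟩
    · obtain ⟨e, e', rfl, rfl, h'⟩ | ⟨e, e', rfl, rfl, h'⟩ := stateRel_hsum_cases h
      · exact ⟨Sum.inl (Sum.inr e), Sum.inl (Sum.inr e'), rfl, rfl,
          .rel _ _ (.left (.right h'))⟩
      · exact ⟨Sum.inr e, Sum.inr e', rfl, rfl, .rel _ _ (.right h')⟩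
    · fin_cases g
      · exact ⟨Sum.inl (Sum.inl (u 0)), Sum.inl (Sum.inr (B.bd (Sum.inl 0))), rfl, rfl,
          .rel _ _ (.left (.mid (u := ![u 0, u 3])
            (v := ![B.bd (Sum.inl 0), B.bd (Sum.inl 3)]) 0))⟩
      · exact ⟨Sum.inl (Sum.inl (u 1)), Sum.inr (B'.bd (Sum.inl 1)), rfl, rfl,
          .rel _ _ (.mid (u := u₁) (v := B'.bd ∘ Sum.inl) 1)⟩
      · exact ⟨Sum.inl (Sum.inl (u 2)), Sum.inr (B'.bd (Sum.inl 2)), rfl, rfl,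
          .rel _ _ (.mid (u := u₁) (v := B'.bd ∘ Sum.inl) 2)⟩
      · exact ⟨Sum.inl (Sum.inl (u 3)), Sum.inl (Sum.inr (B.bd (Sum.inl 3))), rfl, rfl,
          .rel _ _ (.left (.mid (u := ![u 0, u 3])
            (v := ![B.bd (Sum.inl 0), B.bd (Sum.inl 3)]) 1))⟩
  · have key : ∀ e e' : B.E ⊕ B'.E, mk e = mk e' →
        EqvGen (Glue R₁ (B'.StateRel τ) u₁ (B'.bd ∘ Sum.inl)) (Sum.map Sum.inr id e)
          (Sum.map Sum.inr id e') := by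
      intro e e' h
      refine eqvGen_map _ ?_ (Quot.eqvGen_exact h)
      rintro _ _ ⟨p, rfl | rfl, rfl, rfl⟩
      · exact .rel _ _ (.mid (u := u₁) (v := B'.bd ∘ Sum.inl) 0)
      · exact .rel _ _ (.mid (u := u₁) (v := B'.bd ∘ Sum.inl) 3)
    rintro ((x | e) | e) ((x' | e') | e') h <;>
      simp only [Sum.elim_inl, Sum.elim_inr, Sum.inl.injEq, Sum.inr.injEq, reduceCtorEq] at h
    · subst h
      exact .refl _
    · exact key (Sum.inl e) (Sum.inl e') h
    · exact key (Sum.inl e) (Sum.inr e') h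
    · exact key (Sum.inr e) (Sum.inl e') h
    · exact key (Sum.inr e) (Sum.inr e') h

/-- Among the arc patterns, horizontal beside horizontal is horizontal, a mixed pair is vertical,
and vertical beside vertical has an extra circle and counts zero. -/
theorem OuterExpands.hsum {B : PTangle κ} {B' : PTangle κ'} {a b a' b' : ℂ}
    (h : OuterExpands B a b) (h' : OuterExpands B' a' b') :
    OuterExpands (hsum B B') (a * a') (a * b' + b * a') := by
  classical
  intro α R u
  refine (stateSum_sum (X := B.X) (Y := B'.X) _).trans ?_
  have step : ∀ σ : B.X → Bool, (stateSum fun τ : B'.X → Bool =>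
      Total (Glue R ((PTangle.hsum B B').StateRel (Sum.elim σ τ)) u
        ((PTangle.hsum B B').bd ∘ Sum.inl))) =
      -- The horizontal part of `B'` merely prolongs the right ends of `B`; its vertical part closes
      -- `B` on the right and joins `u 1` with `u 2`, which is the situation of `Expands.close`.
      a' * ind (Total (Glue R (B.StateRel σ) u (B.bd ∘ Sum.inl))) +
      b' * ind (Total (Glue (Adj R [(u 1, u 2)])
        (Adj (B.StateRel σ) [(B.bd (Sum.inl 1), B.bd (Sum.inl 2))]) ![u 0, u 3]
        ![B.bd (Sum.inl 0), B.bd (Sum.inl 3)])) := by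
    intro σ
    rw [stateSum_congr fun τ => total_hsum_iff B B' σ τ R u, h']
    congr 2
    · refine ind_congr (total_congr ?_ ?_)
      · rintro _ _ ((h | h | g) | hp)
        · exact .rel _ _ (.left h)
        · exact .rel _ _ (.right h)
        · fin_cases g
          · exact .rel _ _ (.mid (u := u) (v := B.bd ∘ Sum.inl) 0)
          · exact .rel _ _ (.mid (u := u) (v := B.bd ∘ Sum.inl) 3)
        · simp only [List.mem_cons, List.not_mem_nil, or_false] at hp
          rcases hp with hp | hp <;> obtain ⟨rfl, rfl⟩ := Prod.ext_iff.1 hp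
          · exact (EqvGen.rel _ _ (.mid (u := u) (v := B.bd ∘ Sum.inl) 1)).symm
          · exact (EqvGen.rel _ _ (.mid (u := u) (v := B.bd ∘ Sum.inl) 2)).symm
      · rintro _ _ (h | h | g)
        · exact Adj.left (.left h)
        · exact Adj.left (.right h)
        · fin_cases g
          · exact Adj.left (.mid (u := ![u 0, u 3])
              (v := ![B.bd (Sum.inl 0), B.bd (Sum.inl 3)]) 0)
          · exact (Adj.fst).symm
          · exact (Adj.snd).symm
          · exact Adj.left (.mid (u := ![u 0, u 3])
              (v := ![B.bd (Sum.inl 0), B.bd (Sum.inl 3)]) 1)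
    · refine ind_congr (total_congr ?_ ?_)
      · rintro _ _ ((h | h | g) | hp)
        · exact .rel _ _ (.left (Or.inl h))
        · exact .rel _ _ (.right (Or.inl h))
        · exact .rel _ _ (.mid g)
        · simp only [List.mem_cons, List.not_mem_nil, or_false] at hp
          rcases hp with hp | hp <;> obtain ⟨rfl, rfl⟩ := Prod.ext_iff.1 hp
          · exact .rel _ _ (.right (Or.inr (List.mem_singleton.2 rfl)))
          · exact .rel _ _ (.left (Or.inr (List.mem_singleton.2 rfl)))
      · rintro _ _ ((h | hp) | (h | hp) | g)
        · exact Adj.left (.left h)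
        · obtain ⟨rfl, rfl⟩ := Prod.ext_iff.1 (List.mem_singleton.1 hp)
          exact Adj.snd
        · exact Adj.left (.right h)
        · obtain ⟨rfl, rfl⟩ := Prod.ext_iff.1 (List.mem_singleton.1 hp)
          exact Adj.fst
        · exact Adj.left (.mid g)
  refine (Fintype.sum_congr _ _ fun σ => congrArg (wt σ * ·) (step σ)).trans ?_
  rw [sum_wt_mul_ind, h, Expands.close (v := Sum.inl) h]
  have : Total (Adj (Adj R [(u 1, u 2)]) [(u 0, u 3)]) ↔
      Total (Adj R [(u 0, u 3), (u 1, u 2)]) := by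
    refine total_congr ?_ ?_
    · rintro x y ((h | hp) | hp)
      · exact Adj.left h
      · obtain ⟨rfl, rfl⟩ := Prod.ext_iff.1 (List.mem_singleton.1 hp)
        exact Adj.snd
      · obtain ⟨rfl, rfl⟩ := Prod.ext_iff.1 (List.mem_singleton.1 hp)
        exact Adj.fst
    · rintro x y (h | hp)
      · exact Adj.left (Or.inl h)
      · simp only [List.mem_cons, List.not_mem_nil, or_false] at hp
        rcases hp with hp | hp <;> obtain ⟨rfl, rfl⟩ := Prod.ext_iff.1 hp
        · exact Adj.fst
        · exact Adj.left (Or.inr (List.mem_singleton.2 rfl))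
  rw [ind_congr this]
  ring

end PTangle

namespace BT

open PTangle

variable {B B' : BT} {a b a' b' : ℂ}

theorem outerExpands_hsum (h : OuterExpands B a b) (h' : OuterExpands B' a' b') :
    OuterExpands (BT.hsum B B') (a * a') (a * b' + b * a') :=
  Expands.relabel (OuterExpands.hsum h h')

theorem outerExpands_vsum (h : OuterExpands B a b) (h' : OuterExpands B' a' b') :
    OuterExpands (BT.vsum B B') (b * a' + a * b') (b * b') :=
  Expands.relabel (f := Sum.map id (Prod.map Empty.elim id)) (v := Sum.inl)
    (OuterExpands.hsum h.rot h'.rot).rot.rot.rot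

theorem outerExpands_hFlip (h : OuterExpands B a b) : OuterExpands (BT.hFlip B) a b :=
  Expands.relabel (f := Sum.map ![1, 0, 3, 2] id) (v := Sum.inl)
    (Expands.turnOver (Expands.hFlip h))

theorem outerExpands_vFlip (h : OuterExpands B a b) : OuterExpands (BT.vFlip B) a b :=
  Expands.relabel (f := Sum.map ![3, 2, 1, 0] id) (v := Sum.inl)
    (Expands.turnOver (Expands.vFlip h))

end BT

end Tangle

/-! ### Effect of rotations, inversion and horizontal sums on the four state sums -/

namespace Tangle

open Relation Diagram

namespace Diagram

variable {β β' : Type}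

theorem rel_eq_adj (D : Diagram β) (σ : D.X → Bool) (l : List (β × β)) :
    D.Rel σ (fun p q => (p, q) ∈ l) = Adj (D.StateRel σ) (l.map (Prod.map D.bd D.bd)) := by
  funext x y
  refine propext (or_congr Iff.rfl ?_)
  constructor
  · rintro ⟨p, q, h, rfl, rfl⟩
    exact List.mem_map.2 ⟨(p, q), h, rfl⟩
  · intro hp'
    obtain ⟨⟨p, q⟩, h, hp⟩ := List.mem_map.1 hp'
    obtain ⟨rfl, rfl⟩ := Prod.ext_iff.1 hp
    exact ⟨p, q, h, rfl, rfl⟩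

theorem adj_nil {α : Type} (R : α → α → Prop) : Adj R [] = R := by
  funext x y
  simp [Adj]

theorem total_adj_rel (D : Diagram β) (σ : D.X → Bool) (l l' : List (β × β)) :
    Total (Adj (D.Rel σ fun p q => (p, q) ∈ l) (l'.map (Prod.map D.bd D.bd))) ↔
      D.Conn σ fun p q => (p, q) ∈ l ++ l' := by
  rw [Conn, rel_eq_adj, rel_eq_adj, List.map_append]
  refine total_congr ?_ ?_
  · rintro x y ((h | h) | h)
    · exact Adj.left h
    · exact Adj.right (List.mem_append_left _ h)
    · exact Adj.right (List.mem_append_right _ h)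
  · rintro x y (h | h)
    · exact Adj.left (Or.inl h)
    · exact (List.mem_append.1 h).elim (fun h => Adj.left (Or.inr h)) Adj.right

/-- Every pair in `l` is in `l'`, up to the order of its components. -/
def pairsIn [DecidableEq β] (l l' : List (β × β)) : Bool :=
  l.all fun t => l'.any fun s => decide (s = t) || decide (s = t.swap)

theorem conn_list_congr [DecidableEq β] (D : Diagram β) (σ : D.X → Bool) {l l' : List (β × β)}
    (h : pairsIn l l' = true ∧ pairsIn l' l = true) :
    (D.Conn σ fun p q => (p, q) ∈ l) ↔ D.Conn σ fun p q => (p, q) ∈ l' := by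
  have key : ∀ {l l' : List (β × β)}, pairsIn l l' = true → ∀ p q, (p, q) ∈ l →
      EqvGen (fun p q => (p, q) ∈ l') p q := by
    intro l l' h p q hpq
    obtain ⟨s, hs, hst⟩ := List.any_eq_true.1 (List.all_eq_true.1 h _ hpq)
    rcases (by simpa using hst : s = (p, q) ∨ s = (q, p)) with rfl | rfl
    · exact .rel _ _ hs
    · exact .symm _ _ (.rel _ _ hs)
  exact conn_congr (key h.1) (key h.2)

theorem wsum_relabel_list (D : Diagram β) (f : β' → β) (l : List (β' × β')) :
    ((D.relabel f).wsum fun p q => (p, q) ∈ l) =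
      D.wsum fun p q => (p, q) ∈ l.map (Prod.map f f) := by
  rw [wsum_relabel]
  congr 1
  funext p q
  simp [Relation.Map]

end Diagram

namespace ST

open PTangle

/-- The pairs of endpoints connected by the filling `j` of the hole. -/
def holePairs (j : Fin 2) : List ((Fin 4 ⊕ Unit × Fin 4) × (Fin 4 ⊕ Unit × Fin 4)) :=
  (fillPairs j).map (Prod.map (fun k => Sum.inr ((), k)) fun k => Sum.inr ((), k))

/-- The pairs of endpoints connected in `S_{ij}`. -/
def closingPairs (i j : Fin 2) : List ((Fin 4 ⊕ Unit × Fin 4) × (Fin 4 ⊕ Unit × Fin 4)) :=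
  (outerPairs i).map (Prod.map Sum.inl Sum.inl) ++ holePairs j

theorem closing_eq (i j : Fin 2) : closing i j = fun p q => (p, q) ∈ closingPairs i j := by
  funext p q
  exact propext (closing_iff i j p q)

theorem closing_cases {i j : Fin 2} {p q : Fin 4 ⊕ Unit × Fin 4} (h : closing i j p q) :
    (∃ a b, (a, b) ∈ outerPairs i ∧ p = Sum.inl a ∧ q = Sum.inl b) ∨
      (p, q) ∈ holePairs j := by
  refine (List.mem_append.1 ((closing_iff _ _ _ _).1 h)).imp_left fun h' => ?_
  clear h
  obtain ⟨⟨a, b⟩, h, hp⟩ := List.mem_map.1 h'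
  obtain ⟨rfl, rfl⟩ := Prod.ext_iff.1 hp
  exact ⟨a, b, h, rfl, rfl⟩

theorem exists_of_mem_holePairs {j : Fin 2} {p q : Fin 4 ⊕ Unit × Fin 4}
    (h : (p, q) ∈ holePairs j) : ∃ a b : Unit × Fin 4, p = Sum.inr a ∧ q = Sum.inr b := by
  obtain ⟨⟨a, b⟩, -, hp⟩ := List.mem_map.1 h
  obtain ⟨rfl, rfl⟩ := Prod.ext_iff.1 hp
  exact ⟨_, _, rfl, rfl⟩

theorem closing_of_outer {i j : Fin 2} {a b : Fin 4} (h : (a, b) ∈ outerPairs i) :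
    closing i j (Sum.inl a) (Sum.inl b) :=
  (closing_iff _ _ _ _).2 (List.mem_append_left _ (List.mem_map.2 ⟨_, h, rfl⟩))

theorem closing_of_hole {i j : Fin 2} {p q : Fin 4 ⊕ Unit × Fin 4} (h : (p, q) ∈ holePairs j) :
    closing i j p q :=
  (closing_iff _ _ _ _).2 (List.mem_append_right _ h)

theorem wsum_perm_congr (S : ST) {l l' : List ((Fin 4 ⊕ Unit × Fin 4) × (Fin 4 ⊕ Unit × Fin 4))}
    (h : pairsIn l l' = true ∧ pairsIn l' l = true) :
    (S.wsum fun p q => (p, q) ∈ l) = S.wsum fun p q => (p, q) ∈ l' :=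
  stateSum_congr fun σ => conn_list_congr S σ h

theorem entry_r₁ (S : ST) (i j : Fin 2) : (r₁ S).entry i j = S.entry i (j + 1) := by
  rw [entry, entry, closing_eq, closing_eq]
  refine (wsum_relabel_list S _ _).trans (wsum_perm_congr S ?_)
  revert i j
  decide +kernel

theorem entry_r₂ (S : ST) (i j : Fin 2) : (r₂ S).entry i j = S.entry (i + 1) j := by
  rw [entry, entry, closing_eq, closing_eq]
  refine (wsum_relabel_list S _ _).trans (wsum_perm_congr S ?_)
  revert i j
  decide +kernel

/-- Closure and filling exchange roles. The indices shift because `0` means horizontal arcs outside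
but vertical arcs in the hole. -/
theorem entry_inv (S : ST) (i j : Fin 2) : (inv S).entry i j = S.entry (j + 1) (i + 1) := by
  rw [entry, entry, closing_eq, closing_eq]
  refine (wsum_relabel_list S.turnOver _ _).trans ((wsum_turnOver S _).trans (wsum_perm_congr S ?_))
  revert i j
  decide +kernel

/-- The endpoints of the connect sum of a spherical tangle and a ball tangle. -/
def sumEnds₂ : Fin 4 ⊕ Unit × Fin 4 → (Fin 4 ⊕ Unit × Fin 4) ⊕ (Fin 4 ⊕ Empty × Fin 4) :=
  Sum.elim ![Sum.inl (Sum.inl 0), Sum.inr (Sum.inl 1), Sum.inr (Sum.inl 2), Sum.inl (Sum.inl 3)]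
    fun p => Sum.inl (Sum.inr p)

/-- The endpoints of the connect sum of a ball tangle and a spherical tangle. -/
def sumEnds₁ : Fin 4 ⊕ Unit × Fin 4 → (Fin 4 ⊕ Empty × Fin 4) ⊕ (Fin 4 ⊕ Unit × Fin 4) :=
  Sum.elim ![Sum.inl (Sum.inl 0), Sum.inr (Sum.inl 1), Sum.inr (Sum.inl 2), Sum.inl (Sum.inl 3)]
    fun p => Sum.inr (Sum.inr p)

theorem outerH₂_eq (S : ST) (B : BT) : outerH₂ S B = ((S.disj B).join
    {(Sum.inl (Sum.inl 1), Sum.inr (Sum.inl 0)),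
      (Sum.inl (Sum.inl 2), Sum.inr (Sum.inl 3))}).relabel sumEnds₂ := by
  refine congrArg (relabel ((Diagram.disj _ _).join _)) (funext ?_)
  rintro (k | ⟨⟨⟩, k⟩) <;> rfl

theorem outerH₁_eq (B : BT) (S : ST) : outerH₁ B S = ((B.disj S).join
    {(Sum.inl (Sum.inl 1), Sum.inr (Sum.inl 0)),
      (Sum.inl (Sum.inl 2), Sum.inr (Sum.inl 3))}).relabel sumEnds₁ := by
  refine congrArg (relabel ((Diagram.disj _ _).join _)) (funext ?_)
  rintro (k | ⟨⟨⟩, k⟩) <;> rfl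

/-- The state sum of the outer horizontal sum, in terms of the relations of its summands, for the
numerator closure. -/
theorem entry_outerH₂_zero (S : ST) (B : BT) (j : Fin 2) : (outerH₂ S B).entry 0 j =
    (S.disj B).wsum (Glue (fun p q => (p, q) ∈ holePairs j) (fun p q => (p, q) ∈ [])
      ![Sum.inl 1, Sum.inl 0, Sum.inl 3, Sum.inl 2] Sum.inl) := by
  rw [entry, outerH₂_eq]
  refine stateSum_congr fun σ => (conn_relabel _ _ _ _).trans
    ((conn_join _ _ _ _).trans (conn_congr ?_ ?_))
  · rintro _ _ ((hp | hp) | ⟨p, q, h, rfl, rfl⟩)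
    · obtain ⟨rfl, rfl⟩ := Prod.ext_iff.1 hp
      exact .rel _ _ (.mid (u := ![Sum.inl 1, Sum.inl 0, Sum.inl 3, Sum.inl 2]) (v := Sum.inl) 0)
    · obtain ⟨rfl, rfl⟩ := Prod.ext_iff.1 hp
      exact .rel _ _ (.mid (u := ![Sum.inl 1, Sum.inl 0, Sum.inl 3, Sum.inl 2]) (v := Sum.inl) 3)
    · rcases closing_cases h with ⟨a, b, h', rfl, rfl⟩ | h
      · simp only [outerPairs, if_pos, List.mem_cons, Prod.mk.injEq, List.not_mem_nil, or_false] at h'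
        rcases h' with ⟨rfl, rfl⟩ | ⟨rfl, rfl⟩
        · exact .rel _ _
            (.mid (u := ![Sum.inl 1, Sum.inl 0, Sum.inl 3, Sum.inl 2]) (v := Sum.inl) 1)
        · exact .rel _ _
            (.mid (u := ![Sum.inl 1, Sum.inl 0, Sum.inl 3, Sum.inl 2]) (v := Sum.inl) 2)
      · obtain ⟨a, b, rfl, rfl⟩ := exists_of_mem_holePairs h
        exact .rel _ _ (.left h)
  · rintro _ _ (h | h | g)
    · obtain ⟨a, b, rfl, rfl⟩ := exists_of_mem_holePairs h
      exact .rel _ _ (Or.inr ⟨_, _, closing_of_hole h, rfl, rfl⟩)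
    · exact absurd h List.not_mem_nil
    · fin_cases g
      · exact .rel _ _ (Or.inl (Or.inl rfl))
      · exact .rel _ _ (Or.inr ⟨Sum.inl 0, Sum.inl 1, closing_of_outer (by decide), rfl, rfl⟩)
      · exact .rel _ _ (Or.inr ⟨Sum.inl 3, Sum.inl 2, closing_of_outer (by decide), rfl, rfl⟩)
      · exact .rel _ _ (Or.inl (Or.inr rfl))

/-- In the denominator closure each summand is closed on its free side, and the two meet in two
points only, so that `Expands.close` becomes applicable. -/
theorem entry_outerH₂_one (S : ST) (B : BT) (j : Fin 2) : (outerH₂ S B).entry 1 j =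
    (S.disj B).wsum (Glue (fun p q => (p, q) ∈ holePairs j ++ [(Sum.inl 0, Sum.inl 3)])
      (fun p q => (p, q) ∈ [(Sum.inl 1, Sum.inl 2)])
      ![Sum.inl 1, Sum.inl 2] ![Sum.inl 0, Sum.inl 3]) := by
  rw [entry, outerH₂_eq]
  refine stateSum_congr fun σ => (conn_relabel _ _ _ _).trans
    ((conn_join _ _ _ _).trans (conn_congr ?_ ?_))
  · rintro _ _ ((hp | hp) | ⟨p, q, h, rfl, rfl⟩)
    · obtain ⟨rfl, rfl⟩ := Prod.ext_iff.1 hp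
      exact .rel _ _ (.mid (u := ![Sum.inl 1, Sum.inl 2]) (v := ![Sum.inl 0, Sum.inl 3]) 0)
    · obtain ⟨rfl, rfl⟩ := Prod.ext_iff.1 hp
      exact .rel _ _ (.mid (u := ![Sum.inl 1, Sum.inl 2]) (v := ![Sum.inl 0, Sum.inl 3]) 1)
    · rcases closing_cases h with ⟨a, b, h', rfl, rfl⟩ | h
      · simp only [outerPairs, one_ne_zero, if_false, List.mem_cons, Prod.mk.injEq,
          List.not_mem_nil, or_false] at h'
        rcases h' with ⟨rfl, rfl⟩ | ⟨rfl, rfl⟩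
        · exact .rel _ _ (.left (List.mem_append_right _ (List.mem_singleton.2 rfl)))
        · exact .rel _ _ (.right (List.mem_singleton.2 rfl))
      · obtain ⟨a, b, rfl, rfl⟩ := exists_of_mem_holePairs h
        exact .rel _ _ (.left (List.mem_append_left _ h))
  · rintro _ _ (h | h | g)
    · rcases List.mem_append.1 h with h | h
      · obtain ⟨a, b, rfl, rfl⟩ := exists_of_mem_holePairs h
        exact .rel _ _ (Or.inr ⟨_, _, closing_of_hole h, rfl, rfl⟩)
      · obtain ⟨rfl, rfl⟩ := Prod.ext_iff.1 (List.mem_singleton.1 h)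
        exact .rel _ _ (Or.inr ⟨Sum.inl 0, Sum.inl 3, closing_of_outer (by decide), rfl, rfl⟩)
    · obtain ⟨rfl, rfl⟩ := Prod.ext_iff.1 (List.mem_singleton.1 h)
      exact .rel _ _ (Or.inr ⟨Sum.inl 1, Sum.inl 2, closing_of_outer (by decide), rfl, rfl⟩)
    · fin_cases g
      · exact .rel _ _ (Or.inl (Or.inl rfl))
      · exact .rel _ _ (Or.inl (Or.inr rfl))

theorem entry_outerH₁_zero (B : BT) (S : ST) (j : Fin 2) : (outerH₁ B S).entry 0 j =
    (B.disj S).wsum (Glue (fun p q => (p, q) ∈ []) (fun p q => (p, q) ∈ holePairs j)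
      Sum.inl ![Sum.inl 1, Sum.inl 0, Sum.inl 3, Sum.inl 2]) := by
  rw [entry, outerH₁_eq]
  refine stateSum_congr fun σ => (conn_relabel _ _ _ _).trans
    ((conn_join _ _ _ _).trans (conn_congr ?_ ?_))
  · rintro _ _ ((hp | hp) | ⟨p, q, h, rfl, rfl⟩)
    · obtain ⟨rfl, rfl⟩ := Prod.ext_iff.1 hp
      exact .rel _ _ (.mid (v := ![Sum.inl 1, Sum.inl 0, Sum.inl 3, Sum.inl 2]) (u := Sum.inl) 1)
    · obtain ⟨rfl, rfl⟩ := Prod.ext_iff.1 hp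
      exact .rel _ _ (.mid (v := ![Sum.inl 1, Sum.inl 0, Sum.inl 3, Sum.inl 2]) (u := Sum.inl) 2)
    · rcases closing_cases h with ⟨a, b, h', rfl, rfl⟩ | h
      · simp only [outerPairs, if_pos, List.mem_cons, Prod.mk.injEq, List.not_mem_nil, or_false] at h'
        rcases h' with ⟨rfl, rfl⟩ | ⟨rfl, rfl⟩
        · exact .rel _ _
            (.mid (v := ![Sum.inl 1, Sum.inl 0, Sum.inl 3, Sum.inl 2]) (u := Sum.inl) 0)
        · exact .rel _ _
            (.mid (v := ![Sum.inl 1, Sum.inl 0, Sum.inl 3, Sum.inl 2]) (u := Sum.inl) 3)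
      · obtain ⟨a, b, rfl, rfl⟩ := exists_of_mem_holePairs h
        exact .rel _ _ (.right h)
  · rintro _ _ (h | h | g)
    · exact absurd h List.not_mem_nil
    · obtain ⟨a, b, rfl, rfl⟩ := exists_of_mem_holePairs h
      exact .rel _ _ (Or.inr ⟨_, _, closing_of_hole h, rfl, rfl⟩)
    · fin_cases g
      · exact .rel _ _ (Or.inr ⟨Sum.inl 0, Sum.inl 1, closing_of_outer (by decide), rfl, rfl⟩)
      · exact .rel _ _ (Or.inl (Or.inl rfl))
      · exact .rel _ _ (Or.inl (Or.inr rfl))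
      · exact .rel _ _ (Or.inr ⟨Sum.inl 3, Sum.inl 2, closing_of_outer (by decide), rfl, rfl⟩)

theorem entry_outerH₁_one (B : BT) (S : ST) (j : Fin 2) : (outerH₁ B S).entry 1 j =
    (B.disj S).wsum (Glue (fun p q => (p, q) ∈ [(Sum.inl 0, Sum.inl 3)])
      (fun p q => (p, q) ∈ holePairs j ++ [(Sum.inl 1, Sum.inl 2)])
      ![Sum.inl 1, Sum.inl 2] ![Sum.inl 0, Sum.inl 3]) := by
  rw [entry, outerH₁_eq]
  refine stateSum_congr fun σ => (conn_relabel _ _ _ _).trans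
    ((conn_join _ _ _ _).trans (conn_congr ?_ ?_))
  · rintro _ _ ((hp | hp) | ⟨p, q, h, rfl, rfl⟩)
    · obtain ⟨rfl, rfl⟩ := Prod.ext_iff.1 hp
      exact .rel _ _ (.mid (u := ![Sum.inl 1, Sum.inl 2]) (v := ![Sum.inl 0, Sum.inl 3]) 0)
    · obtain ⟨rfl, rfl⟩ := Prod.ext_iff.1 hp
      exact .rel _ _ (.mid (u := ![Sum.inl 1, Sum.inl 2]) (v := ![Sum.inl 0, Sum.inl 3]) 1)
    · rcases closing_cases h with ⟨a, b, h', rfl, rfl⟩ | h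
      · simp only [outerPairs, one_ne_zero, if_false, List.mem_cons, Prod.mk.injEq,
          List.not_mem_nil, or_false] at h'
        rcases h' with ⟨rfl, rfl⟩ | ⟨rfl, rfl⟩
        · exact .rel _ _ (.left (List.mem_singleton.2 rfl))
        · exact .rel _ _ (.right (List.mem_append_right _ (List.mem_singleton.2 rfl)))
      · obtain ⟨a, b, rfl, rfl⟩ := exists_of_mem_holePairs h
        exact .rel _ _ (.right (List.mem_append_left _ h))
  · rintro _ _ (h | h | g)
    · obtain ⟨rfl, rfl⟩ := Prod.ext_iff.1 (List.mem_singleton.1 h)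
      exact .rel _ _ (Or.inr ⟨Sum.inl 0, Sum.inl 3, closing_of_outer (by decide), rfl, rfl⟩)
    · rcases List.mem_append.1 h with h | h
      · obtain ⟨a, b, rfl, rfl⟩ := exists_of_mem_holePairs h
        exact .rel _ _ (Or.inr ⟨_, _, closing_of_hole h, rfl, rfl⟩)
      · obtain ⟨rfl, rfl⟩ := Prod.ext_iff.1 (List.mem_singleton.1 h)
        exact .rel _ _ (Or.inr ⟨Sum.inl 1, Sum.inl 2, closing_of_outer (by decide), rfl, rfl⟩)
    · fin_cases g
      · exact .rel _ _ (Or.inl (Or.inl rfl))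
      · exact .rel _ _ (Or.inl (Or.inr rfl))

open Classical in
-- In the numerator closure of the sum, `B` meets `S` in all four outer endpoints. Its horizontal
-- arcs close `S` as a numerator, and its vertical arcs as a denominator.
theorem sum_glue_zero (S : ST) {B : BT} {a b : ℂ} (h : OuterExpands B a b) (j : Fin 2) :
    ∑ τ : S.X → Bool, wt τ * (stateSum fun σ : B.X → Bool =>
      Total (Glue (S.Rel τ fun p q => (p, q) ∈ holePairs j) (B.Rel σ fun p q => (p, q) ∈ [])
        (S.bd ∘ ![Sum.inl 1, Sum.inl 0, Sum.inl 3, Sum.inl 2]) (B.bd ∘ Sum.inl))) =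
      a * S.entry 0 j + b * S.entry 1 j := by
  have step : ∀ τ : S.X → Bool, (stateSum fun σ : B.X → Bool =>
      Total (Glue (S.Rel τ fun p q => (p, q) ∈ holePairs j) (B.Rel σ fun p q => (p, q) ∈ [])
        (S.bd ∘ ![Sum.inl 1, Sum.inl 0, Sum.inl 3, Sum.inl 2]) (B.bd ∘ Sum.inl))) =
      a * ind (S.Conn τ (closing 0 j)) + b * ind (S.Conn τ (closing 1 j)) := by
    intro τ
    simp only [rel_eq_adj B, List.map_nil, adj_nil]
    rw [h, closing_eq, closing_eq]
    congr 2
    · refine ind_congr ((total_adj_rel S τ (holePairs j)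
        [(Sum.inl 1, Sum.inl 0), (Sum.inl 2, Sum.inl 3)]).trans (conn_list_congr S τ ?_))
      revert j
      decide +kernel
    · refine ind_congr ((total_adj_rel S τ (holePairs j)
        [(Sum.inl 1, Sum.inl 2), (Sum.inl 0, Sum.inl 3)]).trans (conn_list_congr S τ ?_))
      revert j
      decide +kernel
  simp only [step, sum_wt_mul_ind]
  rfl

theorem entry_outerH₂ (S : ST) {B : BT} {a b : ℂ} (h : OuterExpands B a b) (j : Fin 2) :
    (outerH₂ S B).entry 0 j = a * S.entry 0 j + b * S.entry 1 j ∧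
      (outerH₂ S B).entry 1 j = a * S.entry 1 j := by
  classical
  constructor
  · rw [entry_outerH₂_zero, ← sum_glue_zero S h j]
    refine (stateSum_sum (X := S.X) (Y := B.X) _).trans (Fintype.sum_congr _ _ fun τ => ?_)
    congr 1
    exact stateSum_congr fun σ => conn_disj_glue S B τ σ _ _ _ _
  · rw [entry_outerH₂_one, entry]
    refine (stateSum_sum (X := S.X) (Y := B.X) _).trans ?_
    have step : ∀ τ : S.X → Bool, (stateSum fun σ : B.X → Bool => (S.disj B).Conn (Sum.elim τ σ)
        (Glue (fun p q => (p, q) ∈ holePairs j ++ [(Sum.inl 0, Sum.inl 3)])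
          (fun p q => (p, q) ∈ [(Sum.inl 1, Sum.inl 2)])
          ![Sum.inl 1, Sum.inl 2] ![Sum.inl 0, Sum.inl 3])) =
        -- The vanishing second term only gives the sum the shape required by `sum_wt_mul_ind`.
        a * ind (S.Conn τ (closing 1 j)) + 0 * ind False := by
      intro τ
      rw [stateSum_congr fun σ => conn_disj_glue S B τ σ _ _ _ _]
      have key := Expands.close h (S.Rel τ fun p q => (p, q) ∈ holePairs j ++ [(Sum.inl 0, Sum.inl 3)])
        (S.bd (Sum.inl 1)) (S.bd (Sum.inl 2))
      rw [zero_mul, add_zero, closing_eq]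
      refine Eq.trans ?_ (key.trans ?_)
      · refine stateSum_congr fun σ => ?_
        rw [rel_eq_adj B]
        have h₁ : S.bd ∘ ![Sum.inl 1, Sum.inl 2] = ![S.bd (Sum.inl 1), S.bd (Sum.inl 2)] := by
          funext k
          fin_cases k <;> rfl
        have h₂ : B.bd ∘ ![Sum.inl 0, Sum.inl 3] = ![B.bd (Sum.inl 0), B.bd (Sum.inl 3)] := by
          funext k
          fin_cases k <;> rfl
        rw [h₁, h₂]
        rfl
      · congr 1
        refine ind_congr ((total_adj_rel S τ (holePairs j ++ [(Sum.inl 0, Sum.inl 3)])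
          [(Sum.inl 1, Sum.inl 2)]).trans (conn_list_congr S τ ?_))
        clear key
        revert j
        decide +kernel
    simp only [step, sum_wt_mul_ind]
    rw [zero_mul, add_zero]
    rfl

theorem entry_outerH₁ (S : ST) {B : BT} {a b : ℂ} (h : OuterExpands B a b) (j : Fin 2) :
    (outerH₁ B S).entry 0 j = a * S.entry 0 j + b * S.entry 1 j ∧
      (outerH₁ B S).entry 1 j = a * S.entry 1 j := by
  classical
  constructor
  · rw [entry_outerH₁_zero, ← sum_glue_zero S h j]
    refine (stateSum_sum_right (X := B.X) (Y := S.X) _).trans (Fintype.sum_congr _ _ fun τ => ?_)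
    congr 1
    exact stateSum_congr fun σ => (conn_disj_glue B S σ τ _ _ _ _).trans total_glue_swap
  · rw [entry_outerH₁_one, entry]
    refine (stateSum_sum_right (X := B.X) (Y := S.X) _).trans ?_
    have step : ∀ τ : S.X → Bool, (stateSum fun σ : B.X → Bool => (B.disj S).Conn (Sum.elim σ τ)
        (Glue (fun p q => (p, q) ∈ [(Sum.inl 0, Sum.inl 3)])
          (fun p q => (p, q) ∈ holePairs j ++ [(Sum.inl 1, Sum.inl 2)])
          ![Sum.inl 1, Sum.inl 2] ![Sum.inl 0, Sum.inl 3])) =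
        a * ind (S.Conn τ (closing 1 j)) + 0 * ind False := by
      intro τ
      rw [stateSum_congr fun σ => (conn_disj_glue B S σ τ _ _ _ _).trans total_glue_swap]
      -- Here `B` is on the left, so its left endpoints are the closed ones; the flipped naming of
      -- endpoints turns them into right ones without changing the coefficients.
      have key := Expands.close (Expands.hFlip h)
        (S.Rel τ fun p q => (p, q) ∈ holePairs j ++ [(Sum.inl 1, Sum.inl 2)])
        (S.bd (Sum.inl 0)) (S.bd (Sum.inl 3))
      rw [zero_mul, add_zero, closing_eq]
      refine Eq.trans ?_ (key.trans ?_)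
      · refine stateSum_congr fun σ => ?_
        rw [rel_eq_adj B]
        have h₁ : S.bd ∘ ![Sum.inl 0, Sum.inl 3] = ![S.bd (Sum.inl 0), S.bd (Sum.inl 3)] := by
          funext k
          fin_cases k <;> rfl
        have h₂ : B.bd ∘ ![Sum.inl 1, Sum.inl 2] = ![B.bd (Sum.inl 1), B.bd (Sum.inl 2)] := by
          funext k
          fin_cases k <;> rfl
        rw [h₁, h₂]
        rfl
      · congr 1
        refine ind_congr ((total_adj_rel S τ (holePairs j ++ [(Sum.inl 1, Sum.inl 2)])
          [(Sum.inl 0, Sum.inl 3)]).trans (conn_list_congr S τ ?_))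
        clear key
        revert j
        decide +kernel
    simp only [step, sum_wt_mul_ind]
    rw [zero_mul, add_zero]
    rfl

end ST

end Tangle

/-! ### Integral coefficients and determinants of `F` -/

namespace Tangle

open Relation Diagram PTangle

namespace BT

/-- `B` expands with coefficients that are integer multiples of a root of unity `w` and of `i w`. -/
def Integral (B : BT) : Prop := ∃ (w : ℂ) (m n : ℤ), w ^ 8 = 1 ∧
  OuterExpands B (w * m) (w * Complex.I * n)

theorem I_pow_eight : Complex.I ^ 8 = 1 := by
  rw [show 8 = 4 * 2 from rfl, pow_mul, Complex.I_pow_four, one_pow]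

theorem Integral.hsum {B B' : BT} (h : Integral B) (h' : Integral B') :
    Integral (BT.hsum B B') := by
  obtain ⟨w, m, n, hw, h⟩ := h
  obtain ⟨w', m', n', hw', h'⟩ := h'
  refine ⟨w * w', m * m', m * n' + n * m', by rw [mul_pow, hw, hw', one_mul], ?_⟩
  convert outerExpands_hsum h h' using 1 <;> push_cast <;> ring

theorem Integral.vsum {B B' : BT} (h : Integral B) (h' : Integral B') :
    Integral (BT.vsum B B') := by
  obtain ⟨w, m, n, hw, h⟩ := h
  obtain ⟨w', m', n', hw', h'⟩ := h'
  refine ⟨w * w' * Complex.I, m * n' + n * m', n * n',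
    by rw [mul_pow, mul_pow, hw, hw', I_pow_eight, one_mul, one_mul], ?_⟩
  convert outerExpands_vsum h h' using 1 <;> push_cast <;> ring

theorem Integral.rot {B : BT} (h : Integral B) : Integral (PTangle.rot B) := by
  obtain ⟨w, m, n, hw, h⟩ := h
  -- The coefficients `w m` and `w i n` are exchanged; the new unit `w i` makes the second one `(w
  -- i) i (-m) = w m`.
  refine ⟨w * Complex.I, n, -m, by rw [mul_pow, hw, I_pow_eight, one_mul], ?_⟩
  convert h.rot using 1
  push_cast
  linear_combination (-w * m) * Complex.I_mul_I

theorem Integral.hFlip {B : BT} (h : Integral B) : Integral (BT.hFlip B) := by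
  obtain ⟨w, m, n, hw, h⟩ := h
  exact ⟨w, m, n, hw, outerExpands_hFlip h⟩

theorem Integral.vFlip {B : BT} (h : Integral B) : Integral (BT.vFlip B) := by
  obtain ⟨w, m, n, hw, h⟩ := h
  exact ⟨w, m, n, hw, outerExpands_vFlip h⟩

end BT

namespace ST

theorem mem_F_iff_entry (S : ST) (M : Matrix (Fin 2) (Fin 2) ℤ) :
    M ∈ F S ↔ ∃ z : ℂ, z ^ 8 = 1 ∧ (M 0 0 : ℂ) = z * S.entry 0 0 ∧
      (M 0 1 : ℂ) = -Complex.I * z * S.entry 0 1 ∧ (M 1 0 : ℂ) = Complex.I * z * S.entry 1 0 ∧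
      (M 1 1 : ℂ) = z * S.entry 1 1 := by
  rw [mem_F_iff]
  refine exists_congr fun z => and_congr_right fun _ => ?_
  rw [← Matrix.ext_iff, Fin.forall_fin_two, Fin.forall_fin_two, Fin.forall_fin_two, and_assoc]
  rfl

theorem eq_one_or_neg_one_of_int {c : ℂ} (hc : c ^ 8 = 1) {a b : ℤ} (ha : a ≠ 0)
    (h : (b : ℂ) = c * a) : c = 1 ∨ c = -1 := by
  have ha' : (a : ℂ) ≠ 0 := by exact_mod_cast ha
  have hr : c = ((b / a : ℝ) : ℂ) := by
    push_cast
    rw [h, mul_div_cancel_right₀ _ ha']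
  rw [hr] at hc ⊢
  have h1 : (b / a : ℝ) ^ 8 = 1 := by exact_mod_cast hc
  rcases (pow_eq_one_iff_of_ne_zero (n := 8) (by norm_num)).1 h1 with h2 | ⟨h2, -⟩
  · left
    rw [h2]
    norm_num
  · right
    rw [h2]
    norm_num

/-- Two members differ by an 8-th root of unity. At a nonzero integer entry it is a ratio of
integers, hence real, hence `1` or `-1`. If `M = 0`, the pair degenerates to one matrix. -/
theorem F_eq_pair {S : ST} {M : Matrix (Fin 2) (Fin 2) ℤ} (hM : M ∈ F S) : F S = {M, -M} := by
  obtain ⟨z, hz, hM'⟩ := (mem_F_iff S M).1 hM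
  have hz0 : z ≠ 0 := by rintro rfl; norm_num at hz
  have hmul : ∀ c w, S.entries (c * w) = c • S.entries w := by
    intro c w
    ext i j
    fin_cases i <;> fin_cases j <;> simp [entries] <;> ring
  ext N
  rw [Set.mem_insert_iff, Set.mem_singleton_iff]
  constructor
  · intro hN
    obtain ⟨z', hz', hN'⟩ := (mem_F_iff S N).1 hN
    have hc : (z' / z) ^ 8 = 1 := by rw [div_pow, hz, hz', div_one]
    have hNM : ∀ i j, (N i j : ℂ) = z' / z * M i j := by
      intro i j
      have h1 := congrFun (congrFun hN' i) j
      have h2 := congrFun (congrFun hM' i) j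
      rw [Matrix.map_apply] at h1 h2
      rw [h1, h2, show z' = z' / z * z by field_simp, hmul, mul_div_cancel_right₀ _ hz0]
      rfl
    by_cases h0 : M = 0
    · left
      ext i j
      have := hNM i j
      rw [h0] at this ⊢
      simpa using this
    · obtain ⟨i, j, hij⟩ : ∃ i j, M i j ≠ 0 := by
        by_contra hcon
        push Not at hcon
        exact h0 (Matrix.ext hcon)
      rcases eq_one_or_neg_one_of_int hc hij (hNM i j) with h | h
      · left
        ext i j
        have := hNM i j
        rw [h, one_mul] at this
        exact_mod_cast this
      · right
        ext i j
        have := hNM i j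
        rw [h, neg_one_mul] at this
        rw [Matrix.neg_apply]
        exact_mod_cast this
  · rintro (rfl | rfl)
    · exact hM
    · refine (mem_F_iff S _).2 ⟨-z, by rw [neg_pow, hz]; norm_num, ?_⟩
      rw [← neg_one_mul z, hmul, ← hM']
      ext i j
      simp

/-- The determinant of `F S'` is a square times that of `F S`. -/
def SquareMultiple (S S' : ST) : Prop :=
  ∀ N ∈ F S, ∃ M ∈ F S', ∃ n : ℤ, M.det = n ^ 2 * N.det

theorem SquareMultiple.refl (S : ST) : SquareMultiple S S := fun N hN => ⟨N, hN, 1, by simp⟩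

theorem SquareMultiple.trans {S S' S'' : ST} (h : SquareMultiple S S')
    (h' : SquareMultiple S' S'') : SquareMultiple S S'' := by
  intro N hN
  obtain ⟨M, hM, n, hn⟩ := h N hN
  obtain ⟨L, hL, k, hk⟩ := h' M hM
  exact ⟨L, hL, k * n, by rw [hk, hn]; ring⟩

/-- Exchanging the fillings exchanges the columns, and the phases in `F` turn this into right
multiplication by a quarter-turn matrix of determinant `1`. For the outside hole, rows take the
place of columns. -/
theorem exists_det_r₁ (S : ST) {N : Matrix (Fin 2) (Fin 2) ℤ} (hN : N ∈ F S) :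
    ∃ M ∈ F (r₁ S), M.det = N.det := by
  obtain ⟨z, hz, h00, h01, h10, h11⟩ := (mem_F_iff_entry S N).1 hN
  refine ⟨!![N 0 1, -N 0 0; N 1 1, -N 1 0], (mem_F_iff_entry _ _).2
    ⟨-Complex.I * z, ?_, ?_, ?_, ?_, ?_⟩, ?_⟩
  · rw [mul_pow, hz, neg_pow, BT.I_pow_eight]
    norm_num
  · simp [entry_r₁, h01]
  · simp only [entry_r₁, Matrix.of_apply, Matrix.cons_val_zero, Matrix.cons_val_one, Int.cast_neg,
      h00, show (1 : Fin 2) + 1 = 0 from rfl]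
    linear_combination (z * S.entry 0 0) * (-Complex.I_mul_I)
  · simp only [entry_r₁, Matrix.of_apply, Matrix.cons_val_zero, Matrix.cons_val_one,
      h11, zero_add]
    linear_combination (z * S.entry 1 1) * Complex.I_mul_I
  · simp only [entry_r₁, Matrix.of_apply, Matrix.cons_val_zero, Matrix.cons_val_one, Int.cast_neg,
      h10, show (1 : Fin 2) + 1 = 0 from rfl]
    ring
  · rw [Matrix.det_fin_two, Matrix.det_fin_two]
    simp
    ring

theorem exists_det_r₂ (S : ST) {N : Matrix (Fin 2) (Fin 2) ℤ} (hN : N ∈ F S) :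
    ∃ M ∈ F (r₂ S), M.det = N.det := by
  obtain ⟨z, hz, h00, h01, h10, h11⟩ := (mem_F_iff_entry S N).1 hN
  refine ⟨!![N 1 0, N 1 1; -N 0 0, -N 0 1], (mem_F_iff_entry _ _).2
    ⟨Complex.I * z, ?_, ?_, ?_, ?_, ?_⟩, ?_⟩
  · rw [mul_pow, hz, BT.I_pow_eight, one_mul]
  · simp [entry_r₂, h10]
  · simp only [entry_r₂, Matrix.of_apply, Matrix.cons_val_zero, Matrix.cons_val_one,
      h11, zero_add]
    linear_combination (z * S.entry 1 1) * Complex.I_mul_I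
  · simp only [entry_r₂, Matrix.of_apply, Matrix.cons_val_zero, Matrix.cons_val_one, Int.cast_neg,
      h00, show (1 : Fin 2) + 1 = 0 from rfl]
    linear_combination (z * S.entry 0 0) * (-Complex.I_mul_I)
  · simp only [entry_r₂, Matrix.of_apply, Matrix.cons_val_zero, Matrix.cons_val_one, Int.cast_neg,
      h01, show (1 : Fin 2) + 1 = 0 from rfl]
    ring
  · rw [Matrix.det_fin_two, Matrix.det_fin_two]
    simp
    ring

theorem squareMultiple_r₁ (S : ST) : SquareMultiple S (r₁ S) := fun _ hN =>
  (exists_det_r₁ S hN).imp fun _ h => ⟨h.1, 1, by rw [h.2]; ring⟩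

theorem squareMultiple_r₂ (S : ST) : SquareMultiple S (r₂ S) := fun _ hN =>
  (exists_det_r₂ S hN).imp fun _ h => ⟨h.1, 1, by rw [h.2]; ring⟩

theorem rot_eq (S : ST) : PTangle.rot S = r₁ (r₂ S) := by
  refine congrArg (Diagram.relabel S) (funext ?_)
  rintro (k | k) <;> rfl

theorem squareMultiple_rot (S : ST) : SquareMultiple S (PTangle.rot S) := by
  rw [rot_eq]
  exact (squareMultiple_r₂ S).trans (squareMultiple_r₁ _)

/-- Inversion swaps the two diagonal entries and fixes the others, with no change of phase. -/
theorem squareMultiple_inv (S : ST) : SquareMultiple S (inv S) := by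
  intro N hN
  obtain ⟨z, hz, h00, h01, h10, h11⟩ := (mem_F_iff_entry S N).1 hN
  refine ⟨!![N 1 1, N 0 1; N 1 0, N 0 0], (mem_F_iff_entry _ _).2 ⟨z, hz, ?_, ?_, ?_, ?_⟩, 1, ?_⟩
  · simp [entry_inv, h11]
  · simp [entry_inv, h01]
  · simp [entry_inv, h10]
  · simp [entry_inv, h00]
  · rw [Matrix.det_fin_two, Matrix.det_fin_two]
    simp
    ring

theorem squareMultiple_of_entry {S S' : ST} {w : ℂ} (hw : w ^ 8 = 1) {m n : ℤ}
    (h : ∀ j, S'.entry 0 j = w * m * S.entry 0 j + w * Complex.I * n * S.entry 1 j ∧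
      S'.entry 1 j = w * m * S.entry 1 j) : SquareMultiple S S' := by
  have hw0 : w ≠ 0 := by rintro rfl; norm_num at hw
  intro N hN
  obtain ⟨z, hz, h00, h01, h10, h11⟩ := (mem_F_iff_entry S N).1 hN
  -- This is the upper triangular matrix with rows `(m, n)` and `(0, m)` times `N`. The relative
  -- phase `i` of the expansion coefficients matches that of the rows in `F`, so the factor is
  -- integral.
  refine ⟨!![m * N 0 0 + n * N 1 0, m * N 0 1 + n * N 1 1; m * N 1 0, m * N 1 1],
    (mem_F_iff_entry _ _).2 ⟨z * w⁻¹, by rw [mul_pow, inv_pow, hw, hz, inv_one, one_mul],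
      ?_, ?_, ?_, ?_⟩, m, ?_⟩
  · simp only [Matrix.of_apply, Matrix.cons_val_zero, Int.cast_add, Int.cast_mul, h00, h10, (h 0).1]
    field_simp
  · simp only [Matrix.of_apply, Matrix.cons_val_zero, Matrix.cons_val_one, Int.cast_add,
      Int.cast_mul, h01, h11, (h 1).1]
    field_simp
    linear_combination (z * n * S.entry 1 1) * Complex.I_sq
  · simp only [Matrix.of_apply, Matrix.cons_val_zero, Matrix.cons_val_one, Int.cast_mul, h10,
      (h 0).2]
    field_simp
  · simp only [Matrix.of_apply, Matrix.cons_val_zero, Matrix.cons_val_one, Int.cast_mul, h11,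
      (h 1).2]
    field_simp
  · rw [Matrix.det_fin_two, Matrix.det_fin_two]
    simp
    ring

variable {B : BT}

theorem squareMultiple_outerH₂ (S : ST) (h : BT.Integral B) : SquareMultiple S (outerH₂ S B) := by
  obtain ⟨w, m, n, hw, h⟩ := h
  exact squareMultiple_of_entry hw fun j => entry_outerH₂ S h j

theorem squareMultiple_outerH₁ (S : ST) (h : BT.Integral B) : SquareMultiple S (outerH₁ B S) := by
  obtain ⟨w, m, n, hw, h⟩ := h
  exact squareMultiple_of_entry hw fun j => entry_outerH₁ S h j

theorem outerV₂_eq (S : ST) (B : BT) : outerV₂ S B =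
    PTangle.rot (PTangle.rot (PTangle.rot (outerH₂ (PTangle.rot S) (PTangle.rot B)))) := by
  refine congrArg (Diagram.relabel (PTangle.hsum (PTangle.rot S) (PTangle.rot B))) (funext ?_)
  rintro (k | k) <;> rfl

theorem outerV₁_eq (B : BT) (S : ST) : outerV₁ B S =
    PTangle.rot (PTangle.rot (PTangle.rot (outerH₁ (PTangle.rot B) (PTangle.rot S)))) := by
  refine congrArg (Diagram.relabel (PTangle.hsum (PTangle.rot B) (PTangle.rot S))) (funext ?_)
  rintro (k | k) <;> rfl

theorem squareMultiple_rot_rot_rot (S : ST) :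
    SquareMultiple S (PTangle.rot (PTangle.rot (PTangle.rot S))) :=
  ((squareMultiple_rot S).trans (squareMultiple_rot _)).trans (squareMultiple_rot _)

theorem squareMultiple_outerV₂ (S : ST) (h : BT.Integral B) : SquareMultiple S (outerV₂ S B) := by
  rw [outerV₂_eq]
  exact ((squareMultiple_rot S).trans (squareMultiple_outerH₂ _ h.rot)).trans
    (squareMultiple_rot_rot_rot _)

theorem squareMultiple_outerV₁ (S : ST) (h : BT.Integral B) : SquareMultiple S (outerV₁ B S) := by
  rw [outerV₁_eq]
  exact ((squareMultiple_rot S).trans (squareMultiple_outerH₁ _ h.rot)).trans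
    (squareMultiple_rot_rot_rot _)

theorem squareMultiple_innerH₁ (S : ST) (h : BT.Integral B) : SquareMultiple S (innerH₁ B S) :=
  ((squareMultiple_inv S).trans (squareMultiple_outerH₂ _ h.hFlip)).trans (squareMultiple_inv _)

theorem squareMultiple_innerH₂ (S : ST) (h : BT.Integral B) : SquareMultiple S (innerH₂ S B) :=
  ((squareMultiple_inv S).trans (squareMultiple_outerH₁ _ h.hFlip)).trans (squareMultiple_inv _)

theorem squareMultiple_innerV₁ (S : ST) (h : BT.Integral B) : SquareMultiple S (innerV₁ B S) :=
  ((squareMultiple_inv S).trans (squareMultiple_outerV₂ _ h.vFlip)).trans (squareMultiple_inv _)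

theorem squareMultiple_innerV₂ (S : ST) (h : BT.Integral B) : SquareMultiple S (innerV₂ S B) :=
  ((squareMultiple_inv S).trans (squareMultiple_outerV₁ _ h.vFlip)).trans (squareMultiple_inv _)

theorem exists_det_rotations (S : ST) (a b : ℕ) {N : Matrix (Fin 2) (Fin 2) ℤ} (hN : N ∈ F S) :
    ∃ M ∈ F (r₂^[b] (r₁^[a] S)), M.det = N.det := by
  have h₁ : ∀ a, ∃ M ∈ F (r₁^[a] S), M.det = N.det := by
    intro a
    induction a with
    | zero => exact ⟨N, hN, rfl⟩
    | succ a ih =>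
      obtain ⟨M, hM, hd⟩ := ih
      rw [Function.iterate_succ_apply']
      obtain ⟨M', hM', hd'⟩ := exists_det_r₁ _ hM
      exact ⟨M', hM', hd'.trans hd⟩
  induction b with
  | zero => exact h₁ a
  | succ b ih =>
    obtain ⟨M, hM, hd⟩ := ih
    rw [Function.iterate_succ_apply']
    obtain ⟨M', hM', hd'⟩ := exists_det_r₂ _ hM
    exact ⟨M', hM', hd'.trans hd⟩

/-- The closures of the identity tangle, as finite data. -/
def identityCode (i j : Fin 2) : Code I (closing i j) (id : Fin 4 ⊕ Unit × Fin 4 → _) where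
  n := 0
  e := Equiv.equivOfIsEmpty (Fin 0) Empty
  enc := Fin.val
  enc_inj := Fin.val_injective
  es := List.finRange 4
  mem_es := List.mem_finRange
  qs := closingPairs i j
  mem_qs := closing_iff i j

/-- Equal indices mean perpendicular arcs outside and inside, which close up to one circle through
the radial segments; different indices give parallel arcs and two circles. -/
theorem entry_I (i j : Fin 2) : I.entry i j = if i = j then 1 else 0 := by
  have hI : IsEmpty I.X := inferInstanceAs (IsEmpty Empty)
  have hlab : ∀ i j : Fin 2, (∀ x y : Fin 4,
      ((closingPairs i j).map (Prod.map I.bd I.bd)).foldl merge (Fin.val : Fin 4 → ℕ) x =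
      ((closingPairs i j).map (Prod.map I.bd I.bd)).foldl merge (Fin.val : Fin 4 → ℕ) y) ↔
      i = j := by
    decide +kernel
  have hconn : ∀ σ, I.Conn σ (closing i j) ↔ i = j := by
    intro σ
    rw [← hlab i j]
    refine forall_congr' fun x => forall_congr' fun y => ?_
    have := (identityCode i j).eqvGen_iff Fin.elim0 x y
    rw [show (fun x => Fin.elim0 ((identityCode i j).e.symm x) : I.X → Bool) = σ from
      funext fun x => hI.elim x,
      show statePairs (I.cross ∘ (identityCode i j).e) Fin.elim0 = [] from rfl,
      List.append_nil] at this
    exact this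
  rw [entry, wsum, stateSum_congr hconn, stateSum_eq_ind, Fintype.sum_unique]
  refine (congrArg (· * ind (i = j)) (Fintype.prod_empty _)).trans ?_
  rw [one_mul, ind]
  split_ifs <;> rfl

theorem one_mem_F_I : (1 : Matrix (Fin 2) (Fin 2) ℤ) ∈ F I := by
  rw [mem_F_iff_entry]
  exact ⟨1, one_pow _, by simp [entry_I], by simp [entry_I], by simp [entry_I], by simp [entry_I]⟩

end ST

end Tangle

namespace Tangle

/-! ### Checkerboard colourings of planar diagrams -/

section Coloring

variable {Ω : Type} [Fintype Ω]

/-- The `ZMod 2`-valued functions that are constant on related elements. -/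
def invariants (r : Ω → Ω → Prop) : Submodule (ZMod 2) (Ω → ZMod 2) where
  carrier := {f | ∀ s t, r s t → f s = f t}
  add_mem' := fun hf hg s t h => congrArg₂ (· + ·) (hf s t h) (hg s t h)
  zero_mem' := fun _ _ _ => rfl
  smul_mem' := fun c _ hf s t h => congrArg (c * ·) (hf s t h)

theorem finrank_invariants (r : Ω → Ω → Prop) :
    Module.finrank (ZMod 2) (invariants r) = Nat.card (Quot r) := by
  classical
  have e : (Quot r → ZMod 2) ≃ₗ[ZMod 2] invariants r :=
    { toFun := fun g => ⟨fun s => g (Quot.mk r s), fun s t h => congrArg g (Quot.sound h)⟩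
      map_add' := fun _ _ => rfl
      map_smul' := fun _ _ => rfl
      invFun := fun f => Quot.lift f.1 f.2
      left_inv := fun g => by
        funext q
        induction q using Quot.ind
        rfl
      right_inv := fun f => rfl }
  have : Fintype (Quot r) := Fintype.ofFinite _
  rw [← e.finrank_eq, Module.finrank_fintype_fun_eq_card, Nat.card_eq_fintype_card]

/-- The functions orthogonal to `W`. -/
noncomputable def perp (W : Submodule (ZMod 2) (Ω → ZMod 2)) :
    Submodule (ZMod 2) (Ω → ZMod 2) where
  carrier := {g | ∀ f ∈ W, ∑ s, g s * f s = 0}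
  add_mem' := fun hg hg' f hf => by
    simp only [Pi.add_apply, add_mul, Finset.sum_add_distrib, hg f hf, hg' f hf, add_zero]
  zero_mem' := fun f _ => by simp
  smul_mem' := fun c g hg f hf => by
    simp only [Pi.smul_apply, smul_eq_mul, mul_assoc, ← Finset.mul_sum, hg f hf, mul_zero]

theorem finrank_perp (W : Submodule (ZMod 2) (Ω → ZMod 2)) :
    Module.finrank (ZMod 2) (perp W) + Module.finrank (ZMod 2) W = Fintype.card Ω := by
  classical
  have h : perp W = (W.dualAnnihilator).comap (dotProductEquiv (ZMod 2) Ω).toLinearMap := by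
    ext g
    rw [Submodule.mem_comap, Submodule.mem_dualAnnihilator]
    rfl
  have h' := Subspace.finrank_add_finrank_dualAnnihilator_eq W
  rw [Module.finrank_fintype_fun_eq_card] at h'
  rw [h, ← h', add_comm]
  congr 1
  exact ((dotProductEquiv (ZMod 2) Ω).ofSubmodule' W.dualAnnihilator).finrank_eq

/-- This is the vanishing of the first cohomology of the sphere modulo `2`, in terms of edge-ends.
The boundary map `δ` sends functions constant on faces into the functions orthogonal to vertices and
edges, and the Euler characteristic forces it to be onto. The constant `1` is orthogonal because all
degrees are even and edges have two ends, so `1 = δ o`, where `o` is a checkerboard colouring. -/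
theorem exists_coloring (a b : Equiv.Perm Ω) {𝓔 : Type} (edge : Ω → 𝓔)
    (hbb : ∀ s, b (b s) = s) (hb : ∀ s, b s ≠ s)
    (hedge : ∀ s t, edge t = edge s ↔ t = s ∨ t = b s)
    (ha : ∀ h : Ω → ZMod 2, (∀ s, h (a s) = h s) → ∑ s, h s = 0)
    (euler : Nat.card (Quot fun s t => t = a s) + Nat.card (Quot fun s t => t = a (b s)) =
      Nat.card (Set.range edge) + 2 * Nat.card (Quot fun s t => t = a s ∨ edge t = edge s)) :
    ∃ o : Ω → ZMod 2, (∀ s, o (a s) = o s + 1) ∧ ∀ s, o (b s) = o s + 1 := by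
  classical
  set IV := invariants fun s t => t = a s with hIV
  set IF := invariants fun s t => t = a (b s) with hIF
  set IE := invariants fun s t => edge t = edge s with hIE
  set IC := invariants fun s t => t = a s ∨ edge t = edge s with hIC
  have hrange : Nat.card (Set.range edge) = Nat.card (Quot fun s t => edge t = edge s) := by
    refine (Nat.card_congr ((Quot.congrRight fun s t => eq_comm).trans
      (Setoid.quotientKerEquivRange edge))).symm
  have euler' : Module.finrank (ZMod 2) IV + Module.finrank (ZMod 2) IF =
      Module.finrank (ZMod 2) IE + 2 * Module.finrank (ZMod 2) IC := by
    rw [hIV, hIF, hIE, hIC, finrank_invariants, finrank_invariants, finrank_invariants,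
      finrank_invariants, ← hrange]
    exact euler
  have memE : ∀ f, f ∈ IE ↔ ∀ s, f (b s) = f s := by
    intro f
    constructor
    · exact fun h s => (h s (b s) ((hedge _ _).2 (Or.inr rfl))).symm
    · intro h s t hst
      rcases (hedge s t).1 hst with rfl | rfl
      · rfl
      · exact (h s).symm
  have memV : ∀ f, f ∈ IV ↔ ∀ s, f (a s) = f s := by
    intro f
    constructor
    · exact fun h s => (h s (a s) rfl).symm
    · rintro h s t rfl
      exact (h s).symm
  have memF : ∀ f, f ∈ IF ↔ ∀ s, f (a (b s)) = f s := by
    intro f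
    constructor
    · exact fun h s => (h s _ rfl).symm
    · rintro h s t rfl
      exact (h s).symm
  have hinf : IV ⊓ IE = IC := by
    ext f
    rw [Submodule.mem_inf]
    constructor
    · rintro ⟨h, h'⟩ s t (hst | hst)
      · exact h s t hst
      · exact h' s t hst
    · exact fun h => ⟨fun s t hst => h s t (Or.inl hst), fun s t hst => h s t (Or.inr hst)⟩
  have hsup := Submodule.finrank_sup_add_finrank_inf_eq IV IE
  rw [hinf] at hsup
  have htwo : ∀ x : ZMod 2, x + x = 0 := by decide
  have heq : ∀ x y : ZMod 2, x + y = 0 → y = x := by decide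
  -- Every edge has exactly two ends, so orthogonality to its indicator means equal values at them.
  -- In dimensions this yields `|Ω| ≤ 2 · dim IE`.
  have hself : perp IE ≤ IE := by
    intro g hg
    rw [memE]
    intro s
    have h1 := hg (fun t => if t = s ∨ t = b s then 1 else 0) ((memE _).2 fun t => by
      have : (b t = s ∨ b t = b s) ↔ (t = s ∨ t = b s) := by
        rw [b.injective.eq_iff, ← b.injective.eq_iff (a := b t), hbb]
        exact or_comm
      simp only [this])
    have h2 : ∑ t, g t * (if t = s ∨ t = b s then 1 else 0) = g s + g (b s) := by
      simp only [mul_ite, mul_one, mul_zero]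
      rw [← Finset.sum_filter,
        show Finset.univ.filter (fun t => t = s ∨ t = b s) = {s, b s} by ext; simp,
        Finset.sum_pair (hb s).symm]
    exact heq _ _ (h2.symm.trans h1)
  have hcard := finrank_perp IE
  have hcard' := finrank_perp (IV ⊔ IE)
  have hle := Submodule.finrank_mono hself
  let δ : (Ω → ZMod 2) →ₗ[ZMod 2] (Ω → ZMod 2) := LinearMap.id + LinearMap.funLeft _ _ b
  have hδ : ∀ f s, δ f s = f s + f (b s) := fun f s => rfl
  -- A function constant on faces and on edges is constant around vertices too, hence on components.
  have hker : Module.finrank (ZMod 2) (LinearMap.ker (δ.domRestrict IF)) ≤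
      Module.finrank (ZMod 2) IC := by
    rw [← Submodule.finrank_map_subtype_eq]
    refine Submodule.finrank_mono ?_
    rintro _ ⟨⟨f, hf⟩, hf', rfl⟩
    have hfb : ∀ s, f (b s) = f s := fun s => heq _ _ (congrFun (LinearMap.mem_ker.1 hf') s)
    rw [← hinf]
    refine ⟨(memV f).2 fun s => ?_, (memE f).2 hfb⟩
    have := (memF f).1 hf (b s)
    rw [hbb] at this
    exact this.trans (hfb s)
  have hrank := LinearMap.finrank_range_add_finrank_ker (δ.domRestrict IF)
  have hle' : LinearMap.range (δ.domRestrict IF) ≤ perp (IV ⊔ IE) := by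
    rintro _ ⟨⟨f, hf⟩, rfl⟩ g hg
    obtain ⟨h, hh, k, hk, rfl⟩ := Submodule.mem_sup.1 hg
    change ∑ s, (f s + f (b s)) * (h s + k s) = 0
    have h1 : ∑ s, f (b s) * h s = ∑ s, f s * h s := by
      rw [← Equiv.sum_comp a fun s => f s * h s]
      refine Fintype.sum_congr _ _ fun s => ?_
      have := (memF f).1 hf (b s)
      rw [hbb] at this
      rw [this, (memV h).1 hh]
    have h2 : ∑ s, f (b s) * k s = ∑ s, f s * k s := by
      rw [← Equiv.sum_comp b fun s => f s * k s]
      exact Fintype.sum_congr _ _ fun s => by rw [(memE k).1 hk]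
    simp only [add_mul, mul_add, Finset.sum_add_distrib, h1, h2]
    rw [htwo, htwo, add_zero]
  have hrange' : LinearMap.range (δ.domRestrict IF) = perp (IV ⊔ IE) := by
    -- With `V + F = E + 2C`, the rank of `δ` on `IF` is at least `F - C = E - V + C`, and the
    -- orthogonal space has dimension `|Ω| - (V + E - C)`, at most the same number.
    refine Submodule.eq_of_le_of_finrank_le hle' ?_
    omega
  have hone : (fun _ => 1 : Ω → ZMod 2) ∈ perp (IV ⊔ IE) := by
    intro g hg
    obtain ⟨h, hh, k, hk, rfl⟩ := Submodule.mem_sup.1 hg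
    simp only [one_mul, Pi.add_apply, Finset.sum_add_distrib]
    rw [ha h ((memV h).1 hh), zero_add]
    refine Finset.sum_involution (fun s _ => b s) (fun s _ => ?_) (fun s _ _ => hb s)
      (fun s _ => Finset.mem_univ _) (fun s _ => hbb s)
    rw [(memE k).1 hk]
    exact htwo _
  rw [← hrange'] at hone
  obtain ⟨⟨o, ho⟩, ho'⟩ := hone
  have hob : ∀ s, o (b s) = o s + 1 := by
    have : ∀ x y : ZMod 2, x + y = 1 → y = x + 1 := by decide
    exact fun s => this _ _ (congrFun ho' s)
  refine ⟨o, fun s => ?_, hob⟩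
  have := (memF o).1 ho (b s)
  rw [hbb] at this
  rw [this, hob]

end Coloring

end Tangle

namespace Tangle

open Relation

/-! ### Splittings of a four-valent graph with a source-sink orientation -/

/-- The identifications of edges caused by splitting every vertex: `true` connects the edge-ends
`0` with `1` and `2` with `3`, and `false` connects `1` with `2` and `3` with `0`. -/
def SplitRel {V E : Type} (ed : V → Fin 4 → E) (s : V → Bool) (e e' : E) : Prop :=
  ∃ v, (s v = true ∧ ((e = ed v 0 ∧ e' = ed v 1) ∨ (e = ed v 2 ∧ e' = ed v 3)))
    ∨ (s v = false ∧ ((e = ed v 1 ∧ e' = ed v 2) ∨ (e = ed v 3 ∧ e' = ed v 0)))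

/-- The even (`false`) and the odd (`true`) positions at a vertex. -/
def position : Bool → Bool → Fin 4
  | false, false => 0
  | false, true => 2
  | true, false => 1
  | true, true => 3

/-- A source-sink orientation: at the vertex `v` the positions of parity `ω v` are outgoing and the
others are incoming, and `β` maps the beginning of an edge to its end. -/
structure SourceSink {V E : Type} (ed : V → Fin 4 → E) where
  ω : V → Bool
  β : Equiv.Perm (V × Bool)
  edge_β : ∀ y, ed (β y).1 (position (!ω (β y).1) (β y).2) = ed y.1 (position (ω y.1) y.2)
  injective : ∀ y y' : V × Bool,
    ed y.1 (position (ω y.1) y.2) = ed y'.1 (position (ω y'.1) y'.2) → y = y'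

namespace SourceSink

variable {V E : Type} {ed : V → Fin 4 → E} (o : SourceSink ed)

/-- The edge beginning at an outgoing position. -/
def out (y : V × Bool) : E := ed y.1 (position (o.ω y.1) y.2)

/-- The edge ending at an incoming position. -/
def inn (y : V × Bool) : E := ed y.1 (position (!o.ω y.1) y.2)

theorem inn_β (y : V × Bool) : o.inn (o.β y) = o.out y := o.edge_β y

/-- The permutation that connects the incoming positions with the outgoing ones. -/
def turn (s : V → Bool) : Equiv.Perm (V × Bool) :=
  Equiv.prodCongrRight fun v => if s v = true then 1 else Equiv.swap false true

/-- Following the circles of a state. -/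
def step (s : V → Bool) : Equiv.Perm (V × Bool) := turn s * o.β

/-- A splitting always pairs an incoming with an outgoing position. The numbering in `position`
makes this pairing the identity or the swap according to `s v`, independently of `ω v`. -/
theorem splitRel_out {s : V → Bool} {e e' : E} (h : SplitRel ed s e e') :
    ∃ y, (e = o.out y ∧ e' = o.out (o.step s y)) ∨ (e' = o.out y ∧ e = o.out (o.step s y)) := by
  have key : ∀ v i, (e = o.inn (v, i) ∧ e' = o.out (turn s (v, i))) ∨
      (e' = o.inn (v, i) ∧ e = o.out (turn s (v, i))) →
      ∃ y, (e = o.out y ∧ e' = o.out (o.step s y)) ∨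
        (e' = o.out y ∧ e = o.out (o.step s y)) := by
    intro v i h'
    refine ⟨o.β.symm (v, i), ?_⟩
    have h1 : o.out (o.β.symm (v, i)) = o.inn (v, i) := by
      rw [← o.inn_β, Equiv.apply_symm_apply]
    have h2 : o.step s (o.β.symm (v, i)) = turn s (v, i) := by
      rw [step, Equiv.Perm.mul_apply, Equiv.apply_symm_apply]
    rw [h1, h2]
    exact h'
  obtain ⟨v, ⟨hs, h | h⟩ | ⟨hs, h | h⟩⟩ := h <;> obtain ⟨rfl, rfl⟩ := h <;>
    cases hω : o.ω v
  · exact key v false (by simp [inn, out, turn, hs, hω, position])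
  · exact key v false (by simp [inn, out, turn, hs, hω, position])
  · exact key v true (by simp [inn, out, turn, hs, hω, position])
  · exact key v true (by simp [inn, out, turn, hs, hω, position])
  · exact key v false (by simp [inn, out, turn, hs, hω, position])
  · exact key v true (by simp [inn, out, turn, hs, hω, position])
  · exact key v true (by simp [inn, out, turn, hs, hω, position])
  · exact key v false (by simp [inn, out, turn, hs, hω, position])

theorem sameCycle_of_total {s : V → Bool} (h : Total (SplitRel ed s)) (y y' : V × Bool) :
    (o.step s).SameCycle y y' := by
  let K : E → Prop := fun e => ∃ z, e = o.out z ∧ (o.step s).SameCycle y z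
  have hK : ∀ z, K (o.out z) ↔ (o.step s).SameCycle y z := by
    intro z
    constructor
    · rintro ⟨z', hz, hz'⟩
      rw [o.injective _ _ hz]
      exact hz'
    · exact fun hz => ⟨z, rfl, hz⟩
  have hcl : ∀ e e', EqvGen (SplitRel ed s) e e' → (K e ↔ K e') := by
    intro e e' he
    induction he with
    | rel e e' he =>
      obtain ⟨z, ⟨rfl, rfl⟩ | ⟨rfl, rfl⟩⟩ := o.splitRel_out he
      · rw [hK, hK, Equiv.Perm.sameCycle_apply_right]
      · rw [hK, hK, Equiv.Perm.sameCycle_apply_right]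
    | refl => exact Iff.rfl
    | symm _ _ _ ih => exact ih.symm
    | trans _ _ _ _ _ ih ih' => exact ih.trans ih'
  rw [← hK, ← hcl _ _ (h (o.out y) (o.out y')), hK]

/-- The sign of a splitting. -/
def sgn (b : Bool) : ℤˣ := if b = true then 1 else -1

theorem sign_turn [Fintype V] [DecidableEq V] (s : V → Bool) :
    Equiv.Perm.sign (turn s) = ∏ v, sgn (s v) := by
  rw [turn, Equiv.Perm.sign_prodCongrRight]
  refine Fintype.prod_congr _ _ fun v => ?_
  rw [sgn]
  split_ifs
  · exact Equiv.Perm.sign_one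
  · exact Equiv.Perm.sign_swap (by decide)

/-- All states with a single circle have the same sign. -/
theorem exists_sign (o : SourceSink ed) [Fintype V] [Nonempty V] :
    ∃ c : ℤˣ, ∀ s : V → Bool, Total (SplitRel ed s) → ∏ v, sgn (s v) = c := by
  classical
  refine ⟨-Equiv.Perm.sign o.β, fun s h => ?_⟩
  have hsame := o.sameCycle_of_total h
  -- A fixed point would form the whole orbit, but each vertex has two outgoing positions.
  have hmove : ∀ y, o.step s y ≠ y := by
    intro y hy
    have h1 := (hsame (y.1, false) y).symm
    have h2 := (hsame (y.1, true) y).symm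
    obtain ⟨n, hn⟩ := h1
    obtain ⟨m, hm⟩ := h2
    rw [Equiv.Perm.zpow_apply_eq_self_of_apply_eq_self hy] at hn hm
    exact absurd (hn.symm.trans hm) (by simp)
  have hcyc : (o.step s).IsCycle :=
    ⟨(Classical.arbitrary V, false), hmove _, fun y _ => hsame _ y⟩
  have hsupp : (o.step s).support = Finset.univ := by
    ext y
    simp [hmove y]
  -- A cycle through all `2 |V|` outgoing positions is odd; since `β` does not depend on the state,
  -- the sign of `turn s` is determined.
  have hsign := hcyc.sign
  rw [hsupp, Finset.card_univ, Fintype.card_prod, Fintype.card_bool, mul_comm, pow_mul, step,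
    Equiv.Perm.sign_mul, sign_turn] at hsign
  rw [show ((-1 : ℤˣ) ^ 2) = 1 by decide, one_pow] at hsign
  rw [← Int.units_inv_eq_self (Equiv.Perm.sign o.β), ← neg_one_mul, eq_mul_inv_iff_mul_eq, hsign]

/-- Conservation of flow: a set of edges has as many beginnings as ends, and if it respects the
splittings away from `v₀`, these balance at every other vertex, hence at `v₀`. -/
theorem balanced (o : SourceSink ed) [Fintype V] (K : E → Prop) [DecidablePred K] (s : V → Bool)
    (v₀ : V)
    (hK : ∀ v, v ≠ v₀ → if s v = true then (K (ed v 0) ↔ K (ed v 1)) ∧ (K (ed v 2) ↔ K (ed v 3))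
      else (K (ed v 1) ↔ K (ed v 2)) ∧ (K (ed v 3) ↔ K (ed v 0))) :
    (if K (ed v₀ 0) then (1 : ℤ) else 0) + (if K (ed v₀ 2) then 1 else 0) =
      (if K (ed v₀ 1) then 1 else 0) + (if K (ed v₀ 3) then 1 else 0) := by
  classical
  let χ : E → ℤ := fun e => if K e then 1 else 0
  have h1 : ∑ y, χ (o.out y) = ∑ y, χ (o.inn y) := by
    rw [← Equiv.sum_comp o.β fun y => χ (o.inn y)]
    exact Fintype.sum_congr _ _ fun y => by rw [o.inn_β]
  have h2 : ∀ v, v ≠ v₀ → ∑ i, χ (o.out (v, i)) = ∑ i, χ (o.inn (v, i)) := by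
    intro v hv
    have := hK v hv
    cases hω : o.ω v <;> split_ifs at this <;>
      simp only [Fintype.sum_bool, χ, out, inn, hω, position, this.1, this.2, Bool.not_false,
        Bool.not_true, add_comm]
  rw [Fintype.sum_prod_type, Fintype.sum_prod_type, ← sub_eq_zero, ← Finset.sum_sub_distrib,
    Finset.sum_eq_single v₀ (fun v _ hv => sub_eq_zero.2 (h2 v hv))
      (fun h => absurd (Finset.mem_univ _) h), sub_eq_zero] at h1
  cases hω : o.ω v₀ <;>
    simp only [Fintype.sum_bool, χ, out, inn, hω, position, Bool.not_false, Bool.not_true] at h1 <;>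
    linarith

end SourceSink

end Tangle

namespace Tangle

open Relation

/-! ### The source-sink orientation of a planar diagram -/

namespace PTangle

variable {κ : Type} (D : PTangle κ)

/-- Crossings, the outside, and holes. -/
abbrev Vert : Type := D.X ⊕ (Unit ⊕ κ)

/-- The edge-ends at crossings, at the outside and at holes. -/
def slot : D.Vert × Fin 4 ≃ D.Slot where
  toFun
    | (Sum.inl x, k) => Sum.inl (x, k)
    | (Sum.inr (Sum.inl _), k) => Sum.inr (Sum.inl k)
    | (Sum.inr (Sum.inr h), k) => Sum.inr (Sum.inr (h, k))
  invFun
    | Sum.inl (x, k) => (Sum.inl x, k)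
    | Sum.inr (Sum.inl k) => (Sum.inr (Sum.inl ()), k)
    | Sum.inr (Sum.inr (h, k)) => (Sum.inr (Sum.inr h), k)
  left_inv := by rintro ⟨x | x | x, k⟩ <;> rfl
  right_inv := by rintro (⟨x, k⟩ | k | ⟨h, k⟩) <;> rfl

/-- The edges at crossings, at the outside and at holes. -/
def ends (v : D.Vert) (k : Fin 4) : D.E := D.edge (D.slot (v, k))

/-- The edge-ends in counterclockwise order. -/
def turnPerm : Equiv.Perm D.Slot where
  toFun := next D
  invFun
    | Sum.inl (x, k) => Sum.inl (x, k - 1)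
    | Sum.inr (Sum.inl k) => Sum.inr (Sum.inl (k - 1))
    | Sum.inr (Sum.inr (h, k)) => Sum.inr (Sum.inr (h, k + 1))
  left_inv := by rintro (⟨x, k⟩ | k | ⟨h, k⟩) <;> simp [next]
  right_inv := by rintro (⟨x, k⟩ | k | ⟨h, k⟩) <;> simp [next]

theorem next_slot (v : D.Vert) (k : Fin 4) :
    next D (D.slot (v, k)) = D.slot (v, k + 1) ∨ D.slot (v, k) = next D (D.slot (v, k + 1)) := by
  rcases v with x | x | x
  · exact Or.inl rfl
  · exact Or.inl rfl
  · right
    simp [slot, next]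

theorem sum_eq_zero_of_invariant [Fintype κ] (h : D.Slot → ZMod 2)
    (hh : ∀ s, h (next D s) = h s) : ∑ s, h s = 0 := by
  rw [← Equiv.sum_comp D.slot, Fintype.sum_prod_type]
  refine Finset.sum_eq_zero fun v _ => ?_
  have key : ∀ k, h (D.slot (v, k + 1)) = h (D.slot (v, k)) := by
    intro k
    rcases D.next_slot v k with h' | h'
    · rw [← h', hh]
    · rw [h', hh]
  have h1 := key 0
  have h2 := key 1
  have h3 := key 2
  have four : ∀ x : ZMod 2, x + x + x + x = 0 := by decide
  rw [Fin.sum_univ_four]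
  rw [show (3 : Fin 4) = 2 + 1 from rfl, h3, show (2 : Fin 4) = 1 + 1 from rfl, h2,
    show (1 : Fin 4) = 0 + 1 from rfl, h1]
  exact four _

variable {D}

/-- The colouring of edge-ends alternates around each vertex and along each edge. Declaring ends of
colour `0` outgoing and those of colour `1` incoming gives the orientation. -/
theorem IsPlanar.exists_sourceSink [Fintype κ] (hD : IsPlanar D) :
    Nonempty (SourceSink D.ends) := by
  classical
  obtain ⟨hother, heuler⟩ := hD
  choose b hb hb' using fun s => (hother s)
  have hbb : ∀ s, b (b s) = s := fun s =>
    (hb' (b s) s ⟨(hb s).1.symm, (hb s).2.symm⟩).symm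
  let bp : Equiv.Perm D.Slot := ⟨b, b, hbb, hbb⟩
  have hedge : ∀ s t, D.edge t = D.edge s ↔ t = s ∨ t = b s := by
    intro s t
    constructor
    · intro h
      by_cases hts : t = s
      · exact Or.inl hts
      · exact Or.inr (hb' s t ⟨hts, h⟩)
    · rintro (rfl | rfl)
      · rfl
      · exact (hb s).2
  have hface : (fun s t : D.Slot => ∃ u, OtherEnd D s u ∧ t = next D u) =
      fun s t => t = next D (b s) := by
    funext s t
    refine propext ⟨?_, fun h => ⟨b s, hb s, h⟩⟩
    rintro ⟨u, hu, rfl⟩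
    rw [hb' s u hu]
  rw [Faces, hface] at heuler
  obtain ⟨o, hoa, hob⟩ := exists_coloring D.turnPerm bp D.edge hbb (fun s => (hb s).1) hedge
    D.sum_eq_zero_of_invariant heuler
  have hok : ∀ v k, o (D.slot (v, k + 1)) = o (D.slot (v, k)) + 1 := by
    intro v k
    have two : ∀ x : ZMod 2, x = x + 1 + 1 := by decide
    rcases D.next_slot v k with h' | h'
    · rw [← h']
      exact hoa _
    · rw [h']
      exact (two _).trans (congrArg (· + 1) (hoa _).symm)
  have bool : ∀ x : ZMod 2, ∃ w : Bool, x = if w then 1 else 0 := by decide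
  choose ω hω using fun v => bool (o (D.slot (v, 0)))
  have col : ∀ v w i, o (D.slot (v, position w i)) = if w = ω v then 0 else 1 := by
    intro v w i
    have h1 := hok v 0
    have h2 := hok v 1
    have h3 := hok v 2
    simp only [show (0 : Fin 4) + 1 = 1 from rfl, show (1 : Fin 4) + 1 = 2 from rfl,
      show (2 : Fin 4) + 1 = 3 from rfl] at h1 h2 h3
    rw [h2, h1] at h3
    rw [h1] at h2
    rw [hω] at h1 h2 h3
    cases w <;> cases i <;> simp only [position, hω, h1, h2, h3] <;> generalize ω v = z <;>
      revert z <;> decide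
  have hpos : ∀ w, Function.Injective (position w) := by decide
  have hpos' : ∀ k, ∃ w i, k = position w i := by decide
  have equiv : ∀ (c : Bool), ∃ e : D.Vert × Bool ≃ {s // o s = if c then 1 else 0},
      ∀ y, (e y).1 = D.slot (y.1, position (c ^^ ω y.1) y.2) := by
    intro c
    let f : D.Vert × Bool → {s // o s = if c then 1 else 0} := fun y =>
      ⟨D.slot (y.1, position (c ^^ ω y.1) y.2), by
        rw [col]; cases c <;> simp⟩
    have hf : Function.Bijective f := by
      constructor
      · rintro ⟨v, i⟩ ⟨v', i'⟩ h
        have h' := D.slot.injective (congrArg Subtype.val h)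
        obtain ⟨rfl, h''⟩ := Prod.mk.inj h'
        exact Prod.ext rfl (hpos _ h'')
      · rintro ⟨s, hs⟩
        obtain ⟨⟨v, k⟩, rfl⟩ := D.slot.surjective s
        obtain ⟨w, i, rfl⟩ := hpos' k
        rw [col] at hs
        have : w = (c ^^ ω v) := by
          have key : ∀ c w z : Bool, ((if w = z then 0 else 1 : ZMod 2) = if c then 1 else 0) →
            w = (c ^^ z) := by decide
          exact key _ _ _ hs
        exact ⟨(v, i), Subtype.ext (by simp only [f, this])⟩
    exact ⟨Equiv.ofBijective f hf, fun y => rfl⟩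
  obtain ⟨e, he⟩ := equiv false
  obtain ⟨e', he'⟩ := equiv true
  have hbo : ∀ s, (o s = if false then 1 else 0) ↔ (o (bp s) = if true then 1 else 0) := by
    intro s
    have : o (bp s) = o s + 1 := hob s
    rw [this]
    generalize o s = x
    revert x
    decide
  refine ⟨⟨ω, e.trans ((bp.subtypeEquiv hbo).trans e'.symm), fun y => ?_, fun y y' h => ?_⟩⟩
  · have h1 := he' ((e.trans ((bp.subtypeEquiv hbo).trans e'.symm)) y)
    have h2 := he y
    simp only [Bool.true_xor, Bool.false_xor] at h1 h2
    rw [ends, ← h1, ends, ← h2]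
    simp only [Equiv.trans_apply, Equiv.apply_symm_apply, Equiv.subtypeEquiv_apply]
    exact (hb _).2
  · have h1 := he y
    have h2 := he y'
    simp only [Bool.false_xor] at h1 h2
    rw [ends, ends, ← h1, ← h2] at h
    rcases (hedge _ _).1 h with h | h
    · exact e.injective (Subtype.ext h)
    · have h3 := (e y).2
      have h4 := (e y').2
      have h5 : o (b (e y').1) = o (e y').1 + 1 := hob _
      rw [h, h5, h4] at h3
      exact absurd h3 (by decide)

end PTangle

end Tangle

namespace Tangle

open Relation Diagram PTangle SourceSink

/-! ### Planar diagrams have integral invariants -/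

/-- The phase of the weight of a state of given sign. -/
noncomputable def phase (ε : ℤˣ) : ℂ := if ε = 1 then 1 else Complex.I

/-- Since `(-i)² = -1`, the square of the weight is the sign of the state; so the weight is `±1` or
`±i`. -/
theorem wt_eq_phase_mul {X : Type} [Fintype X] (σ : X → Bool) :
    ∃ k : ℤ, wt σ = phase (∏ x, sgn (σ x)) * k := by
  have h : wt σ ^ 2 = (((∏ x, sgn (σ x) : ℤˣ) : ℤ) : ℂ) := by
    rw [wt, ← Finset.prod_pow, Units.coe_prod, Int.cast_prod]
    refine Fintype.prod_congr _ _ fun x => ?_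
    cases σ x <;> simp [sgn]
  rcases Int.units_eq_one_or (∏ x, sgn (σ x)) with h' | h'
  · rw [h'] at h ⊢
    have : wt σ ^ 2 = 1 ^ 2 := by simpa using h
    rcases sq_eq_sq_iff_eq_or_eq_neg.1 this with h'' | h''
    · exact ⟨1, by simp [h'', phase]⟩
    · exact ⟨-1, by simp [h'', phase]⟩
  · rw [h'] at h ⊢
    have : wt σ ^ 2 = Complex.I ^ 2 := by simpa using h
    have hne : (-1 : ℤˣ) ≠ 1 := by decide
    rcases sq_eq_sq_iff_eq_or_eq_neg.1 this with h'' | h''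
    · exact ⟨1, by simp [h'', phase, hne]⟩
    · exact ⟨-1, by simp [h'', phase, hne]⟩

theorem stateSum_eq_phase_mul {X : Type} [Fintype X] {P : (X → Bool) → Prop} {ε : ℤˣ}
    (h : ∀ σ, P σ → ∏ x, sgn (σ x) = ε) : ∃ k : ℤ, stateSum P = phase ε * k := by
  classical
  choose k hk using wt_eq_phase_mul (X := X)
  refine ⟨∑ σ, if P σ then k σ else 0, ?_⟩
  rw [stateSum, Int.cast_sum, Finset.mul_sum]
  refine Fintype.sum_congr _ _ fun σ => ?_
  by_cases hσ : P σ
  · rw [if_pos hσ, if_pos hσ, hk, h σ hσ]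
  · rw [if_neg hσ, if_neg hσ, Int.cast_zero, mul_zero]

namespace PTangle

variable {κ : Type} (D : PTangle κ)

/-- The names of the endpoints on the outer boundary and at the holes. -/
def endpoint : Unit ⊕ κ → Fin 4 → Fin 4 ⊕ κ × Fin 4
  | Sum.inl _, k => Sum.inl k
  | Sum.inr h, k => Sum.inr (h, k)

theorem splitRel_elim (σ : D.X → Bool) (τ : Unit ⊕ κ → Bool) (e e' : D.E) :
    SplitRel D.ends (Sum.elim σ τ) e e' ↔
      D.StateRel σ e e' ∨ SplitRel (fun v k => D.bd (endpoint v k)) τ e e' := by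
  rw [SplitRel, Sum.exists]
  refine or_congr Iff.rfl ?_
  rw [SplitRel, Sum.exists, Sum.exists]
  rfl

end PTangle

theorem Reached.total {α γ : Type} {S : α → α → Prop} {v : γ → α} {l : List (α × α)}
    (h : Reached S v) (g₀ : γ) (hl : ∀ g, EqvGen (Adj S l) (v g) (v g₀)) : Total (Adj S l) := by
  have key : ∀ x, EqvGen (Adj S l) x (v g₀) := fun x => by
    obtain ⟨g, hg⟩ := h x
    exact (eqvGen_map id (fun _ _ => Adj.left) hg).trans _ _ _ (hl g)
  exact fun x y => (key x).trans _ _ _ (key y).symm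

theorem reached_of_total {α γ : Type} {S : α → α → Prop} {v : γ → α} {l : List (α × α)}
    (h : Total (Adj S l)) (g₀ : γ) (hl : ∀ x y, (x, y) ∈ l → ∃ g g', x = v g ∧ y = v g') :
    Reached S v := by
  have key : ∀ x y, EqvGen (Adj S l) x y →
      ((∃ g, EqvGen S x (v g)) ↔ ∃ g, EqvGen S y (v g)) := by
    intro x y hxy
    induction hxy with
    | rel x y hxy =>
      rcases hxy with hxy | hxy
      · have hxy' : EqvGen S x y := .rel _ _ hxy
        exact ⟨fun ⟨g, hg⟩ => ⟨g, hxy'.symm.trans _ _ _ hg⟩,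
          fun ⟨g, hg⟩ => ⟨g, hxy'.trans _ _ _ hg⟩⟩
      · obtain ⟨g, g', rfl, rfl⟩ := hl _ _ hxy
        exact iff_of_true ⟨g, .refl _⟩ ⟨g', .refl _⟩
    | refl => exact Iff.rfl
    | symm _ _ _ ih => exact ih.symm
    | trans _ _ _ _ _ ih ih' => exact ih.trans ih'
  exact fun y => (key y (v g₀) (h _ _)).2 ⟨g₀, .refl _⟩

/-- By `hex` the four points cannot all lie in one class that exhausts `S`. So when all of `S` is
reached, its partition of the four points is exactly that of two horizontal arcs, which is detected
by the vertical closure being connected. -/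
theorem total_glue_iff_of_connected {α α' : Type} {R : α → α → Prop} {S : α' → α' → Prop}
    {u : Fin 4 → α} {v : Fin 4 → α'} (h₁ : EqvGen S (v 0) (v 1)) (h₂ : EqvGen S (v 3) (v 2))
    (hex : ¬ (Total (Adj S [(v 0, v 1), (v 3, v 2)]) ∧ Total (Adj S [(v 0, v 3), (v 1, v 2)]))) :
    Total (Glue R S u v) ↔
      (Total (Adj S [(v 0, v 3), (v 1, v 2)]) ∧ Total (Adj R [(u 0, u 1), (u 3, u 2)])) ∨
        (Total (Adj S [(v 0, v 1), (v 3, v 2)]) ∧ Total (Adj R [(u 0, u 3), (u 1, u 2)])) := by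
  have : Nonempty α := ⟨u 0⟩
  have lift : ∀ {l : List (α' × α')} {x y}, EqvGen S x y → EqvGen (Adj S l) x y :=
    fun h => eqvGen_map id (fun _ _ => Adj.left) h
  rw [total_glue_iff]
  constructor
  · rintro ⟨hr, ht⟩
    have h03 : EqvGen (Adj S [(v 0, v 3), (v 1, v 2)]) (v 0) (v 3) := Adj.fst
    have hv : Total (Adj S [(v 0, v 3), (v 1, v 2)]) := by
      refine hr.total 0 fun g => ?_
      fin_cases g
      · exact .refl _
      · exact (lift h₁).symm
      · exact (lift h₂).symm.trans _ _ _ h03.symm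
      · exact h03.symm
    have hn : ¬ EqvGen S (v 0) (v 3) := fun h03' => hex ⟨hr.total 0 fun g => by
      fin_cases g
      · exact .refl _
      · exact (lift h₁).symm
      · exact (lift h₂).symm.trans _ _ _ (lift h03').symm
      · exact (lift h03').symm, hv⟩
    refine Or.inl ⟨hv, ht.mono ?_⟩
    rintro x y (hxy | ⟨g, g', hg, rfl, rfl⟩)
    · exact Adj.left hxy
    · have hg' : EqvGen S (v g) (v g') := hg
      fin_cases g <;> fin_cases g'
      · exact .refl _
      · exact Adj.fst
      · exact absurd (hg'.trans _ _ _ h₂.symm) hn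
      · exact absurd hg' hn
      · exact Adj.fst.symm
      · exact .refl _
      · exact absurd (h₁.trans _ _ _ (hg'.trans _ _ _ h₂.symm)) hn
      · exact absurd (h₁.trans _ _ _ hg') hn
      · exact absurd (hg'.symm.trans _ _ _ h₂.symm) hn
      · exact absurd (h₁.trans _ _ _ (hg'.symm.trans _ _ _ h₂.symm)) hn
      · exact .refl _
      · exact (Adj.right (by simp)).symm
      · exact absurd hg'.symm hn
      · exact absurd (h₁.trans _ _ _ hg'.symm) hn
      · exact Adj.right (by simp)
      · exact .refl _
  · rintro (⟨hv, ht⟩ | ⟨hh, -⟩)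
    · refine ⟨reached_of_total hv 0 fun x y hxy => ?_, ht.mono ?_⟩
      · simp only [List.mem_cons, Prod.mk.injEq, List.not_mem_nil, or_false] at hxy
        rcases hxy with ⟨rfl, rfl⟩ | ⟨rfl, rfl⟩
        · exact ⟨0, 3, rfl, rfl⟩
        · exact ⟨1, 2, rfl, rfl⟩
      · rintro x y (hxy | hxy)
        · exact With.left hxy
        · simp only [List.mem_cons, Prod.mk.injEq, List.not_mem_nil, or_false] at hxy
          rcases hxy with ⟨rfl, rfl⟩ | ⟨rfl, rfl⟩
          · exact With.right h₁
          · exact With.right h₂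
    · refine absurd ⟨hh, hh.mono ?_⟩ hex
      rintro x y (hxy | hxy)
      · exact Adj.left hxy
      · simp only [List.mem_cons, Prod.mk.injEq, List.not_mem_nil, or_false] at hxy
        rcases hxy with ⟨rfl, rfl⟩ | ⟨rfl, rfl⟩
        · exact lift h₁
        · exact lift h₂

/-- Glueing relations along four points which are not connected crosswise on one side. -/
theorem total_glue_iff_of_noncrossing {α α' : Type} {R : α → α → Prop} {S : α' → α' → Prop}
    {u : Fin 4 → α} {v : Fin 4 → α'}
    (hS : (EqvGen S (v 0) (v 1) ∧ EqvGen S (v 3) (v 2)) ∨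
      (EqvGen S (v 0) (v 3) ∧ EqvGen S (v 1) (v 2)))
    (hex : ¬ (Total (Adj S [(v 0, v 1), (v 3, v 2)]) ∧ Total (Adj S [(v 0, v 3), (v 1, v 2)]))) :
    Total (Glue R S u v) ↔
      (Total (Adj S [(v 0, v 3), (v 1, v 2)]) ∧ Total (Adj R [(u 0, u 1), (u 3, u 2)])) ∨
        (Total (Adj S [(v 0, v 1), (v 3, v 2)]) ∧ Total (Adj R [(u 0, u 3), (u 1, u 2)])) := by
  rcases hS with ⟨h₁, h₂⟩ | ⟨h₁, h₂⟩
  · exact total_glue_iff_of_connected h₁ h₂ hex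
  -- Exchanging NE with SW interchanges the horizontal and the vertical pattern.
  · let ρ : Equiv.Perm (Fin 4) := Equiv.swap 1 3
    have h := total_glue_iff_of_connected (R := R) (u := u ∘ ρ) (v := v ∘ ρ) h₁ h₂
      fun h => hex ⟨h.2, h.1⟩
    rw [total_glue_comp_equiv] at h
    exact h.trans or_comm

end Tangle

/-! ### Integrality for planar ball tangles, nonemptiness of `F` for planar spherical tangles -/

namespace Tangle

open Relation Diagram PTangle SourceSink

namespace BT

/-- By `balanced` at the outside, the class of any endpoint contains as many of the endpoints `0, 2`
as of `1, 3`. This excludes the diagonal connection. -/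
theorem endpoints_noncrossing {B : BT} (hB : IsPlanar B) (σ : B.X → Bool) :
    let v := fun k => B.bd (Sum.inl k)
    (EqvGen (B.StateRel σ) (v 0) (v 1) ∧ EqvGen (B.StateRel σ) (v 3) (v 2)) ∨
      (EqvGen (B.StateRel σ) (v 0) (v 3) ∧ EqvGen (B.StateRel σ) (v 1) (v 2)) := by
  classical
  intro v
  obtain ⟨o⟩ := hB.exists_sourceSink
  have key : ∀ g : Fin 4,
      (if EqvGen (B.StateRel σ) (v 0) (v g) then (1 : ℤ) else 0) +
        (if EqvGen (B.StateRel σ) (v 2) (v g) then 1 else 0) =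
      (if EqvGen (B.StateRel σ) (v 1) (v g) then 1 else 0) +
        (if EqvGen (B.StateRel σ) (v 3) (v g) then 1 else 0) := by
    intro g
    refine o.balanced (fun e => EqvGen (B.StateRel σ) e (v g))
      (Sum.elim σ fun _ => true) (Sum.inr (Sum.inl ())) fun x hx => ?_
    rcases x with x | ⟨⟨⟩⟩ | x
    · have hrel : ∀ {e e'}, B.StateRel σ e e' →
          (EqvGen (B.StateRel σ) e (v g) ↔ EqvGen (B.StateRel σ) e' (v g)) := fun {e e'} h =>
        have h' : EqvGen (B.StateRel σ) e e' := .rel _ _ h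
        ⟨fun h'' => h'.symm.trans _ _ _ h'', fun h'' => h'.trans _ _ _ h''⟩
      cases hσ : σ x
      · simp only [Sum.elim_inl, hσ, Bool.false_eq_true, if_false]
        exact ⟨hrel ⟨x, Or.inr ⟨hσ, Or.inl ⟨rfl, rfl⟩⟩⟩, hrel ⟨x, Or.inr ⟨hσ, Or.inr ⟨rfl, rfl⟩⟩⟩⟩
      · simp only [Sum.elim_inl, hσ, if_true]
        exact ⟨hrel ⟨x, Or.inl ⟨hσ, Or.inl ⟨rfl, rfl⟩⟩⟩, hrel ⟨x, Or.inl ⟨hσ, Or.inr ⟨rfl, rfl⟩⟩⟩⟩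
    · exact absurd rfl hx
    · exact x.elim
  have h0 := key 0
  have h2 := key 2
  rw [if_pos (EqvGen.refl _)] at h0
  rw [if_pos (EqvGen.refl (v 2))] at h2
  by_cases h10 : EqvGen (B.StateRel σ) (v 1) (v 0)
  · by_cases h32 : EqvGen (B.StateRel σ) (v 3) (v 2)
    · exact Or.inl ⟨h10.symm, h32⟩
    · rw [if_neg h32] at h2
      have h12 : EqvGen (B.StateRel σ) (v 1) (v 2) := by
        by_contra h
        rw [if_neg h] at h2
        split_ifs at h2
        all_goals omega
      have h20 : EqvGen (B.StateRel σ) (v 2) (v 0) := h12.symm.trans _ _ _ h10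
      rw [if_pos h20, if_pos h10] at h0
      refine Or.inr ⟨?_, h12⟩
      by_contra h
      rw [if_neg fun h' => h h'.symm] at h0
      omega
  · rw [if_neg h10] at h0
    have h30 : EqvGen (B.StateRel σ) (v 3) (v 0) := by
      by_contra h
      rw [if_neg h] at h0
      split_ifs at h0
      all_goals omega
    refine Or.inr ⟨h30.symm, ?_⟩
    by_contra h12
    rw [if_neg h12] at h2
    have h32 : EqvGen (B.StateRel σ) (v 3) (v 2) := by
      by_contra h
      rw [if_neg h] at h2
      split_ifs at h2
      all_goals omega
    have h20 : EqvGen (B.StateRel σ) (v 2) (v 0) := h32.symm.trans _ _ _ h30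
    rw [if_pos h20, if_pos h30] at h0
    omega

theorem total_closure_iff (B : BT) (σ : B.X → Bool) (t : Bool) :
    Total (SplitRel B.ends (Sum.elim σ fun _ => t)) ↔ Total (Adj (B.StateRel σ)
      (if t = true then [(B.bd (Sum.inl 0), B.bd (Sum.inl 1)), (B.bd (Sum.inl 3), B.bd (Sum.inl 2))]
        else [(B.bd (Sum.inl 0), B.bd (Sum.inl 3)), (B.bd (Sum.inl 1), B.bd (Sum.inl 2))])) := by
  refine total_congr (fun e e' h => ?_) (fun e e' h => ?_)
  · rcases (splitRel_elim B σ _ e e').1 h with h | ⟨⟨⟩ | x, h⟩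
    · exact Adj.left h
    · rcases h with ⟨rfl, ⟨rfl, rfl⟩ | ⟨rfl, rfl⟩⟩ | ⟨rfl, ⟨rfl, rfl⟩ | ⟨rfl, rfl⟩⟩
      · exact Adj.fst
      · exact (Adj.right (by simp [endpoint])).symm
      · exact Adj.right (by simp [endpoint])
      · exact Adj.fst.symm
    · exact x.elim
  · have key : ∀ {e e'}, SplitRel (fun v k => B.bd (endpoint v k)) (fun _ => t) e e' →
        EqvGen (SplitRel B.ends (Sum.elim σ fun _ => t)) e e' := fun h =>
      .rel _ _ ((splitRel_elim B σ _ _ _).2 (Or.inr h))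
    rcases h with h | h
    · exact .rel _ _ ((splitRel_elim B σ _ _ _).2 (Or.inl h))
    · cases t <;> simp only [if_true, if_false, Bool.false_eq_true, List.mem_cons, Prod.mk.injEq,
        List.not_mem_nil, or_false] at h <;> rcases h with ⟨rfl, rfl⟩ | ⟨rfl, rfl⟩
      · exact (key ⟨Sum.inl (), Or.inr ⟨rfl, Or.inr ⟨rfl, rfl⟩⟩⟩).symm
      · exact key ⟨Sum.inl (), Or.inr ⟨rfl, Or.inl ⟨rfl, rfl⟩⟩⟩
      · exact key ⟨Sum.inl (), Or.inl ⟨rfl, Or.inl ⟨rfl, rfl⟩⟩⟩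
      · exact (key ⟨Sum.inl (), Or.inl ⟨rfl, Or.inr ⟨rfl, rfl⟩⟩⟩).symm

theorem integral_of_isPlanar {B : BT} (hB : IsPlanar B) : Integral B := by
  classical
  obtain ⟨o⟩ := hB.exists_sourceSink
  obtain ⟨c, hc⟩ := o.exists_sign
  set v : Fin 4 → B.E := fun k => B.bd (Sum.inl k)
  -- The states that look like horizontal arcs are recognised by their vertical closure being a
  -- single circle, and vice versa. The two closures are opposite splittings at the outside, so the
  -- signs `-c` and `c` differ and no state is of both kinds.
  let H : (B.X → Bool) → Prop := fun σ => Total (Adj (B.StateRel σ) [(v 0, v 3), (v 1, v 2)])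
  let V : (B.X → Bool) → Prop := fun σ => Total (Adj (B.StateRel σ) [(v 0, v 1), (v 3, v 2)])
  have hH : ∀ σ, H σ → ∏ x, sgn (σ x) = -c := fun σ hσ => by
    have := hc _ ((total_closure_iff B σ false).2 hσ)
    rw [← this, Fintype.prod_sum_type, Fintype.prod_sum_type]
    simp only [Sum.elim_inl, Sum.elim_inr, Finset.univ_unique, Finset.prod_singleton,
      Finset.univ_eq_empty, Finset.prod_empty]
    simp [sgn]
  have hV : ∀ σ, V σ → ∏ x, sgn (σ x) = c := fun σ hσ => by
    have := hc _ ((total_closure_iff B σ true).2 hσ)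
    rw [← this, Fintype.prod_sum_type, Fintype.prod_sum_type]
    simp only [Sum.elim_inl, Sum.elim_inr, Finset.univ_unique, Finset.prod_singleton,
      Finset.univ_eq_empty, Finset.prod_empty]
    simp [sgn]
  have hne : ∀ c : ℤˣ, c ≠ -c := by decide
  have hex : ∀ σ, ¬ (V σ ∧ H σ) := fun σ ⟨h, h'⟩ => hne c ((hV σ h).symm.trans (hH σ h'))
  have hexp : OuterExpands B (stateSum H) (stateSum V) := by
    intro α R u
    rw [stateSum_eq_ind, mul_comm, mul_comm (stateSum V), ← sum_wt_mul_ind]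
    refine Fintype.sum_congr _ _ fun σ => ?_
    have h := total_glue_iff_of_noncrossing (R := R) (u := u) (endpoints_noncrossing hB σ) (hex σ)
    congr 1
    refine (ind_congr h).trans ?_
    by_cases h1 : H σ
    · have h2 : ¬ V σ := fun h2 => hex σ ⟨h2, h1⟩
      rw [ind_true h1, ind_false h2, mul_one, mul_zero, add_zero]
      exact ind_congr ⟨fun h => h.elim And.right fun h => absurd h.1 h2, fun h => Or.inl ⟨h1, h⟩⟩
    · by_cases h2 : V σ
      · rw [ind_true h2, ind_false h1, mul_one, mul_zero, zero_add]
        exact ind_congr ⟨fun h => h.elim (fun h => absurd h.1 h1) And.right,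
          fun h => Or.inr ⟨h2, h⟩⟩
      · rw [ind_false h1, ind_false h2, mul_zero, mul_zero, add_zero]
        exact ind_false fun h => h.elim (fun h => h1 h.1) fun h => h2 h.1
  obtain ⟨m, hm⟩ := stateSum_eq_phase_mul hH
  obtain ⟨n, hn⟩ := stateSum_eq_phase_mul hV
  rw [hm, hn] at hexp
  have hone : (-1 : ℤˣ) ≠ 1 := by decide
  -- Of the two coefficients one is an integer and the other `i` times an integer; in the first case
  -- the unit `w = i` puts the imaginary one first.
  rcases Int.units_eq_one_or c with rfl | rfl
  · refine ⟨Complex.I, m, -n, I_pow_eight, ?_⟩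
    rw [phase, if_neg hone, phase, if_pos rfl] at hexp
    rw [Complex.I_mul_I, Int.cast_neg, neg_mul_neg]
    exact hexp
  · refine ⟨1, m, n, one_pow _, ?_⟩
    rw [neg_neg, phase, if_pos rfl, phase, if_neg hone] at hexp
    rw [one_mul Complex.I]
    exact hexp

end BT

namespace ST

theorem conn_closing_iff (S : ST) (σ : S.X → Bool) (i j : Fin 2) :
    Total (SplitRel S.ends (Sum.elim σ (Sum.elim (fun _ => decide (i = 0)) fun _ =>
      decide (j = 1)))) ↔ S.Conn σ (closing i j) := by
  rw [Conn]
  refine total_congr (fun e e' h => ?_) (fun e e' h => ?_)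
  · have key : ∀ {p q}, (p, q) ∈ closingPairs i j → EqvGen (S.Rel σ (closing i j)) (S.bd p)
      (S.bd q) := fun {p q} h =>
        .rel _ _ (Or.inr ⟨p, q, (closing_iff i j p q).2 h, rfl, rfl⟩)
    rcases (splitRel_elim S σ _ e e').1 h with hr | ⟨⟨⟩ | ⟨⟨⟩⟩, hr⟩
    · exact .rel _ _ (Or.inl hr)
    · rcases hr with ⟨hs, h'⟩ | ⟨hs, h'⟩ <;>
        simp only [Sum.elim_inl, decide_eq_true_eq, decide_eq_false_iff_not] at hs <;>
        rcases h' with ⟨rfl, rfl⟩ | ⟨rfl, rfl⟩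
      · exact key (by simp [closingPairs, outerPairs, hs, endpoint])
      · exact (key (by simp [closingPairs, outerPairs, hs, endpoint])).symm
      · exact key (by simp [closingPairs, outerPairs, hs, endpoint])
      · exact (key (by simp [closingPairs, outerPairs, hs, endpoint])).symm
    · rcases hr with ⟨hs, h'⟩ | ⟨hs, h'⟩ <;>
        simp only [Sum.elim_inr, decide_eq_true_eq, decide_eq_false_iff_not] at hs <;>
        rcases h' with ⟨rfl, rfl⟩ | ⟨rfl, rfl⟩
      · exact key (by simp [closingPairs, holePairs, fillPairs, hs, endpoint])
      · exact (key (by simp [closingPairs, holePairs, fillPairs, hs, endpoint])).symm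
      · exact key (by simp [closingPairs, holePairs, fillPairs, show j = 0 by omega, endpoint])
      · exact (key (by
          simp [closingPairs, holePairs, fillPairs, show j = 0 by omega, endpoint])).symm
  · have key : ∀ {e e'}, SplitRel (fun v k => S.bd (endpoint v k)) (Sum.elim
        (fun _ => decide (i = 0)) fun _ => decide (j = 1)) e e' →
        EqvGen (SplitRel S.ends (Sum.elim σ (Sum.elim (fun _ => decide (i = 0)) fun _ =>
          decide (j = 1)))) e e' := fun h =>
      .rel _ _ ((splitRel_elim S σ _ _ _).2 (Or.inr h))
    rcases h with h | ⟨p, q, h, rfl, rfl⟩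
    · exact .rel _ _ ((splitRel_elim S σ _ _ _).2 (Or.inl h))
    · rcases List.mem_append.1 ((closing_iff i j p q).1 h) with h | h
      · by_cases hi : i = 0
        · simp [outerPairs, hi] at h
          rcases h with ⟨rfl, rfl⟩ | ⟨rfl, rfl⟩
          · exact key ⟨Sum.inl (), Or.inl ⟨by simp [hi], Or.inl ⟨rfl, rfl⟩⟩⟩
          · exact (key ⟨Sum.inl (), Or.inl ⟨by simp [hi], Or.inr ⟨rfl, rfl⟩⟩⟩).symm
        · simp [outerPairs, hi] at h
          rcases h with ⟨rfl, rfl⟩ | ⟨rfl, rfl⟩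
          · exact (key ⟨Sum.inl (), Or.inr ⟨by simp [hi], Or.inr ⟨rfl, rfl⟩⟩⟩).symm
          · exact key ⟨Sum.inl (), Or.inr ⟨by simp [hi], Or.inl ⟨rfl, rfl⟩⟩⟩
      · by_cases hj : j = 0
        · simp [fillPairs, hj] at h
          rcases h with ⟨rfl, rfl⟩ | ⟨rfl, rfl⟩
          · exact (key ⟨Sum.inr (), Or.inr ⟨by simp [hj], Or.inr ⟨rfl, rfl⟩⟩⟩).symm
          · exact key ⟨Sum.inr (), Or.inr ⟨by simp [hj], Or.inl ⟨rfl, rfl⟩⟩⟩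
        · have hj' : j = 1 := by omega
          simp [fillPairs, hj] at h
          rcases h with ⟨rfl, rfl⟩ | ⟨rfl, rfl⟩
          · exact key ⟨Sum.inr (), Or.inl ⟨by simp [hj'], Or.inl ⟨rfl, rfl⟩⟩⟩
          · exact (key ⟨Sum.inr (), Or.inl ⟨by simp [hj'], Or.inr ⟨rfl, rfl⟩⟩⟩).symm

/-- Changing either the closure or the filling flips the parity of one-circle states, so diagonal
and off-diagonal entries differ in phase by a factor `i`. The factors `∓i` in the definition of `F`
compensate exactly this. -/
theorem exists_mem_F_of_isPlanar {S : ST} (hS : IsPlanar S) : ∃ N, N ∈ F S := by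
  obtain ⟨o⟩ := hS.exists_sourceSink
  obtain ⟨c, hc⟩ := o.exists_sign
  have key : ∀ i j : Fin 2, ∃ m : ℤ, S.entry i j =
      phase (c * (sgn (decide (i = 0)) * sgn (decide (j = 1)))) * m := by
    intro i j
    refine stateSum_eq_phase_mul fun σ hσ => ?_
    rw [← hc _ ((conn_closing_iff S σ i j).2 hσ), Fintype.prod_sum_type, Fintype.prod_sum_type]
    simp only [Sum.elim_inl, Sum.elim_inr, Finset.univ_unique, Finset.prod_singleton]
    rw [mul_assoc, Int.units_mul_self, mul_one]
  obtain ⟨m₀₀, h₀₀⟩ := key 0 0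
  obtain ⟨m₀₁, h₀₁⟩ := key 0 1
  obtain ⟨m₁₀, h₁₀⟩ := key 1 0
  obtain ⟨m₁₁, h₁₁⟩ := key 1 1
  have hone : (-1 : ℤˣ) ≠ 1 := by decide
  simp [sgn, phase] at h₀₀ h₀₁ h₁₀ h₁₁
  rcases Int.units_eq_one_or c with rfl | rfl
  · simp [hone] at h₀₀ h₀₁ h₁₀ h₁₁
    refine ⟨!![-m₀₀, m₀₁; -m₁₀, -m₁₁], (mem_F_iff_entry S _).2
      ⟨Complex.I, BT.I_pow_eight, ?_, ?_, ?_, ?_⟩⟩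
    · simp [h₀₀, ← mul_assoc]
    · simp [h₀₁]
    · simp [h₁₀]
    · simp [h₁₁, ← mul_assoc]
  · simp [hone] at h₀₀ h₀₁ h₁₀ h₁₁
    refine ⟨!![m₀₀, m₀₁; -m₁₀, m₁₁], (mem_F_iff_entry S _).2
      ⟨1, one_pow _, ?_, ?_, ?_, ?_⟩⟩
    · simp [h₀₀]
    · simp [h₀₁, ← mul_assoc]
    · simp [h₁₀, ← mul_assoc]
    · simp [h₁₁]

end ST

end Tangle

namespace Tangle

/-! ### Determinants of reducible spherical tangles -/

theorem Op.apply_cases {op : Op} {P Q R : Piece} (h : op.apply P Q = some R) :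
    (∃ B B' B'', P = .ball B ∧ Q = .ball B' ∧ R = .ball B'' ∧
      (BT.Integral B → BT.Integral B' → BT.Integral B'')) ∨
    (∃ S B S', P = .sph S ∧ Q = .ball B ∧ R = .sph S' ∧
      (BT.Integral B → ST.SquareMultiple S S')) ∨
    (∃ B S S', P = .ball B ∧ Q = .sph S ∧ R = .sph S' ∧
      (BT.Integral B → ST.SquareMultiple S S')) := by
  rcases P with B | S <;> rcases Q with B' | S'
  · cases op <;> simp only [Op.apply, Piece.outerH, Piece.outerV, Piece.innerH, Piece.innerV,
      Option.some.injEq, reduceCtorEq] at h <;> subst h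
    · exact Or.inl ⟨_, _, _, rfl, rfl, rfl, .hsum⟩
    · exact Or.inl ⟨_, _, _, rfl, rfl, rfl, fun h h' => .hsum h' h⟩
    · exact Or.inl ⟨_, _, _, rfl, rfl, rfl, .vsum⟩
    · exact Or.inl ⟨_, _, _, rfl, rfl, rfl, fun h h' => .vsum h' h⟩
  · cases op <;> simp only [Op.apply, Piece.outerH, Piece.outerV, Piece.innerH, Piece.innerV,
      Option.some.injEq] at h <;> subst h
    · exact Or.inr (Or.inr ⟨_, _, _, rfl, rfl, rfl, ST.squareMultiple_outerH₁ _⟩)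
    · exact Or.inr (Or.inr ⟨_, _, _, rfl, rfl, rfl, ST.squareMultiple_outerH₂ _⟩)
    · exact Or.inr (Or.inr ⟨_, _, _, rfl, rfl, rfl, ST.squareMultiple_outerV₁ _⟩)
    · exact Or.inr (Or.inr ⟨_, _, _, rfl, rfl, rfl, ST.squareMultiple_outerV₂ _⟩)
    · exact Or.inr (Or.inr ⟨_, _, _, rfl, rfl, rfl, ST.squareMultiple_innerH₁ _⟩)
    · exact Or.inr (Or.inr ⟨_, _, _, rfl, rfl, rfl, ST.squareMultiple_innerH₂ _⟩)
    · exact Or.inr (Or.inr ⟨_, _, _, rfl, rfl, rfl, ST.squareMultiple_innerV₁ _⟩)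
    · exact Or.inr (Or.inr ⟨_, _, _, rfl, rfl, rfl, ST.squareMultiple_innerV₂ _⟩)
  · cases op <;> simp only [Op.apply, Piece.outerH, Piece.outerV, Piece.innerH, Piece.innerV,
      Option.some.injEq] at h <;> subst h
    · exact Or.inr (Or.inl ⟨_, _, _, rfl, rfl, rfl, ST.squareMultiple_outerH₂ _⟩)
    · exact Or.inr (Or.inl ⟨_, _, _, rfl, rfl, rfl, ST.squareMultiple_outerH₁ _⟩)
    · exact Or.inr (Or.inl ⟨_, _, _, rfl, rfl, rfl, ST.squareMultiple_outerV₂ _⟩)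
    · exact Or.inr (Or.inl ⟨_, _, _, rfl, rfl, rfl, ST.squareMultiple_outerV₁ _⟩)
    · exact Or.inr (Or.inl ⟨_, _, _, rfl, rfl, rfl, ST.squareMultiple_innerH₂ _⟩)
    · exact Or.inr (Or.inl ⟨_, _, _, rfl, rfl, rfl, ST.squareMultiple_innerH₁ _⟩)
    · exact Or.inr (Or.inl ⟨_, _, _, rfl, rfl, rfl, ST.squareMultiple_innerV₂ _⟩)
    · exact Or.inr (Or.inl ⟨_, _, _, rfl, rfl, rfl, ST.squareMultiple_innerV₁ _⟩)
  · cases op <;> simp [Op.apply, Piece.outerH, Piece.outerV, Piece.innerH, Piece.innerV] at h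

/-- No operation is defined on two spherical tangles, so at most one piece is spherical. Up to its
entry the partial sums are integral ball tangles; afterwards each step multiplies its determinant by
a square. -/
theorem evalSums_cases (n : ℕ) (A : Fin (n + 1) → Piece) (op : Fin n → Op)
    (hA : ∀ i, (A i).IsPlanar) (P : Piece) (h : evalSums n A op = some P) :
    (∃ B, P = .ball B ∧ BT.Integral B ∧ ∀ i, ∃ B', A i = .ball B') ∨
    (∃ S i K, P = .sph S ∧ A i = .sph K ∧ ST.SquareMultiple K S ∧
      ∀ i', i' ≠ i → ∃ B', A i' = .ball B') := by
  induction n generalizing P with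
  | zero =>
    rw [evalSums, Option.some.injEq] at h
    subst h
    rcases h0 : A 0 with B | S
    · refine Or.inl ⟨B, rfl, BT.integral_of_isPlanar ?_, fun i => ⟨B, ?_⟩⟩
      · have := hA 0
        rw [h0] at this
        exact this
      · rw [Fin.eq_zero i, h0]
    · exact Or.inr ⟨S, 0, S, rfl, h0, .refl _, fun i hi => absurd (Fin.eq_zero i) hi⟩
  | succ n ih =>
    rw [evalSums, Option.bind_eq_some_iff] at h
    obtain ⟨Q, hQ, h⟩ := h
    have ball : ∀ {B}, A (Fin.last (n + 1)) = .ball B → BT.Integral B := by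
      intro B hB
      have := hA (Fin.last (n + 1))
      rw [hB] at this
      exact BT.integral_of_isPlanar this
    rcases ih _ _ (fun i => hA _) Q hQ with ⟨B, rfl, hB, hall⟩ | ⟨S, i, K, rfl, hi, hS, hall⟩
    · rcases Op.apply_cases h with ⟨B₁, B₂, B₃, h₁, h₂, rfl, h₃⟩ | ⟨_, _, _, h₁, _⟩ |
        ⟨B₁, S, S', h₁, h₂, rfl, h₃⟩
      · cases h₁
        refine Or.inl ⟨B₃, rfl, h₃ hB (ball h₂), fun i => ?_⟩
        induction i using Fin.lastCases with
        | last => exact ⟨B₂, h₂⟩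
        | cast i => exact hall i
      · cases h₁
      · cases h₁
        refine Or.inr ⟨S', _, S, rfl, h₂, h₃ hB, fun i hi => ?_⟩
        induction i using Fin.lastCases with
        | last => exact absurd rfl hi
        | cast i => exact hall i
    · rcases Op.apply_cases h with ⟨B₁, B₂, B₃, h₁, _⟩ | ⟨S₁, B, S', h₁, h₂, rfl, h₃⟩ |
        ⟨_, _, _, h₁, _⟩
      · cases h₁
      · cases h₁
        refine Or.inr ⟨S', i.castSucc, K, rfl, hi, hS.trans (h₃ (ball h₂)), fun i' hi' => ?_⟩
        induction i' using Fin.lastCases with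
        | last => exact ⟨B, h₂⟩
        | cast i' => exact hall i' fun h => hi' (congrArg Fin.castSucc h)
      · cases h₁

theorem IsReducible.exists_det {J S : ST} (h : IsReducible J S) :
    ∃ M N : Matrix (Fin 2) (Fin 2) ℤ, ST.F S = {M, -M} ∧ ST.F J = {N, -N} ∧
      ∃ n : ℤ, M.det = n ^ 2 * N.det := by
  obtain ⟨n, A, op, S', -, hA, heval, hS, i, hi, -⟩ := h
  obtain ⟨_, h, -⟩ | ⟨T, j, K, h, hj, hK, hball⟩ := evalSums_cases n A op hA _ heval
  · cases h
  · cases h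
    -- The piece that rotates to `J` is spherical, and there is only one spherical piece.
    obtain rfl : i = j := by
      by_contra hij
      obtain ⟨B, hB⟩ := hball i hij
      rw [hB] at hi
      exact hi
    rw [hj] at hi
    obtain ⟨a, b, hJ⟩ := hi
    have hplanar := hA i
    rw [hj] at hplanar
    obtain ⟨N₀, hN₀⟩ := ST.exists_mem_F_of_isPlanar hplanar
    obtain ⟨N, hN, hdet⟩ := ST.exists_det_rotations K a b hN₀
    rw [hJ.F_eq] at hN
    obtain ⟨M, hM, n, hn⟩ := hK N₀ hN₀
    rw [← hS.F_eq] at hM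
    exact ⟨M, N, ST.F_eq_pair hM, ST.F_eq_pair hN, n, by rw [hn, hdet]⟩

end Tangle

theorem theorem4p20 :
    (∀ S : Tangle.ST, Tangle.PTangle.IsPlanar S → Tangle.IsReducible Tangle.ST.I S →
      ∃ M : Matrix (Fin 2) (Fin 2) ℤ, Tangle.ST.F S = {M, -M} ∧ ∃ n : ℤ, M.det = n ^ 2) ∧
    (∀ J S : Tangle.ST, Tangle.PTangle.IsPlanar J → Tangle.PTangle.IsPlanar S →
      Tangle.IsReducible J S →
      ∃ M N : Matrix (Fin 2) (Fin 2) ℤ, Tangle.ST.F S = {M, -M} ∧ Tangle.ST.F J = {N, -N} ∧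
        ∃ n : ℤ, M.det = n ^ 2 * N.det) := by
  refine ⟨fun S _ h => ?_, fun J S _ _ h => h.exists_det⟩
  obtain ⟨M, N, hM, hN, n, hn⟩ := h.exists_det
  refine ⟨M, hM, n, ?_⟩
  have hone := Tangle.ST.one_mem_F_I
  rw [hN] at hone
  -- `F I` contains the identity matrix, and for `2 × 2` matrices the determinant ignores the sign
  -- of `N`.
  have hdet : N.det = 1 := by
    rcases hone with h | h
    · rw [← h, Matrix.det_one]
    · rw [← neg_neg N, ← Set.mem_singleton_iff.1 h, Matrix.det_neg, Matrix.det_one]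
      simp
  rw [hn, hdet, mul_one]
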